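/- **Setting.** Let $k\ge 1$ and $M_1\ge 0$. For $\alpha_\star\in\mathbb R^n$ and $Z_\star\in\mathbb R^{n\times k}$ with rows $z_1,\dots,z_n$, put $\Theta_\star=\alpha_\star 1_n^\top+1_n\alpha_\star^\top+Z_\star Z_\star^\top$ and $G_\star=Z_\star Z_\star^\top$. Let $J=I_n-\frac1n 1_n1_n^\top$, and suppose that $JZ_\star=Z_\star$, $\max_i\|z_i\|^2\le M_1/2$, $\|\alpha_\star\|_\infty\le M_1/2$, and $-M_1\le(\Theta_\star)_{ij}\le -M_2$ for all $i\ne j$, where $M_2\ge 0$. Suppose that $Z_\star$ has rank $k$, and let $\kappa_{Z_\star}<\infty$ be the ratio of its largest to its smallest ($k$-th) singular value. One observes the adjacency matrix $A$ of a random undirected graph without self-loops: $A$ is symmetric with zero diagonal, and the entries $A_{ij}$, $i<j$, are independent Bernoulli$(P_{ij})$ variables with $\operatorname{logit}(P_{ij})=\log\frac{P_{ij}}{1-P_{ij}}=(\Theta_\star)_{ij}$. **Initialization with threshold $\tau$.** (1) Let $A=\sum_i\sigma_iu_iv_i^\top$ be a singular value decomposition, $\widetilde P=\sum_{\sigma_i\ge\tau}\sigma_iu_iv_i^\top$,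 let $\widehat P$ be the entrywise projection of $\widetilde P$ to $[\frac12e^{-M_1},\frac12]$, and let $\widehat\Theta=\operatorname{logit}((\widehat P+\widehat P^\top)/2)$ entrywise. (2) Let $\alpha^0$ minimize $\|\widehat\Theta-(\alpha1_n^\top+1_n\alpha^\top)\|_F^2$ over $\alpha\in\mathbb R^n$. (3) Let $\widehat G$ be the Frobenius-norm projection of $J(\widehat\Theta-\alpha^01_n^\top-1_n(\alpha^0)^\top)J$ to the cone of positive semidefinite matrices. (4) Let $Z^0=U_kD_k^{1/2}$, where $U_kD_kU_k^\top$ consists of the top-$k$ singular value components of $\widehat G$. **Error.** Let $$e_0=\|Z_\star\|_{\rm op}^2\min_{R\in O(k)}\|Z^0-Z_\star R\|_F^2+2\|(\alpha^0-\alpha_\star)1_n^\top\|_F^2 .$$ **Proposition.** There is a constant $c_1>0$ such that for all constants $c_0,c>0$ and all $k\ge1$, $M_1$, $\kappa$ there are $\delta>0$ and $N$, depending only on $c_0,c,k,M_1,\kappa$, with the following property. Let $n\ge N$, and let the parameters be as above with $\kappa_{Z_\star}\le\kappa$ and $\|G_\star\|_F\ge c_0n$. Then for every threshold $\tau$ with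 $1.1\sqrt n\le\tau\le\delta n$ (in particular, for any fixed $C\ge1.1$ and all large $n$, for every $\tau\in[1.1\sqrt n,C\sqrt n]$), with probability at least $1-n^{-c_1}$ the algorithm has an output, and each of its outputs $(\alpha^0,Z^0)$ satisfies the initialization condition $$e_0\le c\,e^{-2M_1}\,\|Z_\star\|_{\rm op}^4/\kappa_{Z_\star}^4 .$$ -/

import Mathlib

open MeasureTheory ProbabilityTheory

noncomputable section

namespace LatentSpace

/-- Frobenius norm of a real matrix. -/
def frobNorm {m n : ℕ} (M : Matrix (Fin m) (Fin n) ℝ) : ℝ :=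
  Real.sqrt (∑ i, ∑ j, M i j ^ 2)

/-- Operator norm of a real matrix with respect to Euclidean norms. -/
def opNorm {m n : ℕ} (M : Matrix (Fin m) (Fin n) ℝ) : ℝ :=
  ‖LinearMap.toContinuousLinearMap (Matrix.toEuclideanLin M)‖

/-- Condition number of an `n × k` matrix: its largest singular value divided by its smallest
(that is, `k`-th) singular value. It is meaningful for matrices of full column rank `k ≥ 1`. -/
def condNumber {n k : ℕ} (Z : Matrix (Fin n) (Fin k) ℝ) : ℝ :=
  (Matrix.toEuclideanLin Z).singularValues 0 / (Matrix.toEuclideanLin Z).singularValues (k - 1)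

/-- The centering matrix `J = I - (1/n) 1 1ᵀ`. -/
def centering (n : ℕ) : Matrix (Fin n) (Fin n) ℝ :=
  1 - (1 / (n : ℝ)) • Matrix.of fun _ _ => 1

/-- The matrix `α 1ᵀ`. -/
def rowConst {n : ℕ} (α : Fin n → ℝ) : Matrix (Fin n) (Fin n) ℝ :=
  Matrix.of fun i _ => α i

/-- The matrix `α 1ᵀ + 1 αᵀ`. -/
def additivePart {n : ℕ} (α : Fin n → ℝ) : Matrix (Fin n) (Fin n) ℝ :=
  rowConst α + (rowConst α).transpose

/-- `Θ = α 1ᵀ + 1 αᵀ + Z Zᵀ`, the logit matrix of the inner-product model without covariates. -/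
def logitMatrix {n k : ℕ} (α : Fin n → ℝ) (Z : Matrix (Fin n) (Fin k) ℝ) :
    Matrix (Fin n) (Fin n) ℝ :=
  additivePart α + Z * Z.transpose

/-- The parameter space of the inner-product model without covariates. -/
structure InParameterSpace {n k : ℕ} (M₁ M₂ : ℝ) (α : Fin n → ℝ)
    (Z : Matrix (Fin n) (Fin k) ℝ) : Prop where
  centered : centering n * Z = Z
  latent_le : ∀ i, ∑ l, Z i l ^ 2 ≤ M₁ / 2
  alpha_le : ∀ i, |α i| ≤ M₁ / 2
  M₂_nonneg : 0 ≤ M₂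
  lower : ∀ i j, i ≠ j → -M₁ ≤ logitMatrix α Z i j
  upper : ∀ i j, i ≠ j → logitMatrix α Z i j ≤ -M₂

/-- `A` is the random adjacency matrix of an undirected simple graph whose edges are independent,
the edge `{i, j}` being present with probability `P i j`, where `logit (P i j) = Θ i j`. -/
structure IsBernoulliNetwork {Ω : Type*} [MeasurableSpace Ω] {n : ℕ} (μ : Measure Ω)
    (Θ : Matrix (Fin n) (Fin n) ℝ) (A : Ω → Matrix (Fin n) (Fin n) ℝ) : Prop where
  measurable : ∀ i j, Measurable fun ω => A ω i j
  symm : ∀ ω i j, A ω i j = A ω j i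
  diag : ∀ ω i, A ω i i = 0
  zero_or_one : ∀ ω i j, A ω i j = 0 ∨ A ω i j = 1
  prob : ∀ i j, i < j → μ {ω | A ω i j = 1} = ENNReal.ofReal (Real.sigmoid (Θ i j))
  indep : iIndepFun (fun (e : {p : Fin n × Fin n // p.1 < p.2}) ω => A ω e.1.1 e.1.2) μ

/-- `logit x = log (x / (1 - x))`. -/
def logit (x : ℝ) : ℝ := Real.log (x / (1 - x))

/-- `B = ∑_{σᵢ ≥ τ} σᵢ uᵢ vᵢᵀ` for a singular value decomposition `A = ∑ᵢ σᵢ uᵢ vᵢᵀ`. -/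
def IsSingularValueThreshold {n : ℕ} (A : Matrix (Fin n) (Fin n) ℝ) (τ : ℝ)
    (B : Matrix (Fin n) (Fin n) ℝ) : Prop :=
  ∃ U ∈ Matrix.orthogonalGroup (Fin n) ℝ, ∃ V ∈ Matrix.orthogonalGroup (Fin n) ℝ,
    ∃ s : Fin n → ℝ, (∀ i, 0 ≤ s i) ∧
      A = U * Matrix.diagonal s * V.transpose ∧
      B = U * Matrix.diagonal (fun i => if τ ≤ s i then s i else 0) * V.transpose

/-- Entrywise projection to the interval `[e^{-M₁}/2, 1/2]` (for `M₁ ≥ 0`). -/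
def clip {n : ℕ} (M₁ : ℝ) (B : Matrix (Fin n) (Fin n) ℝ) : Matrix (Fin n) (Fin n) ℝ :=
  B.map fun x => max (Real.exp (-M₁) / 2) (min x (1 / 2))

/-- `logit ((P + Pᵀ) / 2)`, entrywise. -/
def symLogit {n : ℕ} (P : Matrix (Fin n) (Fin n) ℝ) : Matrix (Fin n) (Fin n) ℝ :=
  Matrix.of fun i j => logit ((P i j + P j i) / 2)

/-- `α` minimizes `‖T - (α 1ᵀ + 1 αᵀ)‖_F²`. -/
def IsLeastSquares {n : ℕ} (T : Matrix (Fin n) (Fin n) ℝ) (α : Fin n → ℝ) : Prop :=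
  ∀ α' : Fin n → ℝ, frobNorm (T - additivePart α) ^ 2 ≤ frobNorm (T - additivePart α') ^ 2

/-- `G` is the Frobenius-norm projection of `R` to the cone of positive semidefinite matrices. -/
def IsPSDProjection {n : ℕ} (R G : Matrix (Fin n) (Fin n) ℝ) : Prop :=
  G.PosSemidef ∧ ∀ H : Matrix (Fin n) (Fin n) ℝ, H.PosSemidef → frobNorm (G - R) ≤ frobNorm (H - R)

/-- `Z = U_k D_k^{1/2}`, where `U_k D_k U_kᵀ` consists of the top-`k` singular value components of
the positive semidefinite matrix `G` (padded by zero columns in case `k > n`). -/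
def IsTopFactor {n k : ℕ} (G : Matrix (Fin n) (Fin n) ℝ) (Z : Matrix (Fin n) (Fin k) ℝ) : Prop :=
  ∃ U ∈ Matrix.orthogonalGroup (Fin n) ℝ, ∃ d : Fin n → ℝ, (∀ i, 0 ≤ d i) ∧ Antitone d ∧
    G = U * Matrix.diagonal d * U.transpose ∧
    ∀ i l, Z i l = if h : (l : ℕ) < n then U i ⟨l, h⟩ * Real.sqrt (d ⟨l, h⟩) else 0

/-- `(α⁰, Z⁰)` is an output of the initialization by singular value thresholding, run without
covariates on the adjacency matrix `A` with latent dimension `k` and threshold `τ`. -/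
def IsSVTInit {n k : ℕ} (A : Matrix (Fin n) (Fin n) ℝ) (M₁ τ : ℝ)
    (α₀ : Fin n → ℝ) (Z₀ : Matrix (Fin n) (Fin k) ℝ) : Prop :=
  ∃ P G : Matrix (Fin n) (Fin n) ℝ,
    IsSingularValueThreshold A τ P ∧
    IsLeastSquares (symLogit (clip M₁ P)) α₀ ∧
    IsPSDProjection
      (centering n * (symLogit (clip M₁ P) - additivePart α₀) * centering n) G ∧
    IsTopFactor G Z₀

/-- `dist(Z₁, Z₂) = min_{R ∈ O(k)} ‖Z₁ - Z₂ R‖_F`. -/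
def procrustesDist {n k : ℕ} (Z₁ Z₂ : Matrix (Fin n) (Fin k) ℝ) : ℝ :=
  ⨅ R : Matrix.orthogonalGroup (Fin k) ℝ, frobNorm (Z₁ - Z₂ * (R : Matrix (Fin k) (Fin k) ℝ))

/-- The error metric
`e₀ = ‖Z⋆‖_op² · dist(Z⁰, Z⋆)² + 2 ‖(α⁰ - α⋆) 1ᵀ‖_F²` (there is no covariate term). -/
def initError {n k : ℕ} (α₀ α : Fin n → ℝ) (Z₀ Z : Matrix (Fin n) (Fin k) ℝ) : ℝ :=
  opNorm Z ^ 2 * procrustesDist Z₀ Z ^ 2 + 2 * frobNorm (rowConst (α₀ - α)) ^ 2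

/-- The initialization condition `e₀ ≤ c e^{-2 M₁} ‖Z⋆‖_op⁴ / κ⁴`, where `κ` is the condition
number of `Z⋆`. -/
def InitCondition {n k : ℕ} (c M₁ : ℝ) (α₀ α : Fin n → ℝ)
    (Z₀ Z : Matrix (Fin n) (Fin k) ℝ) : Prop :=
  initError α₀ α Z₀ Z ≤ c * Real.exp (-2 * M₁) * opNorm Z ^ 4 / condNumber Z ^ 4

end LatentSpace

end

/-! Write `A = P + W` with `P` the mean and `W` the centered noise. Since `‖G⋆‖_F ≥ c₀ n` forces
`‖Z⋆‖_op²` to be of order `n`, the right side of the initialization condition is at least a constant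
times `n²`. So it suffices to estimate the logits with squared Frobenius error at most `ε n²` for a
small fixed `ε`, and to show that the later steps of the algorithm propagate this error
continuously.

Noise. No bound on `‖W‖_op` is needed, only one even trace moment of fixed order. In the walk
expansion of the expected trace of `W^(2m)`, a walk that crosses some edge exactly once contributes
zero. Walks on at most `m` vertices are of lower order. The others traverse trees; there are at most
`4^m n^(m+1)` of them (`card_tree_walks`) and each contributes at most `(1/4)^m`, because a
Bernoulli variance is at most `1/4`. The powers of `4` cancel, which is why the noise lives at scale
`√n` and a threshold `1.1 √n` exceeds it. A covariance count and Chebyshev's inequality give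
`IsNoise.measure_trace_pow_gt_le`, with failure probability `O(1/n)`. A trace moment then bounds `‖Q
W‖_F²` by `1.04 n tr Q` plus a small multiple of `n²`, simultaneously for all projections `Q`
(`IsProj.sqNorm_mul_symm_le`).

Signal. The entries of `P` are a continuous function of node parameters in a compact set, so a
finite cover yields a block matrix of bounded rank that approximates `P` (`exists_lowRank_approx`).
`sqNorm_threshold_sub_le` combines this with the noise bound: because `1.21 > 1.05 · 1.04`, few
singular values survive beyond those of the signal, and the signal lost below `τ` costs at most a
multiple of `τ²` times the rank, which is harmless for `τ ≤ δ n`. The logit is Lipschitz on the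
clipping interval, whence `exists_logit_estimate`.

Later steps. Least squares and the cone projection are controlled by orthogonality and minimality,
the top-`k` truncation by an Eckart–Young argument, and the passage from Gram matrices to factors by
a polar decomposition (`procrustesDist_sq_le_of_gram`). These combine in `exists_initCondition`. -/

namespace LatentSpace

/-! ### Encoding of tree-like walks by a stack, and tight vertex–edge counts. -/

section Walks

variable {V : Type*}

/-- The stack obtained from the starting vertex `v` by pushing the vertices in the record `l` and
popping when there is none. -/
def decodeStack (v : V) (l : ℕ → Option V) : ℕ → List V
  | 0 => [v]
  | t + 1 => match l t with
    | some u => u :: decodeStack v l t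
    | none => (decodeStack v l t).tail

lemma decodeStack_congr (v : V) {l l' : ℕ → Option V} {t : ℕ} (h : ∀ s < t, l s = l' s) :
    decodeStack v l t = decodeStack v l' t := by
  induction t with
  | zero => rfl
  | succ t ih =>
    have := ih fun s hs => h s (by omega)
    simp only [decodeStack, h t (by omega), this]

variable [DecidableEq V]

/-- The vertex `x (t + 1)` of the walk `x` has not been visited up to time `t`. -/
def IsFresh (x : ℕ → V) (t : ℕ) : Prop := x (t + 1) ∉ (Finset.range (t + 1)).image x

instance (x : ℕ → V) (t : ℕ) : Decidable (IsFresh x t) := by unfold IsFresh; infer_instance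

/-- The record of the walk `x` at step `t`: the vertex `x (t + 1)` if it is fresh. -/
def walkLabel (x : ℕ → V) (t : ℕ) : Option V := if IsFresh x t then some (x (t + 1)) else none

/-- The edge crossed by the walk `x` at step `t`. -/
def walkEdge (x : ℕ → V) (t : ℕ) : Sym2 V := s(x t, x (t + 1))

lemma walkEdge_ne_of_isFresh {x : ℕ → V} {s t : ℕ} (ht : IsFresh x t) (hst : s < t) :
    walkEdge x s ≠ walkEdge x t := by
  intro h
  apply ht
  have h1 : x (t + 1) ∈ walkEdge x s := by rw [h]; simp [walkEdge]
  simp only [walkEdge, Sym2.mem_iff] at h1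
  simp only [Finset.mem_image, Finset.mem_range]
  rcases h1 with h1 | h1
  · exact ⟨s, by omega, h1.symm⟩
  · exact ⟨s + 1, by omega, h1.symm⟩

/-- Only a fresh step adds a vertex; the extra one is the starting point. -/
lemma card_image_range_le (x : ℕ → V) (N : ℕ) :
    ((Finset.range (N + 1)).image x).card ≤ ((Finset.range N).filter (IsFresh x)).card + 1 := by
  induction N with
  | zero => simp
  | succ N ih =>
    rw [Finset.range_add_one, Finset.image_insert]
    by_cases h : IsFresh x N
    · rw [Finset.range_add_one (n := N), Finset.filter_insert, if_pos h,
        Finset.card_insert_of_notMem (s := (Finset.range N).filter (IsFresh x)) (by simp)]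
      rw [← Finset.range_add_one]
      exact (Finset.card_insert_le _ _).trans (by omega)
    · have h' : x (N + 1) ∈ (Finset.range (N + 1)).image x := by
        by_contra hc; exact h hc
      rw [Finset.insert_eq_of_mem h']
      rw [Finset.range_add_one (n := N), Finset.filter_insert, if_neg h]
      rwa [← Finset.range_add_one]

/-- In a walk of length `2 m` that crosses each of its edges at least twice and visits at least
`m + 1` vertices, the fresh steps are `m` in number, and each of the other steps crosses for the
second and last time an edge first crossed at a fresh step. -/
lemma stale_steps {x : ℕ → V} {m : ℕ}
    (hE : ∀ s < 2 * m, ∃ s' < 2 * m, s' ≠ s ∧ walkEdge x s' = walkEdge x s)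
    (hV : m + 1 ≤ ((Finset.range (2 * m + 1)).image x).card) :
    ((Finset.range (2 * m)).filter (IsFresh x)).card = m ∧
      ∀ t < 2 * m, ¬ IsFresh x t →
        (∃ s < t, IsFresh x s ∧ walkEdge x s = walkEdge x t) ∧
        ∀ t' < 2 * m, ¬ IsFresh x t' → walkEdge x t' = walkEdge x t → t' = t := by
  have hle := card_image_range_le x (2 * m)
  set F := (Finset.range (2 * m)).filter (IsFresh x) with hF
  set D := (Finset.range (2 * m)).filter (fun t => ¬ IsFresh x t) with hD
  have hsum : F.card + D.card = 2 * m := by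
    rw [hF, hD, Finset.card_filter_add_card_filter_not, Finset.card_range]
  have hne : ∀ s t, IsFresh x s → IsFresh x t → walkEdge x s = walkEdge x t → s = t := by
    intro s t hs ht h
    rcases lt_trichotomy s t with h1 | h1 | h1
    · exact absurd h (walkEdge_ne_of_isFresh ht h1)
    · exact h1
    · exact absurd h.symm (walkEdge_ne_of_isFresh hs h1)
  -- The map `f` sends a step to another crossing of the same edge. Fresh steps cross distinct
  -- edges, so `f` injects the fresh steps into the stale ones. The vertex count gives at least `m`
  -- fresh steps out of `2 m`, so this injection is a bijection.
  choose! f hf using hE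
  have hmaps : ∀ s ∈ F, f s ∈ D := by
    intro s hs
    simp only [hF, hD, Finset.mem_filter, Finset.mem_range] at hs ⊢
    refine ⟨(hf s hs.1).1, fun hc => (hf s hs.1).2.1 (hne _ _ hc hs.2 (hf s hs.1).2.2)⟩
  have hinj : ∀ s ∈ F, ∀ t ∈ F, f s = f t → s = t := by
    intro s hs t ht h
    simp only [hF, Finset.mem_filter, Finset.mem_range] at hs ht
    apply hne _ _ hs.2 ht.2
    rw [← (hf s hs.1).2.2, ← (hf t ht.1).2.2, h]
  have hcard : F.card ≤ D.card := Finset.card_le_card_of_injOn f hmaps hinj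
  have hFm : F.card = m := by omega
  have hDm : D.card = m := by omega
  have himage : F.image f = D := by
    apply Finset.eq_of_subset_of_card_le
    · intro t ht
      obtain ⟨s, hs, rfl⟩ := Finset.mem_image.1 ht
      exact hmaps s hs
    · rw [Finset.card_image_of_injOn (fun s hs t ht h => hinj s hs t ht h)]; omega
  have hsurj : ∀ t < 2 * m, ¬ IsFresh x t → ∃ s ∈ F, f s = t := by
    intro t ht hft
    have : t ∈ F.image f := by rw [himage]; simp [hD, ht, hft]
    simpa using this
  refine ⟨hFm, fun t ht hft => ⟨?_, ?_⟩⟩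
  · obtain ⟨s, hs, rfl⟩ := hsurj t ht hft
    simp only [hF, Finset.mem_filter, Finset.mem_range] at hs
    have h1 := hf s hs.1
    refine ⟨s, ?_, hs.2, h1.2.2.symm⟩
    by_contra hc
    exact walkEdge_ne_of_isFresh hs.2 (lt_of_le_of_ne (not_lt.1 hc) h1.2.1) h1.2.2
  · intro t' ht' hft' h
    obtain ⟨s, hs, rfl⟩ := hsurj t ht hft
    obtain ⟨s', hs', rfl⟩ := hsurj t' ht' hft'
    have hs1 := hs
    have hs2 := hs'
    simp only [hF, Finset.mem_filter, Finset.mem_range] at hs hs'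
    rw [(hf s hs.1).2.2, (hf s' hs'.1).2.2] at h
    rw [hne _ _ hs'.2 hs.2 h]

/-- The current vertex of such a walk is on top of the stack decoded from its record. -/
lemma head_decodeStack {x : ℕ → V} {m : ℕ}
    (hE : ∀ s < 2 * m, ∃ s' < 2 * m, s' ≠ s ∧ walkEdge x s' = walkEdge x s)
    (hV : m + 1 ≤ ((Finset.range (2 * m + 1)).image x).card) (t : ℕ) (ht : t ≤ 2 * m) :
    (decodeStack (x 0) (walkLabel x) t).head? = some (x t) := by
  obtain ⟨-, hstale⟩ := stale_steps hE hV
  -- The invariant behind the induction: the stack has no repetition, holds only visited vertices,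
  -- and shows every edge opened by a fresh step and not yet recrossed as a pair of neighbours,
  -- child above parent.
  suffices h : (decodeStack (x 0) (walkLabel x) t).head? = some (x t) ∧
      (decodeStack (x 0) (walkLabel x) t).Nodup ∧
      (∀ v ∈ decodeStack (x 0) (walkLabel x) t, v ∈ (Finset.range (t + 1)).image x) ∧
      ∀ s < t, IsFresh x s → (∃ s' < t, ¬ IsFresh x s' ∧ walkEdge x s' = walkEdge x s) ∨
        [x (s + 1), x s] <:+: decodeStack (x 0) (walkLabel x) t from h.1
  induction t with
  | zero => simp [decodeStack]
  | succ t ih =>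
    obtain ⟨h1, h2, h3, h4⟩ := ih (by omega)
    have hmono : ∀ v, v ∈ (Finset.range (t + 1)).image x → v ∈ (Finset.range (t + 1 + 1)).image x :=
      fun v hv => Finset.image_subset_image (Finset.range_subset_range.2 (by omega)) hv
    set S := decodeStack (x 0) (walkLabel x) t with hS
    obtain ⟨rest, hrest⟩ : ∃ rest, S = x t :: rest := by
      cases hc : S with
      | nil => rw [hc] at h1; simp at h1
      | cons a l => rw [hc] at h1; simp at h1; exact ⟨l, by rw [h1]⟩
    by_cases hfr : IsFresh x t
    · have hst : decodeStack (x 0) (walkLabel x) (t + 1) = x (t + 1) :: S := by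
        simp [decodeStack, walkLabel, hfr, hS]
      rw [hst]
      refine ⟨rfl, ?_, ?_, ?_⟩
      · exact List.nodup_cons.2 ⟨fun hc => hfr (h3 _ hc), h2⟩
      · intro v hv
        rcases List.mem_cons.1 hv with rfl | hv
        · exact Finset.mem_image_of_mem _ (by simp)
        · exact hmono v (h3 v hv)
      · intro s hs hsf
        rcases Nat.lt_succ_iff_lt_or_eq.1 hs with hs | rfl
        · rcases h4 s hs hsf with ⟨s', hs', h⟩ | h
          · exact Or.inl ⟨s', by omega, h⟩
          · exact Or.inr (List.infix_cons h)
        · right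
          rw [hrest]
          exact ⟨[], rest, by simp⟩
    · have hst : decodeStack (x 0) (walkLabel x) (t + 1) = rest := by
        simp [decodeStack, walkLabel, hfr, ← hS, hrest]
      rw [hst]
      rw [hrest] at h2 h3 h4
      obtain ⟨hnotin, hnd⟩ := List.nodup_cons.1 h2
      obtain ⟨⟨s, hst', hsf, hes⟩, huniq⟩ := hstale t (by omega) hfr
      -- A stale step is the only stale crossing of its edge, so that edge is still open before time
      -- `t` and appears on the stack. As the stack has no repetition, `x t` must be the upper end
      -- of the pair, so popping exposes `x s = x (t + 1)`.
      have hopen : [x (s + 1), x s] <:+: x t :: rest := by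
        rcases h4 s hst' hsf with ⟨s', hs', hs'f, h⟩ | h
        · exact absurd (huniq s' (by omega) hs'f (h.trans hes)) (by omega)
        · exact h
      have hx : x s ∈ rest := by
        rcases List.infix_cons_iff.1 hopen with h | h
        · exact (List.cons_prefix_cons.1 h).2.subset (by simp)
        · exact h.subset (by simp)
      have hcase : x t = x (s + 1) ∧ x (t + 1) = x s := by
        simp only [walkEdge, Sym2.eq_iff] at hes
        rcases hes with ⟨h, h'⟩ | ⟨h, h'⟩
        · exact absurd (h ▸ hx) hnotin
        · exact ⟨h'.symm, h.symm⟩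
      have hpre : [x (s + 1), x s] <+: x t :: rest := by
        rcases List.infix_cons_iff.1 hopen with h | h
        · exact h
        · exact absurd (h.subset (by simp [hcase.1])) hnotin
      have hhead : rest.head? = some (x (t + 1)) := by
        obtain ⟨l, hl⟩ := (List.cons_prefix_cons.1 hpre).2
        rw [← hl, hcase.2]; simp
      refine ⟨hhead, hnd, fun v hv => hmono v (h3 v (List.mem_cons_of_mem _ hv)), ?_⟩
      intro s₂ hs₂ hs₂f
      have hs₂t : s₂ < t := by
        rcases Nat.lt_succ_iff_lt_or_eq.1 hs₂ with h | rfl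
        · exact h
        · exact absurd hs₂f hfr
      rcases h4 s₂ hs₂t hs₂f with ⟨s', hs', h⟩ | h
      · exact Or.inl ⟨s', by omega, h⟩
      · rcases List.infix_cons_iff.1 h with h | h
        · left
          refine ⟨t, by omega, hfr, ?_⟩
          obtain ⟨ha, hb⟩ := List.cons_prefix_cons.1 h
          obtain ⟨l, hl⟩ := hb
          rw [← hl] at hhead
          simp only [List.cons_append, List.head?_cons, Option.some.injEq] at hhead
          simp only [walkEdge, ← ha, hhead, Sym2.eq_swap]
        · exact Or.inr h

/-- A set `S` of vertices containing the ends of the edges in `F` has the cardinality of a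
connected graph. -/
def IsTight (S : Finset V) (F : Finset (Sym2 V)) : Prop :=
  S.card ≤ F.card + 1 ∧ ∀ e ∈ F, ∀ v ∈ e, v ∈ S

/-- If `b` is a new vertex then `s(a, b)` is a new edge, because the ends of the old edges already
lie in `S`. -/
lemma IsTight.insert {S : Finset V} {F : Finset (Sym2 V)} (h : IsTight S F) {a : V} (ha : a ∈ S)
    (b : V) : IsTight (insert b S) (insert s(a, b) F) := by
  refine ⟨?_, ?_⟩
  · by_cases hb : b ∈ S
    · rw [Finset.insert_eq_of_mem hb]
      exact h.1.trans (by gcongr; exact Finset.subset_insert _ _)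
    · rw [Finset.card_insert_of_notMem hb, Finset.card_insert_of_notMem]
      · have := h.1; omega
      · intro hc; exact hb (h.2 _ hc b (by simp))
  · intro e he v hv
    rcases Finset.mem_insert.1 he with rfl | he
    · rcases Sym2.mem_iff.1 hv with rfl | rfl
      · exact Finset.mem_insert_of_mem ha
      · exact Finset.mem_insert_self _ _
    · exact Finset.mem_insert_of_mem (h.2 e he v hv)

/-- An arbitrary tight pair is allowed at the start so that walks meeting at a vertex can be glued.
-/
lemma IsTight.walk {S : Finset V} {F : Finset (Sym2 V)} (h : IsTight S F) {x : ℕ → V}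
    (hx : x 0 ∈ S) (N : ℕ) :
    IsTight (S ∪ (Finset.range (N + 1)).image x) (F ∪ (Finset.range N).image (walkEdge x)) := by
  induction N with
  | zero => simpa [hx] using h
  | succ N ih =>
    have := ih.insert (a := x N) (Finset.mem_union_right _ (Finset.mem_image_of_mem _ (by simp)))
      (x (N + 1))
    rw [Finset.range_add_one (n := N + 1), Finset.range_add_one (n := N), Finset.image_insert,
      Finset.image_insert (f := walkEdge x), Finset.union_insert, Finset.union_insert]
    rw [← Finset.range_add_one]
    exact this

end Walks

/-! ### Counting walks and pairs of walks. -/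

section WalkCounts

variable {V : Type*} [DecidableEq V]

/-- The edge crossed by the walk `w` of length `L` at step `t`. -/
def stepEdge {L : ℕ} (w : Fin (L + 1) → V) (t : Fin L) : Sym2 V := s(w t.castSucc, w t.succ)

/-- The number of times that the walk `w` crosses the edge `e`. -/
def edgeCount {L : ℕ} (w : Fin (L + 1) → V) (e : Sym2 V) : ℕ :=
  (Finset.univ.filter fun t => stepEdge w t = e).card

/-- A walk of length `L` as a sequence. -/
def walkSeq {L : ℕ} (w : Fin (L + 1) → V) (t : ℕ) : V := w (Fin.ofNat (L + 1) t)

omit [DecidableEq V] in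
lemma walkSeq_of_le {L : ℕ} (w : Fin (L + 1) → V) {t : ℕ} (ht : t ≤ L) :
    walkSeq w t = w ⟨t, by omega⟩ := by
  unfold walkSeq
  congr 1
  ext
  simp [Fin.ofNat, Nat.mod_eq_of_lt (show t < L + 1 by omega)]

omit [DecidableEq V] in
lemma walkEdge_walkSeq {L : ℕ} (w : Fin (L + 1) → V) {t : ℕ} (ht : t < L) :
    walkEdge (walkSeq w) t = stepEdge w ⟨t, ht⟩ := by
  simp only [walkEdge, stepEdge, walkSeq_of_le w ht.le, walkSeq_of_le w (t := t + 1) ht]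
  rfl

lemma image_walkSeq {L : ℕ} (w : Fin (L + 1) → V) :
    (Finset.range (L + 1)).image (walkSeq w) = Finset.univ.image w := by
  ext v
  simp only [Finset.mem_image, Finset.mem_range, Finset.mem_univ, true_and]
  constructor
  · rintro ⟨t, ht, rfl⟩
    exact ⟨⟨t, ht⟩, (walkSeq_of_le w (by omega)).symm⟩
  · rintro ⟨t, rfl⟩
    exact ⟨t, t.2, walkSeq_of_le w (by omega)⟩

lemma exists_other_step {L : ℕ} {w : Fin (L + 1) → V} (h : ∀ e, edgeCount w e ≠ 1) (s : ℕ)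
    (hs : s < L) :
    ∃ s' < L, s' ≠ s ∧ walkEdge (walkSeq w) s' = walkEdge (walkSeq w) s := by
  have h1 := h (stepEdge w ⟨s, hs⟩)
  unfold edgeCount at h1
  have hmem : (⟨s, hs⟩ : Fin L) ∈
      Finset.univ.filter fun t => stepEdge w t = stepEdge w ⟨s, hs⟩ := by simp
  have h2 : 1 < (Finset.univ.filter fun t => stepEdge w t = stepEdge w ⟨s, hs⟩).card := by
    have := Finset.card_pos.2 ⟨_, hmem⟩
    omega
  obtain ⟨s', hs', hne⟩ := Finset.exists_mem_ne h2 ⟨s, hs⟩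
  refine ⟨s', s'.2, fun hc => hne (Fin.ext hc), ?_⟩
  rw [walkEdge_walkSeq w s'.2, walkEdge_walkSeq w hs]
  simpa using hs'

variable [Fintype V]

omit [DecidableEq V] in
-- Give `none` weight `1` and each vertex weight `1 / n`. The product weights of all sequences sum
-- to `2 ^ L`, and each counted sequence has weight `n ^ (-m)`. The empty vertex set is treated
-- apart, since there the weights degenerate.
lemma card_partial_sequences (L m : ℕ) :
    ((Finset.univ : Finset (Fin L → Option V)).filter
      (fun l => (Finset.univ.filter fun t => (l t).isSome).card = m)).card ≤
      2 ^ L * Fintype.card V ^ m := by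
  rcases isEmpty_or_nonempty V with hV | hV
  · have hall : ∀ l : Fin L → Option V, (Finset.univ.filter fun t => (l t).isSome).card = 0 := by
      intro l
      rw [Finset.card_eq_zero, Finset.filter_eq_empty_iff]
      intro t _
      cases hl : l t with
      | none => simp
      | some v => exact (hV.false v).elim
    rcases Nat.eq_zero_or_pos m with rfl | hm
    · refine (Finset.card_le_univ _).trans ?_
      simp [Nat.one_le_two_pow]
    · rw [Finset.filter_false_of_mem]
      · simp
      · intro l _; rw [hall l]; omega
  have hn : (0 : ℝ) < Fintype.card V := by exact_mod_cast Fintype.card_pos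
  set ω : Option V → ℝ := fun o => o.elim 1 (fun _ => (Fintype.card V : ℝ)⁻¹) with hω
  have hωpos : ∀ o, 0 ≤ ω o := by
    intro o; cases o <;> simp [hω]
  have hsum : ∑ o, ω o = 2 := by
    rw [Fintype.sum_option]
    simp only [hω, Option.elim, Finset.sum_const, Finset.card_univ, nsmul_eq_mul]
    rw [mul_inv_cancel₀ hn.ne']; norm_num
  have hprod : ∀ l : Fin L → Option V, ∏ t, ω (l t) =
      ((Fintype.card V : ℝ)⁻¹) ^ (Finset.univ.filter fun t => (l t).isSome).card := by
    intro l
    rw [← Finset.prod_const, Finset.prod_filter]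
    refine Finset.prod_congr rfl fun t _ => ?_
    cases h : l t <;> simp [hω]
  have hkey : ∑ l ∈ (Finset.univ : Finset (Fin L → Option V)).filter
      (fun l => (Finset.univ.filter fun t => (l t).isSome).card = m), ∏ t, ω (l t) ≤
      (2 : ℝ) ^ L := by
    rw [← hsum, Fintype.sum_pow]
    exact Finset.sum_le_sum_of_subset_of_nonneg (Finset.filter_subset _ _)
      fun l _ _ => Finset.prod_nonneg fun t _ => hωpos _
  rw [Finset.sum_congr rfl (g := fun _ => ((Fintype.card V : ℝ)⁻¹) ^ m)
    (fun l hl => by rw [hprod, (Finset.mem_filter.1 hl).2]), Finset.sum_const, nsmul_eq_mul,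
    inv_pow, ← div_eq_mul_inv, div_le_iff₀ (by positivity)] at hkey
  exact_mod_cast hkey

/-- The number of walks of length `2 m` that cross no edge exactly once and visit more than `m`
vertices is at most `4 ^ m * n ^ (m + 1)`. -/
lemma card_tree_walks (m : ℕ) :
    ((Finset.univ : Finset (Fin (2 * m + 1) → V)).filter
      (fun w => (∀ e, edgeCount w e ≠ 1) ∧ m + 1 ≤ (Finset.univ.image w).card)).card ≤
      4 ^ m * Fintype.card V ^ (m + 1) := by
  set T := (Finset.univ : Finset (Fin (2 * m) → Option V)).filter
      (fun l => (Finset.univ.filter fun t => (l t).isSome).card = m) with hT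
  have hTc : ((Finset.univ : Finset V) ×ˢ T).card ≤ 4 ^ m * Fintype.card V ^ (m + 1) := by
    rw [Finset.card_product, Finset.card_univ]
    refine (Nat.mul_le_mul_left _ (card_partial_sequences (V := V) (2 * m) m)).trans (le_of_eq ?_)
    rw [pow_mul]; ring
  -- A walk is coded by its start and its record, which has exactly `m` fresh entries. The code is
  -- injective because the tops of the decoded stacks give the walk back.
  refine le_trans (Finset.card_le_card_of_injOn
    (fun w => (w 0, fun t : Fin (2 * m) => walkLabel (walkSeq w) t)) ?_ ?_) hTc
  · intro w hw
    simp only [Finset.coe_filter, Finset.mem_univ, true_and, Set.mem_ofPred_eq] at hw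
    have := (stale_steps (exists_other_step hw.1) (by rw [image_walkSeq]; exact hw.2)).1
    simp only [hT, Finset.coe_product, Finset.coe_univ, Set.mem_prod, Set.mem_univ, true_and,
      Finset.coe_filter, Finset.mem_univ, Set.mem_ofPred_eq]
    refine Eq.trans (Finset.card_bij (fun t _ => (t : ℕ)) ?_ ?_ ?_) this
    · intro t ht
      simp only [walkLabel] at ht
      simp only [Finset.mem_filter, Finset.mem_range, t.2, true_and]
      by_contra hc
      simp [hc] at ht
    · intro s _ t _ h; exact Fin.ext h
    · intro t ht
      simp only [Finset.mem_filter, Finset.mem_range] at ht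
      exact ⟨⟨t, ht.1⟩, by simp [walkLabel, ht.2], rfl⟩
  · intro w hw w' hw' h
    simp only [Finset.coe_filter, Finset.mem_univ, true_and, Set.mem_ofPred_eq] at hw hw'
    simp only [Prod.mk.injEq] at h
    have h0 : walkSeq w 0 = walkSeq w' 0 := by
      rw [walkSeq_of_le w (by omega), walkSeq_of_le w' (by omega)]; exact h.1
    funext t
    have h1 := head_decodeStack (exists_other_step hw.1) (by rw [image_walkSeq]; exact hw.2) t
      (by omega)
    have h2 := head_decodeStack (exists_other_step hw'.1) (by rw [image_walkSeq]; exact hw'.2) t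
      (by omega)
    rw [h0, decodeStack_congr (l' := walkLabel (walkSeq w')) _
      (fun s hs => congrFun h.2 ⟨s, by omega⟩), h2, walkSeq_of_le w (by omega),
      walkSeq_of_le w' (by omega)] at h1
    exact (Option.some.inj h1).symm

/-- The number of families with at most `v` values. -/
lemma card_small_image {ι : Type*} [Fintype ι] [DecidableEq ι] [Nonempty V] (v : ℕ) :
    ((Finset.univ : Finset (ι → V)).filter
      (fun f => (Finset.univ.image f).card ≤ v)).card ≤
      v ^ Fintype.card ι * Fintype.card V ^ v := by
  have hcard : ((Finset.univ : Finset ((ι → Fin v) × (Fin v → V)))).card =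
      v ^ Fintype.card ι * Fintype.card V ^ v := by
    simp
  rw [← hcard]
  -- Each such family factors through `v` colours: a colouring of the indices followed by a choice
  -- of a value for each colour.
  refine Finset.card_le_card_of_surjOn (fun p => p.2 ∘ p.1) ?_
  intro f hf
  simp only [Finset.coe_filter, Finset.mem_univ, true_and, Set.mem_ofPred_eq] at hf
  obtain ⟨e⟩ : Nonempty ({x // x ∈ Finset.univ.image f} ↪ Fin v) := by
    apply Function.Embedding.nonempty_of_card_le
    rwa [Fintype.card_coe, Fintype.card_fin]
  refine ⟨(fun i => e ⟨f i, by simp⟩,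
    Function.extend e (fun x => x.1) (fun _ => Classical.arbitrary V)), by simp, ?_⟩
  funext i
  simp [e.injective.extend_apply]

omit [Fintype V] in
lemma sum_edgeCount {L : ℕ} (w : Fin (L + 1) → V) (F : Finset (Sym2 V))
    (hF : ∀ t, stepEdge w t ∈ F) : ∑ e ∈ F, edgeCount w e = L := by
  unfold edgeCount
  rw [← Finset.card_eq_sum_card_fiberwise (fun t _ => hF t)]
  simp

omit [Fintype V] in
lemma edgeCount_pos_iff {L : ℕ} {w : Fin (L + 1) → V} {e : Sym2 V} :
    0 < edgeCount w e ↔ ∃ t, stepEdge w t = e := by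
  unfold edgeCount
  rw [Finset.card_pos]
  simp [Finset.Nonempty]

omit [Fintype V] in
/-- Two walks of length `2 m` that share an edge, and that together cross no edge exactly once,
visit at most `2 m + 1` vertices. -/
lemma card_image_pair_le {m : ℕ} {w w' : Fin (2 * m + 1) → V}
    (h : ∀ e, edgeCount w e + edgeCount w' e ≠ 1)
    (hs : ∃ e, 0 < edgeCount w e ∧ 0 < edgeCount w' e) :
    (Finset.univ.image w ∪ Finset.univ.image w').card ≤ 2 * m + 1 := by
  obtain ⟨e, he, he'⟩ := hs
  obtain ⟨t, ht⟩ := edgeCount_pos_iff.1 he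
  obtain ⟨t', ht'⟩ := edgeCount_pos_iff.1 he'
  set F := Finset.univ.image (stepEdge w) ∪ Finset.univ.image (stepEdge w') with hF
  -- The two walks make `4 m` crossings in total, and every edge used is crossed at least twice.
  have hFcard : F.card ≤ 2 * m := by
    have h1 := sum_edgeCount w F (fun t => by simp [hF])
    have h2 := sum_edgeCount w' F (fun t => by simp [hF])
    have h3 : ∑ e ∈ F, 2 ≤ ∑ e ∈ F, (edgeCount w e + edgeCount w' e) := by
      refine Finset.sum_le_sum fun e he => ?_
      have h4 := h e
      have h5 : 0 < edgeCount w e ∨ 0 < edgeCount w' e := by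
        rcases Finset.mem_union.1 he with he | he
        · left; rw [edgeCount_pos_iff]; simpa using he
        · right; rw [edgeCount_pos_iff]; simpa using he
      omega
    rw [Finset.sum_add_distrib, h1, h2, Finset.sum_const, smul_eq_mul] at h3
    omega
  have hshare : w' t'.castSucc ∈ Finset.univ.image w := by
    have : w' t'.castSucc ∈ stepEdge w t := by rw [ht, ← ht']; simp [stepEdge]
    rcases Sym2.mem_iff.1 this with h | h
    · rw [h]; simp
    · rw [h]; simp
  -- The union is explored in three tight walks: all of `w`, then `w'` forwards from the shared
  -- vertex at time `t'`, then `w'` backwards from it.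
  have h0 : IsTight {walkSeq w 0} (∅ : Finset (Sym2 V)) := ⟨by simp, by simp⟩
  have h1 := h0.walk (x := walkSeq w) (by simp) (2 * m)
  have h2 := h1.walk (x := fun s => walkSeq w' (t' + s)) (by
    rw [image_walkSeq, add_zero, walkSeq_of_le w' (by omega)]
    exact Finset.mem_union_right _ hshare) (2 * m - t')
  have h3 := h2.walk (x := fun s => walkSeq w' (t' - s)) (by
    rw [image_walkSeq, Nat.sub_zero, walkSeq_of_le w' (by omega)]
    exact Finset.mem_union_left _ (Finset.mem_union_right _ hshare)) t'
  have hle := h3.1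
  refine le_trans (Finset.card_le_card ?_) (hle.trans (Nat.add_le_add_right
    ((Finset.card_le_card ?_).trans hFcard) 1))
  · apply Finset.union_subset
    · intro v hv
      rw [image_walkSeq]
      simp only [Finset.mem_union, hv, or_true, true_or]
    · intro v hv
      rw [← image_walkSeq] at hv
      obtain ⟨s, hs, rfl⟩ := Finset.mem_image.1 hv
      rw [Finset.mem_range] at hs
      rcases le_total s t' with hst | hst
      · apply Finset.mem_union_right
        exact Finset.mem_image.2 ⟨t' - s, by simp, by congr 1; omega⟩
      · apply Finset.mem_union_left
        apply Finset.mem_union_right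
        exact Finset.mem_image.2 ⟨s - t', by simp; omega, by congr 1; omega⟩
  · simp only [Finset.empty_union]
    refine Finset.union_subset (Finset.union_subset ?_ ?_) ?_
    · intro e he
      obtain ⟨s, hs, rfl⟩ := Finset.mem_image.1 he
      rw [walkEdge_walkSeq w (Finset.mem_range.1 hs)]
      simp [hF]
    · intro e he
      obtain ⟨s, hs, rfl⟩ := Finset.mem_image.1 he
      rw [Finset.mem_range] at hs
      have : walkEdge (fun s => walkSeq w' (t' + s)) s = stepEdge w' ⟨t' + s, by omega⟩ := by
        rw [← walkEdge_walkSeq w']; rfl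
      rw [this]
      simp [hF]
    · intro e he
      obtain ⟨s, hs, rfl⟩ := Finset.mem_image.1 he
      rw [Finset.mem_range] at hs
      have : walkEdge (fun s => walkSeq w' (t' - s)) s = stepEdge w' ⟨t' - s - 1, by omega⟩ := by
        rw [← walkEdge_walkSeq w']
        simp only [walkEdge]
        rw [Sym2.eq_swap, show (t' : ℕ) - s - 1 + 1 = t' - s by omega,
          show (t' : ℕ) - (s + 1) = t' - s - 1 by omega]
      rw [this]
      simp [hF]

end WalkCounts

/-! ### Mean and variance of the trace moments of the noise. -/

section TraceMoments

set_option linter.unusedSectionVars false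

variable {V : Type*} [DecidableEq V] [Fintype V]

/-- The product of the weights `f` along the walk `w`. -/
def walkProd {L : ℕ} (f : Sym2 V → ℝ) (w : Fin (L + 1) → V) : ℝ := ∏ t, f (stepEdge w t)

/-- The symmetric matrix with entries given by a function on unordered pairs. -/
def sym2Matrix (f : Sym2 V → ℝ) : Matrix V V ℝ := Matrix.of fun i j => f s(i, j)

lemma sym2Matrix_pow_apply (f : Sym2 V → ℝ) (L : ℕ) (i j : V) :
    (sym2Matrix f ^ L) i j =
      ∑ w : Fin (L + 1) → V, if w 0 = i ∧ w (Fin.last L) = j then walkProd f w else 0 := by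
  induction L generalizing i with
  | zero =>
    rw [← (Equiv.funUnique (Fin 1) V).symm.sum_comp]
    simp only [pow_zero, Matrix.one_apply, walkProd]
    simp only [Equiv.funUnique_symm_apply, uniqueElim_const, Finset.univ_eq_empty,
      Finset.prod_empty]
    by_cases h : i = j
    · subst h
      simp
    · rw [if_neg h, Finset.sum_eq_zero]
      intro x _
      rw [if_neg]
      rintro ⟨rfl, rfl⟩
      exact h rfl
  | succ L ih =>
    have hprod : ∀ (i : V) (w : Fin (L + 1) → V),
        walkProd f (Fin.cons i w : Fin (L + 1 + 1) → V) = f s(i, w 0) * walkProd f w := by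
      intro i w
      unfold walkProd
      rw [Fin.prod_univ_succ]
      congr 1
    have hright : (∑ w : Fin (L + 1 + 1) → V,
        if w 0 = i ∧ w (Fin.last (L + 1)) = j then walkProd f w else 0) =
        ∑ w : Fin (L + 1) → V,
          if w (Fin.last L) = j then f s(i, w 0) * walkProd f w else 0 := by
      rw [← (Fin.consEquiv (fun _ => V)).sum_comp, Fintype.sum_prod_type,
        Finset.sum_eq_single i]
      · refine Finset.sum_congr rfl fun w _ => ?_
        simp only [Fin.consEquiv, Equiv.coe_fn_mk, hprod, Fin.cons_zero, true_and,
          ← Fin.succ_last, Fin.cons_succ]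
      · intro b _ hb
        refine Finset.sum_eq_zero fun w _ => ?_
        rw [if_neg]
        simp [Fin.consEquiv, hb]
      · simp
    rw [hright, pow_succ', Matrix.mul_apply]
    simp only [ih, Finset.mul_sum]
    rw [Finset.sum_comm]
    refine Finset.sum_congr rfl fun w _ => ?_
    rw [Finset.sum_eq_single (w 0)]
    · simp [sym2Matrix]
    · intro b _ hb
      rw [if_neg (fun h => hb h.1.symm), mul_zero]
    · simp

lemma trace_sym2Matrix_pow (f : Sym2 V → ℝ) (L : ℕ) :
    (sym2Matrix f ^ L).trace =
      ∑ w ∈ (Finset.univ : Finset (Fin (L + 1) → V)).filter (fun w => w 0 = w (Fin.last L)),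
        walkProd f w := by
  simp only [Matrix.trace, Matrix.diag_apply, sym2Matrix_pow_apply]
  rw [Finset.sum_comm, Finset.sum_filter]
  refine Finset.sum_congr rfl fun w _ => ?_
  rw [Finset.sum_eq_single (w 0)]
  · simp [eq_comm]
  · intro b _ hb
    rw [if_neg (fun h => hb h.1.symm)]
  · simp

lemma walkProd_eq_prod_pow {L : ℕ} (f : Sym2 V → ℝ) (w : Fin (L + 1) → V) :
    walkProd f w = ∏ e, f e ^ edgeCount w e := by
  unfold walkProd edgeCount
  rw [← Finset.prod_fiberwise (s := Finset.univ) (g := stepEdge w)]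
  refine Finset.prod_congr rfl fun e _ => ?_
  rw [← Finset.prod_const]
  exact Finset.prod_congr rfl fun t ht => by rw [(Finset.mem_filter.1 ht).2]

/-- A family of independent centered variables, bounded by `1` and with variances at most `1 / 4`,
indexed by unordered pairs. -/
structure IsNoise {Ω : Type*} [MeasurableSpace Ω] (μ : Measure Ω) (Y : Sym2 V → Ω → ℝ) :
    Prop where
  measurable : ∀ e, Measurable (Y e)
  abs_le_one : ∀ e ω, |Y e ω| ≤ 1
  integral_prod : ∀ a : Sym2 V → ℕ,
    ∫ ω, ∏ e, Y e ω ^ a e ∂μ = ∏ e, ∫ ω, Y e ω ^ a e ∂μ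
  mean_eq_zero : ∀ e, ∫ ω, Y e ω ∂μ = 0
  variance_le : ∀ e, ∫ ω, Y e ω ^ 2 ∂μ ≤ 1 / 4

variable {Ω : Type*} [MeasurableSpace Ω] {μ : Measure Ω} [IsProbabilityMeasure μ]
  {Y : Sym2 V → Ω → ℝ}

namespace IsNoise

lemma integrable_of_abs_le_one {X : Ω → ℝ} (hX : Measurable X) (h : ∀ ω, |X ω| ≤ 1) :
    Integrable X μ :=
  Integrable.of_bound hX.aestronglyMeasurable 1 (Filter.Eventually.of_forall h)

lemma abs_integral_le_one {X : Ω → ℝ} (h : ∀ ω, |X ω| ≤ 1) : |∫ ω, X ω ∂μ| ≤ 1 := by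
  have := norm_integral_le_of_norm_le_const (μ := μ) (f := X) (C := 1)
    (Filter.Eventually.of_forall h)
  simpa using this

lemma abs_walkProd_le (h : IsNoise μ Y) {L : ℕ} (w : Fin (L + 1) → V) (ω : Ω) :
    |walkProd (fun e => Y e ω) w| ≤ 1 := by
  unfold walkProd
  rw [Finset.abs_prod]
  exact Finset.prod_le_one (fun _ _ => abs_nonneg _) fun _ _ => h.abs_le_one _ _

lemma measurable_walkProd (h : IsNoise μ Y) {L : ℕ} (w : Fin (L + 1) → V) :
    Measurable fun ω => walkProd (fun e => Y e ω) w := by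
  unfold walkProd
  exact Finset.measurable_prod _ fun _ _ => h.measurable _

lemma integrable_walkProd (h : IsNoise μ Y) {L : ℕ} (w : Fin (L + 1) → V) :
    Integrable (fun ω => walkProd (fun e => Y e ω) w) μ :=
  integrable_of_abs_le_one (h.measurable_walkProd w) (h.abs_walkProd_le w)

lemma abs_moment_le_one (h : IsNoise μ Y) (e : Sym2 V) (a : ℕ) :
    |∫ ω, Y e ω ^ a ∂μ| ≤ 1 :=
  abs_integral_le_one fun ω => by rw [abs_pow]; exact pow_le_one₀ (abs_nonneg _) (h.abs_le_one _ _)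

lemma abs_moment_le (h : IsNoise μ Y) (e : Sym2 V) {a : ℕ} (ha : 2 ≤ a) :
    |∫ ω, Y e ω ^ a ∂μ| ≤ 1 / 4 := by
  refine (abs_integral_le_integral_abs).trans (le_trans ?_ (h.variance_le e))
  have hint : ∀ b : ℕ, Integrable (fun ω => Y e ω ^ b) μ := fun b =>
    integrable_of_abs_le_one ((h.measurable e).pow_const b) fun ω => by
      rw [abs_pow]; exact pow_le_one₀ (abs_nonneg _) (h.abs_le_one _ _)
  refine integral_mono (hint a).abs (hint 2) fun ω => ?_
  dsimp only
  rw [abs_pow, ← sq_abs (Y e ω)]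
  exact pow_le_pow_of_le_one (abs_nonneg _) (h.abs_le_one _ _) ha

lemma integral_walkProd (h : IsNoise μ Y) {L : ℕ} (w : Fin (L + 1) → V) :
    ∫ ω, walkProd (fun e => Y e ω) w ∂μ = ∏ e, ∫ ω, Y e ω ^ edgeCount w e ∂μ := by
  simp only [walkProd_eq_prod_pow]
  exact h.integral_prod _

lemma integral_walkProd_mul (h : IsNoise μ Y) {L : ℕ} (w w' : Fin (L + 1) → V) :
    ∫ ω, walkProd (fun e => Y e ω) w * walkProd (fun e => Y e ω) w' ∂μ =
      ∏ e, ∫ ω, Y e ω ^ (edgeCount w e + edgeCount w' e) ∂μ := by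
  simp only [walkProd_eq_prod_pow, ← Finset.prod_mul_distrib, ← pow_add]
  exact h.integral_prod _

lemma integral_walkProd_eq_zero (h : IsNoise μ Y) {L : ℕ} (w : Fin (L + 1) → V) {e : Sym2 V}
    (he : edgeCount w e = 1) : ∫ ω, walkProd (fun e => Y e ω) w ∂μ = 0 := by
  rw [h.integral_walkProd, Finset.prod_eq_zero (Finset.mem_univ e)]
  simp [he, h.mean_eq_zero]

/-- A walk on `m + 1` vertices uses at least `m` distinct edges. Each is crossed at least twice, so
by boundedness its moment is at most the variance bound `1 / 4`. -/
lemma integral_walkProd_le (h : IsNoise μ Y) {L m : ℕ} (w : Fin (L + 1) → V)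
    (h1 : ∀ e, edgeCount w e ≠ 1) (h2 : m + 1 ≤ (Finset.univ.image w).card) :
    ∫ ω, walkProd (fun e => Y e ω) w ∂μ ≤ (1 / 4) ^ m := by
  rw [h.integral_walkProd]
  set F := Finset.univ.image (stepEdge w) with hF
  have hm : m ≤ F.card := by
    have h0 : IsTight {walkSeq w 0} (∅ : Finset (Sym2 V)) := ⟨by simp, by simp⟩
    have h3 := (h0.walk (x := walkSeq w) (by simp) L).1
    rw [image_walkSeq] at h3
    have h4 := h2.trans ((Finset.card_le_card Finset.subset_union_right).trans h3)
    have h5 : (∅ ∪ (Finset.range L).image (walkEdge (walkSeq w))).card ≤ F.card := by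
      refine Finset.card_le_card ?_
      rw [Finset.empty_union]
      intro e he
      obtain ⟨s, hs, rfl⟩ := Finset.mem_image.1 he
      rw [walkEdge_walkSeq w (Finset.mem_range.1 hs)]
      simp [hF]
    omega
  calc ∏ e, ∫ ω, Y e ω ^ edgeCount w e ∂μ
      ≤ ∏ e, |∫ ω, Y e ω ^ edgeCount w e ∂μ| := by
        rw [← Finset.abs_prod]; exact le_abs_self _
    _ ≤ ∏ e, (if e ∈ F then (1 / 4 : ℝ) else 1) := by
        refine Finset.prod_le_prod (fun _ _ => abs_nonneg _) fun e _ => ?_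
        split_ifs with he
        · apply h.abs_moment_le
          have h3 : 0 < edgeCount w e := by rw [edgeCount_pos_iff]; simpa [hF] using he
          have := h1 e
          omega
        · exact h.abs_moment_le_one _ _
    _ = (1 / 4) ^ F.card := by simp
    _ ≤ (1 / 4) ^ m := pow_le_pow_of_le_one (by norm_num) (by norm_num) hm

/-- The first term comes from the tree walks `T₁`, where `4 ^ m` and `(1 / 4) ^ m` cancel; the
second from the walks `T₂` with few vertices, each bounded by `1`. All other walks have mean zero.
Closedness of the walks is discarded in both counts. -/
lemma integral_trace_pow_le (h : IsNoise μ Y) [Nonempty V] (m : ℕ) :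
    ∫ ω, (sym2Matrix (fun e => Y e ω) ^ (2 * m)).trace ∂μ ≤
      (Fintype.card V : ℝ) ^ (m + 1) + (m : ℝ) ^ (2 * m + 1) * (Fintype.card V : ℝ) ^ m := by
  simp only [trace_sym2Matrix_pow]
  rw [integral_finsetSum _ fun w _ => h.integrable_walkProd w]
  set T₁ := (Finset.univ : Finset (Fin (2 * m + 1) → V)).filter
      (fun w => (∀ e, edgeCount w e ≠ 1) ∧ m + 1 ≤ (Finset.univ.image w).card) with hT₁
  set T₂ := (Finset.univ : Finset (Fin (2 * m + 1) → V)).filter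
      (fun w => (Finset.univ.image w).card ≤ m) with hT₂
  have h1 : (T₁.card : ℝ) ≤ 4 ^ m * (Fintype.card V : ℝ) ^ (m + 1) := by
    exact_mod_cast card_tree_walks (V := V) m
  have h2 : (T₂.card : ℝ) ≤ (m : ℝ) ^ (2 * m + 1) * (Fintype.card V : ℝ) ^ m := by
    have := card_small_image (V := V) (ι := Fin (2 * m + 1)) m
    rw [Fintype.card_fin] at this
    exact_mod_cast this
  calc ∑ w ∈ (Finset.univ : Finset (Fin (2 * m + 1) → V)).filter
        (fun w => w 0 = w (Fin.last (2 * m))), ∫ ω, walkProd (fun e => Y e ω) w ∂μ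
      ≤ ∑ w ∈ (Finset.univ : Finset (Fin (2 * m + 1) → V)).filter
        (fun w => w 0 = w (Fin.last (2 * m))),
          ((if w ∈ T₁ then (1 / 4 : ℝ) ^ m else 0) + (if w ∈ T₂ then 1 else 0)) := by
        refine Finset.sum_le_sum fun w _ => ?_
        by_cases hw2 : (Finset.univ.image w).card ≤ m
        · rw [if_pos (show w ∈ T₂ by simp [hT₂, hw2])]
          have := (le_abs_self _).trans (abs_integral_le_one (μ := μ) (h.abs_walkProd_le w))
          have h0 : (0 : ℝ) ≤ if w ∈ T₁ then (1 / 4 : ℝ) ^ m else 0 := by positivity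
          linarith
        · by_cases hw1 : ∀ e, edgeCount w e ≠ 1
          · rw [if_pos (show w ∈ T₁ by simp [hT₁, hw1]; omega)]
            have := h.integral_walkProd_le w hw1 (m := m) (by omega)
            have h0 : (0 : ℝ) ≤ if w ∈ T₂ then (1 : ℝ) else 0 := by positivity
            linarith
          · push Not at hw1
            obtain ⟨e, he⟩ := hw1
            rw [h.integral_walkProd_eq_zero w he]
            positivity
    _ ≤ ∑ w : Fin (2 * m + 1) → V,
          ((if w ∈ T₁ then (1 / 4 : ℝ) ^ m else 0) + (if w ∈ T₂ then 1 else 0)) :=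
        Finset.sum_le_sum_of_subset_of_nonneg (Finset.filter_subset _ _)
          fun _ _ _ => by positivity
    _ = T₁.card * (1 / 4) ^ m + T₂.card := by
        rw [Finset.sum_add_distrib, ← Finset.sum_filter, ← Finset.sum_filter]
        simp
    _ ≤ 4 ^ m * (Fintype.card V : ℝ) ^ (m + 1) * (1 / 4) ^ m +
          (m : ℝ) ^ (2 * m + 1) * (Fintype.card V : ℝ) ^ m := by gcongr
    _ = _ := by
        have : (4 : ℝ) ^ m * (1 / 4) ^ m = 1 := by rw [← mul_pow]; norm_num
        linear_combination (Fintype.card V : ℝ) ^ (m + 1) * this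

/-- Walks without a common edge are uncorrelated. If an edge is crossed exactly once by the pair,
both terms vanish. In the remaining case `card_image_pair_le` bounds the number of vertices. -/
lemma covariance_walkProd_le (h : IsNoise μ Y) {m : ℕ} (w w' : Fin (2 * m + 1) → V) :
    ∫ ω, walkProd (fun e => Y e ω) w * walkProd (fun e => Y e ω) w' ∂μ -
        (∫ ω, walkProd (fun e => Y e ω) w ∂μ) * ∫ ω, walkProd (fun e => Y e ω) w' ∂μ ≤
      if (Finset.univ.image w ∪ Finset.univ.image w').card ≤ 2 * m + 1 then 2 else 0 := by
  have hcov2 : ∫ ω, walkProd (fun e => Y e ω) w * walkProd (fun e => Y e ω) w' ∂μ -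
        (∫ ω, walkProd (fun e => Y e ω) w ∂μ) * ∫ ω, walkProd (fun e => Y e ω) w' ∂μ ≤ 2 := by
    have h1 := abs_integral_le_one (μ := μ)
      (X := fun ω => walkProd (fun e => Y e ω) w * walkProd (fun e => Y e ω) w') fun ω => by
        rw [abs_mul]
        exact mul_le_one₀ (h.abs_walkProd_le w ω) (abs_nonneg _) (h.abs_walkProd_le w' ω)
    have h2 : |(∫ ω, walkProd (fun e => Y e ω) w ∂μ) * ∫ ω, walkProd (fun e => Y e ω) w' ∂μ| ≤ 1 := by
      rw [abs_mul]
      exact mul_le_one₀ (abs_integral_le_one (h.abs_walkProd_le w)) (abs_nonneg _)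
        (abs_integral_le_one (h.abs_walkProd_le w'))
    linarith [(abs_le.1 h1).2, (abs_le.1 h2).1]
  by_cases hs : ∃ e, 0 < edgeCount w e ∧ 0 < edgeCount w' e
  · by_cases h1 : ∀ e, edgeCount w e + edgeCount w' e ≠ 1
    · rwa [if_pos (card_image_pair_le h1 hs)]
    · push Not at h1
      obtain ⟨e, he⟩ := h1
      have hzero : ∫ ω, walkProd (fun e => Y e ω) w * walkProd (fun e => Y e ω) w' ∂μ = 0 := by
        rw [h.integral_walkProd_mul, Finset.prod_eq_zero (Finset.mem_univ e)]
        simp [he, h.mean_eq_zero]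
      have hzero' : (∫ ω, walkProd (fun e => Y e ω) w ∂μ) *
          ∫ ω, walkProd (fun e => Y e ω) w' ∂μ = 0 := by
        rcases (show edgeCount w e = 1 ∨ edgeCount w' e = 1 by omega) with h2 | h2
        · rw [h.integral_walkProd_eq_zero w h2, zero_mul]
        · rw [h.integral_walkProd_eq_zero w' h2, mul_zero]
      rw [hzero, hzero', sub_zero]
      positivity
  · have : ∫ ω, walkProd (fun e => Y e ω) w * walkProd (fun e => Y e ω) w' ∂μ =
        (∫ ω, walkProd (fun e => Y e ω) w ∂μ) * ∫ ω, walkProd (fun e => Y e ω) w' ∂μ := by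
      rw [h.integral_walkProd_mul, h.integral_walkProd, h.integral_walkProd,
        ← Finset.prod_mul_distrib]
      refine Finset.prod_congr rfl fun e _ => ?_
      rcases Nat.eq_zero_or_pos (edgeCount w e) with h0 | h0
      · simp [h0]
      · have : edgeCount w' e = 0 := by
          by_contra hc
          exact hs ⟨e, h0, Nat.pos_of_ne_zero hc⟩
        simp [this]
    rw [this, sub_self]
    positivity

lemma memLp_trace_pow (h : IsNoise μ Y) (L : ℕ) :
    MemLp (fun ω => (sym2Matrix (fun e => Y e ω) ^ L).trace) 2 μ := by
  simp only [trace_sym2Matrix_pow]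
  exact memLp_finsetSum _ fun w _ => MemLp.of_bound
    (h.measurable_walkProd w).aestronglyMeasurable 1 (Filter.Eventually.of_forall
      (h.abs_walkProd_le w))

lemma variance_trace_pow_le (h : IsNoise μ Y) [Nonempty V] (m : ℕ) :
    variance (fun ω => (sym2Matrix (fun e => Y e ω) ^ (2 * m)).trace) μ ≤
      2 * (2 * m + 1 : ℝ) ^ (4 * m + 2) * (Fintype.card V : ℝ) ^ (2 * m + 1) := by
  rw [variance_eq_sub (h.memLp_trace_pow _)]
  simp only [Pi.pow_apply, trace_sym2Matrix_pow]
  set C := (Finset.univ : Finset (Fin (2 * m + 1) → V)).filter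
    (fun w => w 0 = w (Fin.last (2 * m))) with hC
  have hsq : ∫ ω, (∑ w ∈ C, walkProd (fun e => Y e ω) w) ^ 2 ∂μ =
      ∑ w ∈ C, ∑ w' ∈ C, ∫ ω, walkProd (fun e => Y e ω) w * walkProd (fun e => Y e ω) w' ∂μ := by
    simp only [sq, Finset.sum_mul_sum]
    have hint : ∀ w w' : Fin (2 * m + 1) → V, Integrable
        (fun ω => walkProd (fun e => Y e ω) w * walkProd (fun e => Y e ω) w') μ := fun w w' =>
      integrable_of_abs_le_one ((h.measurable_walkProd w).mul (h.measurable_walkProd w'))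
        fun ω => by
          rw [abs_mul]
          exact mul_le_one₀ (h.abs_walkProd_le w ω) (abs_nonneg _) (h.abs_walkProd_le w' ω)
    rw [integral_finsetSum _ fun w _ => integrable_finsetSum _ fun w' _ => hint w w']
    exact Finset.sum_congr rfl fun w _ => integral_finsetSum _ fun w' _ => hint w w'
  rw [hsq, integral_finsetSum _ fun w _ => h.integrable_walkProd w, sq, Finset.sum_mul_sum,
    ← Finset.sum_sub_distrib]
  simp only [← Finset.sum_sub_distrib]
  -- A pair of walks is one family indexed by the disjoint union, so the count of families with few
  -- values applies.
  have hcard := card_small_image (V := V) (ι := Fin (2 * m + 1) ⊕ Fin (2 * m + 1)) (2 * m + 1)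
  set T := (Finset.univ : Finset (Fin (2 * m + 1) ⊕ Fin (2 * m + 1) → V)).filter
      (fun f => (Finset.univ.image f).card ≤ 2 * m + 1) with hT
  have himage : ∀ w w' : Fin (2 * m + 1) → V, Finset.univ.image (Sum.elim w w') =
      Finset.univ.image w ∪ Finset.univ.image w' := by
    intro w w'
    ext v
    simp
  calc ∑ w ∈ C, ∑ w' ∈ C,
        (∫ ω, walkProd (fun e => Y e ω) w * walkProd (fun e => Y e ω) w' ∂μ -
        (∫ ω, walkProd (fun e => Y e ω) w ∂μ) * ∫ ω, walkProd (fun e => Y e ω) w' ∂μ)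
      ≤ ∑ w ∈ C, ∑ w' ∈ C, if Sum.elim w w' ∈ T then (2 : ℝ) else 0 := by
        refine Finset.sum_le_sum fun w _ => Finset.sum_le_sum fun w' _ => ?_
        refine (h.covariance_walkProd_le w w').trans (le_of_eq ?_)
        simp only [hT, Finset.mem_filter, Finset.mem_univ, true_and, himage]
    _ ≤ ∑ w : Fin (2 * m + 1) → V, ∑ w' : Fin (2 * m + 1) → V,
          if Sum.elim w w' ∈ T then (2 : ℝ) else 0 := by
        refine (Finset.sum_le_sum fun w _ => Finset.sum_le_sum_of_subset_of_nonneg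
          (Finset.filter_subset _ _) fun _ _ _ => by positivity).trans ?_
        exact Finset.sum_le_sum_of_subset_of_nonneg
          (Finset.filter_subset _ _) fun _ _ _ => Finset.sum_nonneg fun _ _ => by positivity
    _ = ∑ f : Fin (2 * m + 1) ⊕ Fin (2 * m + 1) → V, if f ∈ T then (2 : ℝ) else 0 := by
        rw [← Fintype.sum_prod_type', ← (Equiv.sumArrowEquivProdArrow _ _ V).symm.sum_comp]
        rfl
    _ = T.card * 2 := by
        rw [← Finset.sum_filter]; simp
    _ ≤ ((2 * m + 1) ^ (4 * m + 2) * (Fintype.card V : ℝ) ^ (2 * m + 1)) * 2 := by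
        gcongr
        rw [Fintype.card_sum, Fintype.card_fin,
          show 2 * m + 1 + (2 * m + 1) = 4 * m + 2 by ring] at hcard
        exact_mod_cast hcard
    _ = _ := by ring

/-- The even trace moments of a noise matrix are, with high probability, at most twice those of
the semicircle law on an interval of radius `√n`. -/
theorem measure_trace_pow_gt_le (h : IsNoise μ Y) [Nonempty V] (m : ℕ)
    (hn : 2 * m ^ (2 * m + 1) ≤ Fintype.card V) :
    μ.real {ω | 2 * (Fintype.card V : ℝ) ^ (m + 1) < (sym2Matrix (fun e => Y e ω) ^ (2 * m)).trace} ≤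
      8 * (2 * m + 1 : ℝ) ^ (4 * m + 2) / Fintype.card V := by
  set n : ℝ := ((Fintype.card V : ℕ) : ℝ) with hndef
  have hn0 : 0 < n := by rw [hndef]; exact_mod_cast Fintype.card_pos
  have hnm : 2 * (m : ℝ) ^ (2 * m + 1) ≤ n := by rw [hndef]; exact_mod_cast hn
  have hE := h.integral_trace_pow_le m
  -- The lower bound `hn` on the number of vertices makes the lower-order term at most half of the
  -- main one. Chebyshev's inequality then has room `n ^ (m + 1) / 2`, whose square beats the
  -- variance by a factor of order `n`.
  have hE' : ∫ ω, (sym2Matrix (fun e => Y e ω) ^ (2 * m)).trace ∂μ ≤ 3 / 2 * n ^ (m + 1) := by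
    refine hE.trans ?_
    have := mul_le_mul_of_nonneg_right hnm (pow_nonneg hn0.le m)
    rw [← hndef]
    rw [pow_succ n m] at *
    nlinarith
  have hch := meas_ge_le_variance_div_sq (h.memLp_trace_pow (2 * m)) (c := n ^ (m + 1) / 2)
    (by positivity)
  have hvar := h.variance_trace_pow_le m
  rw [← hndef] at hvar
  have hfin : variance (fun ω => (sym2Matrix (fun e => Y e ω) ^ (2 * m)).trace) μ /
      (n ^ (m + 1) / 2) ^ 2 ≤ 8 * (2 * m + 1 : ℝ) ^ (4 * m + 2) / n := by
    rw [div_le_div_iff₀ (by positivity) hn0]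
    calc _ ≤ 2 * (2 * m + 1 : ℝ) ^ (4 * m + 2) * n ^ (2 * m + 1) * n := by gcongr
      _ = _ := by ring
  refine le_trans ?_ hfin
  rw [measureReal_def]
  refine ENNReal.toReal_le_of_le_ofReal ?_ (le_trans (measure_mono ?_) hch)
  · exact div_nonneg (variance_nonneg _ _) (by positivity)
  · intro ω hω
    simp only [Set.mem_ofPred_eq] at hω ⊢
    refine le_trans ?_ (le_abs_self _)
    linarith

end IsNoise

end TraceMoments

/-! ### The centered adjacency matrix as a noise family. -/

section Network

set_option linter.unusedSectionVars false

/-- The expectation of the adjacency matrix with logits `Θ`. -/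
noncomputable def meanMatrix {n : ℕ} (Θ : Matrix (Fin n) (Fin n) ℝ) : Matrix (Fin n) (Fin n) ℝ :=
  Matrix.of fun i j => if i = j then 0 else Real.sigmoid (Θ i j)

lemma logitMatrix_symm {n k : ℕ} (α : Fin n → ℝ) (Z : Matrix (Fin n) (Fin k) ℝ) (i j : Fin n) :
    logitMatrix α Z i j = logitMatrix α Z j i := by
  simp only [logitMatrix, additivePart, rowConst, Matrix.add_apply, Matrix.of_apply,
    Matrix.transpose_apply, Matrix.mul_apply]
  rw [add_comm (α i)]
  congr 1
  exact Finset.sum_congr rfl fun l _ => mul_comm _ _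

lemma sigmoid_mem_Icc (x : ℝ) : Real.sigmoid x ∈ Set.Icc (0 : ℝ) 1 :=
  ⟨(Real.sigmoid_pos x).le, (Real.sigmoid_lt_one x).le⟩

variable {n : ℕ} {Ω : Type*} [MeasurableSpace Ω] {μ : Measure Ω} [IsProbabilityMeasure μ]
  {Θ : Matrix (Fin n) (Fin n) ℝ} {A : Ω → Matrix (Fin n) (Fin n) ℝ}

/-- The centered entries of the adjacency matrix, indexed by unordered pairs. -/
noncomputable def networkNoise (Θ : Matrix (Fin n) (Fin n) ℝ) (A : Ω → Matrix (Fin n) (Fin n) ℝ)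
    (e : Sym2 (Fin n)) (ω : Ω) : ℝ := (A ω - meanMatrix Θ) e.inf e.sup

lemma sym2Matrix_networkNoise (h : IsBernoulliNetwork μ Θ A) (hΘ : ∀ i j, Θ i j = Θ j i) (ω : Ω) :
    sym2Matrix (fun e => networkNoise Θ A e ω) = A ω - meanMatrix Θ := by
  ext i j
  simp only [sym2Matrix, Matrix.of_apply, networkNoise, Sym2.inf_mk, Sym2.sup_mk]
  rcases le_total i j with hij | hij
  · rw [inf_eq_left.2 hij, sup_eq_right.2 hij]
  · rw [inf_eq_right.2 hij, sup_eq_left.2 hij]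
    simp only [Matrix.sub_apply, meanMatrix, Matrix.of_apply, h.symm ω j i, hΘ j i, eq_comm]

lemma networkNoise_of_not_lt (h : IsBernoulliNetwork μ Θ A) {e : Sym2 (Fin n)}
    (he : ¬ e.inf < e.sup) (ω : Ω) : networkNoise Θ A e ω = 0 := by
  have : e.inf = e.sup := by
    induction e with
    | h i j =>
      simp only [Sym2.inf_mk, Sym2.sup_mk] at he ⊢
      rcases le_total i j with hij | hij
      · rw [inf_eq_left.2 hij, sup_eq_right.2 hij] at he ⊢
        exact le_antisymm hij (not_lt.1 he)
      · rw [inf_eq_right.2 hij, sup_eq_left.2 hij] at he ⊢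
        exact le_antisymm hij (not_lt.1 he)
  simp [networkNoise, this, meanMatrix, h.diag]

lemma networkNoise_of_lt {e : Sym2 (Fin n)} (he : e.inf < e.sup) (ω : Ω) :
    networkNoise Θ A e ω = A ω e.inf e.sup - Real.sigmoid (Θ e.inf e.sup) := by
  simp [networkNoise, meanMatrix, he.ne]

lemma integral_entry (h : IsBernoulliNetwork μ Θ A) {i j : Fin n} (hij : i < j) :
    ∫ ω, A ω i j ∂μ = Real.sigmoid (Θ i j) := by
  have hset : MeasurableSet {ω | A ω i j = 1} :=
    h.measurable i j (measurableSet_singleton (1 : ℝ))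
  have : (fun ω => A ω i j) = {ω | A ω i j = 1}.indicator 1 := by
    funext ω
    by_cases hω : A ω i j = 1
    · rw [Set.indicator_of_mem (by exact hω), hω]; rfl
    · rw [Set.indicator_of_notMem (by exact hω)]
      exact (h.zero_or_one ω i j).resolve_right hω
  rw [this, integral_indicator_one hset, measureReal_def, h.prob i j hij,
    ENNReal.toReal_ofReal (Real.sigmoid_pos _).le]

theorem isNoise_networkNoise (h : IsBernoulliNetwork μ Θ A) : IsNoise μ (networkNoise Θ A) := by
  have hmeas : ∀ e, Measurable (networkNoise Θ A e) := fun e => by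
    unfold networkNoise
    simp only [Matrix.sub_apply]
    exact (h.measurable _ _).sub_const _
  have habs : ∀ e ω, |networkNoise Θ A e ω| ≤ 1 := by
    intro e ω
    by_cases he : e.inf < e.sup
    · rw [networkNoise_of_lt he]
      have := sigmoid_mem_Icc (Θ e.inf e.sup)
      rcases h.zero_or_one ω e.inf e.sup with h0 | h0 <;> rw [h0, abs_le] <;>
        constructor <;> linarith [this.1, this.2]
    · simp [networkNoise_of_not_lt h he]
  have hint : ∀ i j, Integrable (fun ω => A ω i j) μ := fun i j =>
    IsNoise.integrable_of_abs_le_one (h.measurable i j) fun ω => by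
      rcases h.zero_or_one ω i j with h0 | h0 <;> simp [h0]
  refine ⟨hmeas, habs, ?_, ?_, ?_⟩
  · intro a
    have hindep : iIndepFun (fun (e : {e : Sym2 (Fin n) // e.inf < e.sup}) ω =>
        A ω e.1.inf e.1.sup) μ := by
      refine h.indep.precomp (g := fun e : {e : Sym2 (Fin n) // e.inf < e.sup} =>
        (⟨(e.1.inf, e.1.sup), e.2⟩ : {p : Fin n × Fin n // p.1 < p.2})) ?_
      intro e e' hee
      simp only [Subtype.mk.injEq, Prod.mk.injEq] at hee
      apply Subtype.ext
      rw [← Sym2.inf_eq_inf_and_sup_eq_sup]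
      exact hee
    have hprod := hindep.integral_fun_prod_comp
      (f := fun e x => (x - Real.sigmoid (Θ e.1.inf e.1.sup)) ^ a e.1)
      (fun e => (h.measurable _ _).aemeasurable)
      (fun e => ((measurable_id.sub_const _).pow_const _).aestronglyMeasurable)
    -- Independence is given only for pairs `i < j`. The loops carry the deterministic value `0`, so
    -- their factors are constants and come out of the integral.
    have hsplit : ∀ g : Sym2 (Fin n) → ℝ, ∏ e, g e =
        (∏ e : {e : Sym2 (Fin n) // e.inf < e.sup}, g e) *
          ∏ e : {e : Sym2 (Fin n) // ¬ e.inf < e.sup}, g e := fun g =>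
      (Fintype.prod_subtype_mul_prod_subtype (fun e : Sym2 (Fin n) => e.inf < e.sup) g).symm
    have hlt : ∀ ω, ∏ e : {e : Sym2 (Fin n) // e.inf < e.sup}, networkNoise Θ A e ω ^ a e =
        ∏ e : {e : Sym2 (Fin n) // e.inf < e.sup},
          (A ω e.1.inf e.1.sup - Real.sigmoid (Θ e.1.inf e.1.sup)) ^ a e.1 := fun ω =>
      Finset.prod_congr rfl fun e _ => by rw [networkNoise_of_lt e.2]
    have hnlt : ∀ ω, ∏ e : {e : Sym2 (Fin n) // ¬ e.inf < e.sup}, networkNoise Θ A e ω ^ a e =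
        ∏ e : {e : Sym2 (Fin n) // ¬ e.inf < e.sup}, (0 : ℝ) ^ a e.1 := fun ω =>
      Finset.prod_congr rfl fun e _ => by rw [networkNoise_of_not_lt h e.2]
    simp only [hsplit, hlt, hnlt, integral_mul_const]
    rw [hprod]
    congr 1
    · refine Finset.prod_congr rfl fun e _ => ?_
      simp only [networkNoise_of_lt e.2]
    · refine Finset.prod_congr rfl fun e _ => ?_
      simp only [networkNoise_of_not_lt h e.2]
      simp
  · intro e
    by_cases he : e.inf < e.sup
    · simp only [networkNoise_of_lt he]
      rw [integral_sub (hint _ _) (integrable_const _), integral_entry h he]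
      simp
    · simp [networkNoise_of_not_lt h he]
  · intro e
    by_cases he : e.inf < e.sup
    · set p := Real.sigmoid (Θ e.inf e.sup) with hp
      -- For a variable with values in `{0, 1}` the square is affine in the variable, so its mean is
      -- `p (1 - p) ≤ 1 / 4`.
      have hsq : ∀ ω, networkNoise Θ A e ω ^ 2 = (1 - 2 * p) * A ω e.inf e.sup + p ^ 2 := by
        intro ω
        rw [networkNoise_of_lt he]
        rcases h.zero_or_one ω e.inf e.sup with h0 | h0 <;> rw [h0] <;> ring
      simp only [hsq]
      rw [integral_add ((hint _ _).const_mul _) (integrable_const _), integral_const_mul,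
        integral_entry h he]
      simp only [integral_const, probReal_univ, smul_eq_mul, one_mul]
      nlinarith [sq_nonneg (p - 1 / 2)]
    · simp [networkNoise_of_not_lt h he]

end Network

/-! ### Projections, trace moments and singular value thresholding. -/

section SquaredNorm

set_option linter.unusedSectionVars false

variable {m n p : Type*} [Fintype m] [Fintype n] [Fintype p]

/-- The squared Frobenius norm. -/
def sqNorm (M : Matrix m n ℝ) : ℝ := ∑ i, ∑ j, M i j ^ 2

lemma frobNorm_eq_sqrt_sqNorm {m n : ℕ} (M : Matrix (Fin m) (Fin n) ℝ) :
    frobNorm M = Real.sqrt (sqNorm M) := rfl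

lemma sqNorm_nonneg (M : Matrix m n ℝ) : 0 ≤ sqNorm M :=
  Finset.sum_nonneg fun _ _ => Finset.sum_nonneg fun _ _ => sq_nonneg _

lemma frobNorm_sq {m n : ℕ} (M : Matrix (Fin m) (Fin n) ℝ) : frobNorm M ^ 2 = sqNorm M :=
  Real.sq_sqrt (sqNorm_nonneg M)

lemma frobNorm_nonneg {m n : ℕ} (M : Matrix (Fin m) (Fin n) ℝ) : 0 ≤ frobNorm M :=
  Real.sqrt_nonneg _

lemma frobNorm_le_iff {m n m' n' : ℕ} (M : Matrix (Fin m) (Fin n) ℝ)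
    (N : Matrix (Fin m') (Fin n') ℝ) : frobNorm M ≤ frobNorm N ↔ sqNorm M ≤ sqNorm N :=
  Real.sqrt_le_sqrt_iff (sqNorm_nonneg N)

lemma sqNorm_transpose (M : Matrix m n ℝ) : sqNorm M.transpose = sqNorm M := Finset.sum_comm

lemma sum_row_sq_eq (M : Matrix m n ℝ) (i : m) : ∑ j, M i j ^ 2 = (M * M.transpose) i i := by
  simp only [Matrix.mul_apply, Matrix.transpose_apply, sq]

lemma sqNorm_eq_trace (M : Matrix m n ℝ) : sqNorm M = (M * M.transpose).trace := by
  simp only [sqNorm, sum_row_sq_eq, Matrix.trace, Matrix.diag_apply]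

lemma sqNorm_eq_trace' (M : Matrix m n ℝ) : sqNorm M = (M.transpose * M).trace := by
  rw [sqNorm_eq_trace, Matrix.trace_mul_comm]

lemma sqNorm_neg (M : Matrix m n ℝ) : sqNorm (-M) = sqNorm M := by simp [sqNorm]

lemma sqNorm_sub_comm (M N : Matrix m n ℝ) : sqNorm (M - N) = sqNorm (N - M) := by
  rw [← sqNorm_neg, neg_sub]

/-- The free weight is needed later: `x = 1 / 20` keeps the factor of the noise term at `1.05`, so
that it stays below the threshold. -/
lemma sqNorm_add_le {x : ℝ} (hx : 0 < x) (M N : Matrix m n ℝ) :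
    sqNorm (M + N) ≤ (1 + x) * sqNorm M + (1 + 1 / x) * sqNorm N := by
  simp only [sqNorm, Finset.mul_sum, ← Finset.sum_add_distrib]
  refine Finset.sum_le_sum fun i _ => Finset.sum_le_sum fun j _ => ?_
  have h : (1 + x) * M i j ^ 2 + (1 + 1 / x) * N i j ^ 2 - (M i j + N i j) ^ 2 =
      (x * M i j - N i j) ^ 2 / x := by
    field_simp
    ring
  have h2 : 0 ≤ (x * M i j - N i j) ^ 2 / x := by positivity
  rw [Matrix.add_apply]
  linarith

lemma sqNorm_add_le_two (M N : Matrix m n ℝ) :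
    sqNorm (M + N) ≤ 2 * sqNorm M + 2 * sqNorm N := by
  have := sqNorm_add_le one_pos M N
  norm_num at this
  linarith

lemma sqNorm_sub_le_two (M N : Matrix m n ℝ) :
    sqNorm (M - N) ≤ 2 * sqNorm M + 2 * sqNorm N := by
  rw [sub_eq_add_neg, ← sqNorm_neg N]
  exact sqNorm_add_le_two _ _

lemma sqNorm_orthogonal_mul [DecidableEq m] {U : Matrix m m ℝ}
    (hU : U ∈ Matrix.orthogonalGroup m ℝ) (M : Matrix m n ℝ) : sqNorm (U * M) = sqNorm M := by
  rw [sqNorm_eq_trace', sqNorm_eq_trace', Matrix.transpose_mul, Matrix.mul_assoc,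
    ← Matrix.mul_assoc U.transpose, (Matrix.mem_orthogonalGroup_iff' m ℝ).1 hU, Matrix.one_mul]

lemma transpose_mem_orthogonalGroup [DecidableEq m] {U : Matrix m m ℝ}
    (hU : U ∈ Matrix.orthogonalGroup m ℝ) : U.transpose ∈ Matrix.orthogonalGroup m ℝ := by
  rw [Matrix.mem_orthogonalGroup_iff, Matrix.transpose_transpose]
  exact (Matrix.mem_orthogonalGroup_iff' m ℝ).1 hU

lemma sqNorm_mul_orthogonal [DecidableEq n] {U : Matrix n n ℝ}
    (hU : U ∈ Matrix.orthogonalGroup n ℝ) (M : Matrix m n ℝ) : sqNorm (M * U) = sqNorm M := by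
  rw [← sqNorm_transpose, Matrix.transpose_mul,
    sqNorm_orthogonal_mul (transpose_mem_orthogonalGroup hU), sqNorm_transpose]

lemma sqNorm_diagonal_mul [DecidableEq m] (d : m → ℝ) (M : Matrix m n ℝ) :
    sqNorm (Matrix.diagonal d * M) = ∑ i, d i ^ 2 * ∑ j, M i j ^ 2 := by
  simp only [sqNorm, Matrix.diagonal_mul, mul_pow, Finset.mul_sum]

lemma orthogonal_row [DecidableEq m] {U : Matrix m m ℝ}
    (hU : U ∈ Matrix.orthogonalGroup m ℝ) (i : m) : ∑ j, U i j ^ 2 = 1 := by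
  have h : U * U.transpose = 1 := (Matrix.mem_orthogonalGroup_iff m ℝ).1 hU
  rw [sum_row_sq_eq, h, Matrix.one_apply_eq]

/-- Orthogonal projection matrices. -/
structure IsProj [DecidableEq n] (Q : Matrix n n ℝ) : Prop where
  idem : Q * Q = Q
  symm : Q.transpose = Q

namespace IsProj

variable [DecidableEq n] {Q : Matrix n n ℝ}

lemma one_sub (h : IsProj Q) : IsProj (1 - Q) := by
  refine ⟨?_, ?_⟩
  · rw [Matrix.mul_sub, Matrix.sub_mul, Matrix.sub_mul, h.idem]
    simp
  · rw [Matrix.transpose_sub, Matrix.transpose_one, h.symm]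

lemma row_mul (h : IsProj Q) (M : Matrix m n ℝ) (i : m) :
    ∑ j, (M * Q) i j ^ 2 = (M * Q * M.transpose) i i := by
  rw [sum_row_sq_eq, Matrix.transpose_mul, h.symm, Matrix.mul_assoc, ← Matrix.mul_assoc Q, h.idem,
    Matrix.mul_assoc]

/-- Pythagoras' theorem for the rows of a matrix. -/
lemma row_add (h : IsProj Q) (M : Matrix m n ℝ) (i : m) :
    ∑ j, (M * Q) i j ^ 2 + ∑ j, (M * (1 - Q) : Matrix m n ℝ) i j ^ 2 = ∑ j, M i j ^ 2 := by
  rw [h.row_mul, h.one_sub.row_mul, sum_row_sq_eq, Matrix.mul_sub, Matrix.sub_mul,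
    Matrix.sub_apply, Matrix.mul_one]
  ring

lemma row_le (h : IsProj Q) (M : Matrix m n ℝ) (i : m) :
    ∑ j, (M * Q) i j ^ 2 ≤ ∑ j, M i j ^ 2 := by
  rw [← h.row_add M i]
  have : 0 ≤ ∑ j, (M * (1 - Q) : Matrix m n ℝ) i j ^ 2 := Finset.sum_nonneg fun _ _ => sq_nonneg _
  linarith

lemma sqNorm_mul_le (h : IsProj Q) (M : Matrix m n ℝ) : sqNorm (M * Q) ≤ sqNorm M :=
  Finset.sum_le_sum fun i _ => h.row_le M i

lemma sqNorm_proj_mul_le (h : IsProj Q) (M : Matrix n m ℝ) : sqNorm (Q * M) ≤ sqNorm M := by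
  rw [← sqNorm_transpose, Matrix.transpose_mul, h.symm, ← sqNorm_transpose M]
  exact h.sqNorm_mul_le _

lemma sqNorm_eq (h : IsProj Q) : sqNorm Q = Q.trace := by
  rw [sqNorm_eq_trace, h.symm, h.idem]

lemma trace_nonneg (h : IsProj Q) : 0 ≤ Q.trace := by rw [← h.sqNorm_eq]; exact sqNorm_nonneg _

lemma sum_row_orthogonal (h : IsProj Q) {U : Matrix n n ℝ}
    (hU : U ∈ Matrix.orthogonalGroup n ℝ) : ∑ i, ∑ j, (U * Q) i j ^ 2 = Q.trace := by
  rw [← h.sqNorm_eq]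
  exact sqNorm_orthogonal_mul hU Q

end IsProj

/-- The spectral theorem for real symmetric matrices. -/
lemma exists_diagonalization [DecidableEq n] {W : Matrix n n ℝ} (hW : W.transpose = W) :
    ∃ O ∈ Matrix.orthogonalGroup n ℝ, ∃ d : n → ℝ, W = O * Matrix.diagonal d * O.transpose := by
  have hH : W.IsHermitian := by
    rw [Matrix.IsHermitian, Matrix.conjTranspose_eq_transpose_of_trivial, hW]
  refine ⟨hH.eigenvectorUnitary, hH.eigenvectorUnitary.2, hH.eigenvalues, ?_⟩
  have h := hH.spectral_theorem
  rw [Unitary.conjStarAlgAut_apply, Matrix.star_eq_conjTranspose,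
    Matrix.conjTranspose_eq_transpose_of_trivial] at h
  exact h

lemma diagonalization_pow [DecidableEq n] {O : Matrix n n ℝ}
    (hO : O ∈ Matrix.orthogonalGroup n ℝ) (d : n → ℝ) (N : ℕ) :
    (O * Matrix.diagonal d * O.transpose) ^ N =
      O * Matrix.diagonal (fun i => d i ^ N) * O.transpose := by
  have h : O.transpose * O = 1 := (Matrix.mem_orthogonalGroup_iff' n ℝ).1 hO
  have h' : O * O.transpose = 1 := (Matrix.mem_orthogonalGroup_iff n ℝ).1 hO
  induction N with
  | zero => simp [h']
  | succ N ih =>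
    rw [pow_succ, ih]
    calc _ = O * Matrix.diagonal (fun i => d i ^ N) * (O.transpose * O) * Matrix.diagonal d *
          O.transpose := by simp only [Matrix.mul_assoc]
      _ = _ := by
        rw [h, Matrix.mul_one, Matrix.mul_assoc O, Matrix.diagonal_mul_diagonal]
        simp only [pow_succ]

lemma trace_diagonalization [DecidableEq n] {O : Matrix n n ℝ}
    (hO : O ∈ Matrix.orthogonalGroup n ℝ) (d : n → ℝ) :
    (O * Matrix.diagonal d * O.transpose).trace = ∑ i, d i := by
  have h : O.transpose * O = 1 := (Matrix.mem_orthogonalGroup_iff' n ℝ).1 hO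
  rw [Matrix.mul_assoc, Matrix.trace_mul_comm, Matrix.mul_assoc, h, Matrix.mul_one,
    Matrix.trace_diagonal]

/-- A symmetric matrix with a small trace moment is small on subspaces of small dimension. -/
lemma IsProj.sqNorm_mul_symm_le [DecidableEq n] {Q W : Matrix n n ℝ} (hQ : IsProj Q)
    (hW : W.transpose = W) {a : ℝ} (ha : 0 < a) (N : ℕ) :
    sqNorm (Q * W) ≤ a * Q.trace + (W ^ (2 * (N + 1))).trace / a ^ N := by
  obtain ⟨O, hO, d, rfl⟩ := exists_diagonalization hW
  have hO' := transpose_mem_orthogonalGroup hO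
  rw [diagonalization_pow hO, trace_diagonalization hO, ← Matrix.mul_assoc, sqNorm_mul_orthogonal hO',
    ← sqNorm_transpose, ← Matrix.mul_assoc, Matrix.transpose_mul, Matrix.diagonal_transpose,
    sqNorm_diagonal_mul, Matrix.transpose_mul, hQ.symm, ← hQ.sum_row_orthogonal hO', Finset.mul_sum,
    Finset.sum_div, ← Finset.sum_add_distrib]
  refine Finset.sum_le_sum fun i _ => ?_
  -- In an eigenbasis of `W` the squared norm of `Q W` is the sum of the `d i ^ 2` with weights `c`
  -- in `[0, 1]` of total mass `tr Q`. Eigenvalues with `d i ^ 2 ≤ a` are charged to `a * tr Q`,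
  -- larger ones to the trace moment.
  set c := ∑ j, (O.transpose * Q) i j ^ 2 with hc
  have hc0 : 0 ≤ c := Finset.sum_nonneg fun _ _ => sq_nonneg _
  have hc1 : c ≤ 1 := (hQ.row_le _ i).trans_eq (orthogonal_row hO' i)
  have hkey : d i ^ 2 ≤ a + d i ^ (2 * (N + 1)) / a ^ N := by
    rw [pow_mul]
    set y := d i ^ 2 with hy
    have hy0 : 0 ≤ y := sq_nonneg _
    rcases le_total y a with h | h
    · have : 0 ≤ y ^ (N + 1) / a ^ N := by positivity
      linarith
    · have h1 : a ^ N ≤ y ^ N := pow_le_pow_left₀ ha.le h N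
      have : y ≤ y ^ (N + 1) / a ^ N := by
        rw [le_div_iff₀ (by positivity), pow_succ, mul_comm]
        exact mul_le_mul_of_nonneg_right h1 hy0
      linarith
  have hnn : 0 ≤ d i ^ (2 * (N + 1)) / a ^ N := by
    rw [pow_mul]; positivity
  calc d i ^ 2 * c ≤ (a + d i ^ (2 * (N + 1)) / a ^ N) * c := mul_le_mul_of_nonneg_right hkey hc0
    _ ≤ _ := by nlinarith

/-- Singular value thresholding of `L + E + W`, where `L` has small rank, `E` has small Frobenius
norm and `W` is small on subspaces of small dimension. -/
theorem sqNorm_threshold_sub_le {n : ℕ} {A B L E W Q : Matrix (Fin n) (Fin n) ℝ} {τ K : ℝ}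
    (hA : A = L + E + W) (hW : W.transpose = W) (hQ : IsProj Q) (hLQ : L * Q = L)
    (hB : IsSingularValueThreshold A τ B) (hτ : 0 ≤ τ) (hτn : 1.21 * (n : ℝ) ≤ τ ^ 2)
    (hK : ∀ Q' : Matrix (Fin n) (Fin n) ℝ, IsProj Q' →
      sqNorm (Q' * W) ≤ 1.04 * n * Q'.trace + K) (hK0 : 0 ≤ K) :
    sqNorm (B - (L + E)) ≤
      36 * (n * Q.trace) + 33 * K + 400 * sqNorm E + 12 * (τ ^ 2 * Q.trace) := by
  obtain ⟨U, hU, V, hV, s, hs, hAs, hBs⟩ := hB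
  have hUU : U.transpose * U = 1 := (Matrix.mem_orthogonalGroup_iff' _ ℝ).1 hU
  have hV' := transpose_mem_orthogonalGroup hV
  -- `T` projects to the retained left singular vectors, so that `T * A = B`, and `q` counts the
  -- retained singular values.
  set χ : Fin n → ℝ := fun i => if τ ≤ s i then 1 else 0 with hχ
  set T := U * Matrix.diagonal χ * U.transpose with hTdef
  have hT : IsProj T := by
    refine ⟨?_, ?_⟩
    · have := diagonalization_pow hU χ 2
      rw [sq] at this
      rw [hTdef, this]
      congr 3
      funext i
      simp only [hχ]
      split_ifs <;> norm_num
    · simp [hTdef, Matrix.transpose_mul, Matrix.mul_assoc]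
  set q := T.trace with hq
  have hqsum : q = ∑ i, χ i := trace_diagonalization hU χ
  have hTA : T * A = B := by
    rw [hAs, hBs, hTdef]
    calc _ = U * Matrix.diagonal χ * (U.transpose * U) * Matrix.diagonal s * V.transpose := by
          simp only [Matrix.mul_assoc]
      _ = _ := by
        rw [hUU, Matrix.mul_one, Matrix.mul_assoc U, Matrix.diagonal_mul_diagonal]
        congr 3
        funext i
        simp only [hχ]
        split_ifs <;> simp
  have hTA' : (1 - T) * A = U * Matrix.diagonal (fun i => if τ ≤ s i then 0 else s i) *
      V.transpose := by
    rw [Matrix.sub_mul, Matrix.one_mul, hTA, hAs, hBs, ← Matrix.sub_mul, ← Matrix.mul_sub,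
      Matrix.diagonal_sub]
    congr 3
    funext i
    split_ifs <;> simp
  have hr0 := hQ.trace_nonneg
  have hq0 := hT.trace_nonneg
  rw [← hq] at hq0
  set r := Q.trace with hr
  set e := sqNorm E with he
  have he0 : 0 ≤ e := sqNorm_nonneg _
  have hcsum : ∑ i, ∑ j, (V.transpose * Q) i j ^ 2 = r := hQ.sum_row_orthogonal hV'
  have hc0 : ∀ i, 0 ≤ ∑ j, (V.transpose * Q) i j ^ 2 := fun i =>
    Finset.sum_nonneg fun _ _ => sq_nonneg _
  have hcomp : ∀ i, ∑ j, (V.transpose * Q) i j ^ 2 + ∑ j, (V.transpose * (1 - Q) : Matrix (Fin n) (Fin n) ℝ) i j ^ 2 = 1 :=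
    fun i => (hQ.row_add _ i).trans (orthogonal_row hV' i)
  -- the number of retained singular values
  have hcount : τ ^ 2 * (q - r) ≤ 1.05 * (1.04 * n * q + K) + 21 * e := by
    -- Off the row space of the signal, `B` consists only of noise and approximation error, yet each
    -- retained singular value exceeds `τ`. Comparing both bounds limits their number.
    have h1 : B * (1 - Q) = T * W * (1 - Q) + T * E * (1 - Q) := by
      have hL0 : L * (1 - Q) = 0 := by rw [Matrix.mul_sub, hLQ, Matrix.mul_one, sub_self]
      rw [← hTA, hA, Matrix.mul_add, Matrix.mul_add, Matrix.add_mul, Matrix.add_mul,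
        Matrix.mul_assoc T L, hL0, Matrix.mul_zero, zero_add, add_comm]
    have h2 : sqNorm (B * (1 - Q)) ≤ 1.05 * (1.04 * n * q + K) + 21 * e := by
      rw [h1]
      refine (sqNorm_add_le (x := 1 / 20) (by norm_num) _ _).trans ?_
      have h3 := (hQ.one_sub.sqNorm_mul_le (T * W)).trans (hK T hT)
      have h4 := (hQ.one_sub.sqNorm_mul_le (T * E)).trans (hT.sqNorm_proj_mul_le E)
      norm_num
      linarith
    refine le_trans ?_ h2
    rw [hBs, Matrix.mul_assoc, Matrix.mul_assoc, sqNorm_orthogonal_mul hU, sqNorm_diagonal_mul]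
    calc τ ^ 2 * (q - r) ≤ τ ^ 2 * ∑ i, χ i * ∑ j, (V.transpose * (1 - Q) : Matrix (Fin n) (Fin n) ℝ) i j ^ 2 := by
          refine mul_le_mul_of_nonneg_left ?_ (sq_nonneg _)
          rw [hqsum, ← hcsum, ← Finset.sum_sub_distrib]
          refine Finset.sum_le_sum fun i _ => ?_
          have h5 := hcomp i
          have h6 := hc0 i
          simp only [hχ]
          split_ifs <;> linarith
      _ ≤ _ := by
          rw [Finset.mul_sum]
          refine Finset.sum_le_sum fun i _ => ?_
          rw [← mul_assoc]
          refine mul_le_mul_of_nonneg_right ?_ (Finset.sum_nonneg fun _ _ => sq_nonneg _)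
          simp only [hχ]
          split_ifs with hi
          · rw [mul_one]; exact pow_le_pow_left₀ hτ hi 2
          · simp
  -- The gap `1.21 - 1.05 * 1.04 = 0.118` absorbs the term in `n * q` on the right of `hcount`; the
  -- constants are the quotients by `0.118`, rounded up.
  have hnq : (n : ℝ) * q ≤ 11 * (n * r) + 9 * K + 178 * e := by
    have hn0 : (0 : ℝ) ≤ n := Nat.cast_nonneg n
    rcases le_total q r with h | h
    · have := mul_le_mul_of_nonneg_left h hn0
      have := mul_nonneg hn0 hr0
      linarith
    · have := mul_le_mul_of_nonneg_right hτn (sub_nonneg.2 h)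
      nlinarith
  -- the part of the signal that is lost
  have hlost : sqNorm ((1 - T) * L) ≤ 3 * (τ ^ 2 * r + (1.04 * n * r + K) + e) := by
    -- Since `L = L * Q`, the lost signal is what `(1 - T) * A` does on the range of `Q`, up to
    -- noise and error. There all remaining singular values are below `τ`.
    have h1 : (1 - T) * L = (1 - T) * A * Q + (-((1 - T) * (W * Q)) + -((1 - T) * (E * Q))) := by
      rw [hA]
      simp only [Matrix.mul_add, Matrix.add_mul, Matrix.mul_assoc, hLQ]
      abel
    have h2 : sqNorm ((1 - T) * A * Q) ≤ τ ^ 2 * r := by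
      rw [hTA', Matrix.mul_assoc, Matrix.mul_assoc, sqNorm_orthogonal_mul hU, sqNorm_diagonal_mul,
        ← hcsum, Finset.mul_sum]
      refine Finset.sum_le_sum fun i _ => mul_le_mul_of_nonneg_right ?_ (hc0 i)
      split_ifs with hi
      · simp [sq_nonneg]
      · exact pow_le_pow_left₀ (hs i) (not_le.1 hi).le 2
    have h3 : sqNorm (-((1 - T) * (W * Q))) ≤ 1.04 * n * r + K := by
      rw [sqNorm_neg]
      refine (hT.one_sub.sqNorm_proj_mul_le _).trans ?_
      rw [← sqNorm_transpose, Matrix.transpose_mul, hQ.symm, hW]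
      exact hK Q hQ
    have h4 : sqNorm (-((1 - T) * (E * Q))) ≤ e := by
      rw [sqNorm_neg]
      exact (hT.one_sub.sqNorm_proj_mul_le _).trans (hQ.sqNorm_mul_le _)
    rw [h1]
    have h5 := sqNorm_add_le (x := 2) (by norm_num) ((1 - T) * A * Q)
      (-((1 - T) * (W * Q)) + -((1 - T) * (E * Q)))
    have h6 := sqNorm_add_le_two (-((1 - T) * (W * Q))) (-((1 - T) * (E * Q)))
    norm_num at h5
    linarith
  have hdecomp : B - (L + E) = T * W - ((1 - T) * L + (1 - T) * E) := by
    rw [← hTA, hA]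
    simp only [Matrix.mul_add, Matrix.sub_mul, Matrix.one_mul]
    abel
  rw [hdecomp]
  have h1 := sqNorm_sub_le_two (T * W) ((1 - T) * L + (1 - T) * E)
  have h2 := sqNorm_add_le_two ((1 - T) * L) ((1 - T) * E)
  have h3 := hT.one_sub.sqNorm_proj_mul_le E
  have h4 := hK T hT
  have h5 : 0 ≤ (n : ℝ) * r := mul_nonneg (Nat.cast_nonneg n) hr0
  nlinarith

end SquaredNorm

/-! ### Averaging projections of partitions. -/

section BlockAverage

variable {n : ℕ} {T : Type*} [Fintype T] [DecidableEq T]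

/-- The matrix that averages over the blocks of the partition into fibres of `c`. -/
noncomputable def blockAverage (c : Fin n → T) : Matrix (Fin n) (Fin n) ℝ :=
  Matrix.of fun i j => if c i = c j then
    ((Finset.univ.filter fun l => c l = c j).card : ℝ)⁻¹ else 0

omit [Fintype T] in
lemma fiber_card_pos (c : Fin n → T) (j : Fin n) :
    (0 : ℝ) < (Finset.univ.filter fun l => c l = c j).card := by
  exact_mod_cast Finset.card_pos.2 ⟨j, by simp⟩

omit [Fintype T] in
lemma mul_blockAverage (c : Fin n → T) {M : Matrix (Fin n) (Fin n) ℝ} (F : Fin n → T → ℝ)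
    (hM : ∀ i j, M i j = F i (c j)) : M * blockAverage c = M := by
  ext i j
  rw [Matrix.mul_apply]
  simp only [blockAverage, Matrix.of_apply, mul_ite, mul_zero]
  rw [← Finset.sum_filter, Finset.sum_congr rfl (g := fun _ => F i (c j) *
    ((Finset.univ.filter fun l => c l = c j).card : ℝ)⁻¹)]
  · rw [Finset.sum_const, nsmul_eq_mul, hM]
    have := fiber_card_pos c j
    field_simp
  · intro l hl
    rw [hM, (Finset.mem_filter.1 hl).2]

omit [Fintype T] in
lemma isProj_blockAverage (c : Fin n → T) : IsProj (blockAverage c) := by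
  refine ⟨mul_blockAverage c (fun i t => if c i = t then
    ((Finset.univ.filter fun l => c l = t).card : ℝ)⁻¹ else 0) (fun i j => rfl), ?_⟩
  ext i j
  simp only [blockAverage, Matrix.transpose_apply, Matrix.of_apply]
  by_cases h : c i = c j
  · simp [h]
  · rw [if_neg h, if_neg (Ne.symm h)]

/-- Each nonempty block contributes `1` to the trace and each empty one `0`. -/
lemma trace_blockAverage_le (c : Fin n → T) : (blockAverage c).trace ≤ Fintype.card T := by
  have h : (blockAverage c).trace =
      ∑ i, ((Finset.univ.filter fun l => c l = c i).card : ℝ)⁻¹ := by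
    simp [Matrix.trace, blockAverage]
  rw [h, ← Finset.sum_fiberwise (s := Finset.univ) (g := c)]
  calc _ ≤ ∑ t : T, (1 : ℝ) := by
        refine Finset.sum_le_sum fun t _ => ?_
        rw [Finset.sum_congr rfl (g := fun _ =>
          ((Finset.univ.filter fun l => c l = t).card : ℝ)⁻¹)
          (fun i hi => by rw [(Finset.mem_filter.1 hi).2]), Finset.sum_const, nsmul_eq_mul]
        exact mul_inv_le_one
    _ = _ := by simp

end BlockAverage

/-! ### Block approximation of the edge probabilities. -/

section LowRank

/-- The edge probability as a function of the parameters of the two nodes. -/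
noncomputable def linkFunction (k : ℕ) (p : (ℝ × (Fin k → ℝ)) × (ℝ × (Fin k → ℝ))) : ℝ :=
  Real.sigmoid (p.1.1 + p.2.1 + ∑ l, p.1.2 l * p.2.2 l)

lemma continuous_linkFunction (k : ℕ) : Continuous (linkFunction k) := by
  unfold linkFunction
  refine continuous_sigmoid.comp ?_
  fun_prop

lemma sigmoid_logitMatrix {n k : ℕ} (α : Fin n → ℝ) (Z : Matrix (Fin n) (Fin k) ℝ) (i j : Fin n) :
    Real.sigmoid (logitMatrix α Z i j) = linkFunction k ((α i, Z i), (α j, Z j)) := by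
  simp [linkFunction, logitMatrix, additivePart, rowConst, Matrix.mul_apply]

/-- Up to a small error in the Frobenius norm, the matrix of edge probabilities has a rank that is
bounded independently of the number of nodes. -/
theorem exists_lowRank_approx (k : ℕ) (M₁ : ℝ) {ε : ℝ} (hε : 0 < ε) :
    ∃ r : ℕ, ∀ (n : ℕ) (α : Fin n → ℝ) (Z : Matrix (Fin n) (Fin k) ℝ),
      (∀ i, |α i| ≤ M₁ / 2) → (∀ i, ∑ l, Z i l ^ 2 ≤ M₁ / 2) →
      ∃ L Q : Matrix (Fin n) (Fin n) ℝ, IsProj Q ∧ Q.trace ≤ r ∧ L * Q = L ∧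
        sqNorm (meanMatrix (logitMatrix α Z) - L) ≤ ε * (n : ℝ) ^ 2 + n := by
  classical
  set K : Set (ℝ × (Fin k → ℝ)) := Metric.closedBall 0 (|M₁| + 1) with hK
  have hKc : IsCompact K := isCompact_closedBall _ _
  -- Uniform continuity on a compact set gives a radius `δ`, hence a finite net `t`, that do not
  -- depend on `n`. Replacing node parameters by nearby net points yields a matrix constant on
  -- blocks.
  have huc := (hKc.prod hKc).uniformContinuousOn_of_continuous
    (continuous_linkFunction k).continuousOn
  rw [Metric.uniformContinuousOn_iff] at huc
  obtain ⟨δ, hδ, hδg⟩ := huc (Real.sqrt ε) (Real.sqrt_pos.2 hε)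
  obtain ⟨t, htK, htf, htc⟩ := hKc.finite_cover_balls hδ
  have : Fintype t := htf.fintype
  refine ⟨Fintype.card t, fun n α Z hα hZ => ?_⟩
  have hmem : ∀ i, (α i, Z i) ∈ K := by
    intro i
    rw [hK, mem_closedBall_zero_iff, Prod.norm_def, max_le_iff, Real.norm_eq_abs]
    have h0 := le_abs_self M₁
    have h1 := (abs_nonneg _).trans (hα i)
    refine ⟨by linarith [hα i], (pi_norm_le_iff_of_nonneg (by positivity)).2 fun l => ?_⟩
    have h2 : Z i l ^ 2 ≤ M₁ / 2 :=
      (Finset.single_le_sum (fun l _ => sq_nonneg (Z i l)) (Finset.mem_univ l)).trans (hZ i)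
    rw [Real.norm_eq_abs]
    refine abs_le_of_sq_le_sq ?_ (by positivity)
    nlinarith
  have hcov : ∀ i, ∃ x : t, dist (α i, Z i) x.1 < δ := by
    intro i
    obtain ⟨x, hx, hxb⟩ := Set.mem_iUnion₂.1 (htc (hmem i))
    exact ⟨⟨x, hx⟩, hxb⟩
  choose c hc using hcov
  refine ⟨Matrix.of fun i j => linkFunction k ((c i).1, (c j).1), blockAverage c,
    isProj_blockAverage c, trace_blockAverage_le c,
    mul_blockAverage c (fun i t => linkFunction k ((c i).1, t.1)) (fun _ _ => rfl), ?_⟩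
  -- The diagonal of the mean is zero and is not approximated; it costs at most `1` per entry, hence
  -- the summand `n`.
  have hentry : ∀ i j, (meanMatrix (logitMatrix α Z) -
      Matrix.of fun i j => linkFunction k ((c i).1, (c j).1)) i j ^ 2 ≤
      ε + if i = j then 1 else 0 := by
    intro i j
    rw [Matrix.sub_apply, Matrix.of_apply, meanMatrix, Matrix.of_apply]
    split_ifs with hij
    · have := sigmoid_mem_Icc ((c i).1.1 + (c j).1.1 + ∑ l, (c i).1.2 l * (c j).1.2 l)
      have h1 : linkFunction k ((c i).1, (c j).1) ∈ Set.Icc (0 : ℝ) 1 := this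
      nlinarith [h1.1, h1.2]
    · rw [sigmoid_logitMatrix, add_zero]
      have h1 := hδg ((α i, Z i), (α j, Z j)) ⟨hmem i, hmem j⟩ ((c i).1, (c j).1)
        ⟨htK (c i).2, htK (c j).2⟩ (by rw [Prod.dist_eq]; exact max_lt (hc i) (hc j))
      rw [Real.dist_eq] at h1
      rw [← sq_abs, ← Real.sq_sqrt hε.le]
      exact pow_le_pow_left₀ (abs_nonneg _) h1.le 2
  calc _ ≤ ∑ i : Fin n, ∑ j : Fin n, (ε + if i = j then 1 else 0) :=
        Finset.sum_le_sum fun i _ => Finset.sum_le_sum fun j _ => hentry i j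
    _ = _ := by
        simp [Finset.sum_add_distrib]
        ring

end LowRank

/-! ### From probabilities to logits. -/

section Logit

lemma logit_sigmoid (x : ℝ) : logit (Real.sigmoid x) = x := by
  have h1 : 1 - Real.sigmoid x = Real.sigmoid (-x) := by rw [Real.sigmoid_neg]
  have h2 : Real.sigmoid x / (1 - Real.sigmoid x) = Real.exp x := by
    rw [h1, Real.sigmoid_def, Real.sigmoid_def, neg_neg, Real.exp_neg]
    have := Real.exp_pos x
    field_simp
    ring
  rw [logit, h2, Real.log_exp]

lemma log_sub_log_le {a x y : ℝ} (ha : 0 < a) (hx : a ≤ x) (hy : a ≤ y) :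
    Real.log x - Real.log y ≤ |x - y| / a := by
  have hx0 := ha.trans_le hx
  have hy0 := ha.trans_le hy
  rw [← Real.log_div hx0.ne' hy0.ne']
  refine (Real.log_le_sub_one_of_pos (div_pos hx0 hy0)).trans ?_
  have : x / y - 1 = (x - y) / y := by field_simp
  rw [this]
  exact (div_le_div_of_nonneg_right (le_abs_self _) hy0.le).trans
    (div_le_div_of_nonneg_left (abs_nonneg _) ha hy)

/-- In `log z - log (1 - z)` the first term has slope at most `1 / a` and the second at most `2` on
this interval. -/
lemma abs_logit_sub_logit_le {a x y : ℝ} (ha : 0 < a) (hx : x ∈ Set.Icc a (1 / 2))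
    (hy : y ∈ Set.Icc a (1 / 2)) : |logit x - logit y| ≤ (1 / a + 2) * |x - y| := by
  have hlog : ∀ z ∈ Set.Icc a (1 / 2), logit z = Real.log z - Real.log (1 - z) := by
    intro z hz
    rw [logit, Real.log_div (ha.trans_le hz.1).ne' (by linarith [hz.2])]
  rw [hlog x hx, hlog y hy]
  have h1 := log_sub_log_le ha hx.1 hy.1
  have h2 := log_sub_log_le ha hy.1 hx.1
  have h3 := log_sub_log_le (a := 1 / 2) (x := 1 - x) (y := 1 - y) (by norm_num)
    (by linarith [hx.2]) (by linarith [hy.2])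
  have h4 := log_sub_log_le (a := 1 / 2) (x := 1 - y) (y := 1 - x) (by norm_num)
    (by linarith [hy.2]) (by linarith [hx.2])
  rw [abs_sub_comm y x] at h2
  rw [show 1 - x - (1 - y) = y - x by ring, abs_sub_comm y x] at h3
  rw [show 1 - y - (1 - x) = x - y by ring] at h4
  have h5 : (1 / a + 2) * |x - y| = |x - y| / a + |x - y| / (1 / 2) := by
    field_simp
  rw [h5, abs_le]
  constructor <;> linarith

lemma clip_mem {n : ℕ} {M₁ : ℝ} (hM : 0 ≤ M₁) (B : Matrix (Fin n) (Fin n) ℝ) (i j : Fin n) :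
    clip M₁ B i j ∈ Set.Icc (Real.exp (-M₁) / 2) (1 / 2) := by
  have : Real.exp (-M₁) ≤ 1 := Real.exp_le_one_iff.2 (by linarith)
  simp only [clip, Matrix.map_apply]
  exact ⟨le_max_left _ _, max_le (by linarith) (min_le_right _ _)⟩

lemma abs_clip_sub_le {n : ℕ} {M₁ : ℝ} (B : Matrix (Fin n) (Fin n) ℝ) (i j : Fin n) {p : ℝ}
    (hp : p ∈ Set.Icc (Real.exp (-M₁) / 2) (1 / 2)) : |clip M₁ B i j - p| ≤ |B i j - p| := by
  simp only [clip, Matrix.map_apply]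
  have h1 : p = max (Real.exp (-M₁) / 2) (min p (1 / 2)) := by
    rw [min_eq_left hp.2, max_eq_right hp.1]
  calc _ = |max (Real.exp (-M₁) / 2) (min (B i j) (1 / 2)) -
        max (Real.exp (-M₁) / 2) (min p (1 / 2))| := by rw [← h1]
    _ ≤ |min (B i j) (1 / 2) - min p (1 / 2)| := by
        refine (abs_max_sub_max_le_max _ _ _ _).trans ?_
        simp
    _ ≤ _ := by
        refine (abs_min_sub_min_le_max _ _ _ _).trans ?_
        simp

lemma sigmoid_mem_clip_range {M₁ x : ℝ} (hM : 0 ≤ M₁) (h1 : -M₁ ≤ x) (h2 : x ≤ 0) :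
    Real.sigmoid x ∈ Set.Icc (Real.exp (-M₁) / 2) (1 / 2) := by
  rw [Real.sigmoid_def]
  have h3 : 1 ≤ Real.exp (-x) := Real.one_le_exp (by linarith)
  have h4 : Real.exp (-x) ≤ Real.exp M₁ := Real.exp_le_exp.2 (by linarith)
  have h5 : 1 ≤ Real.exp M₁ := Real.one_le_exp hM
  constructor
  · rw [Real.exp_neg, div_eq_mul_inv, ← mul_inv]
    exact inv_anti₀ (by positivity) (by linarith)
  · rw [one_div]
    exact inv_anti₀ (by norm_num) (by linarith)

lemma abs_logitMatrix_diag_le {n k : ℕ} {M₁ M₂ : ℝ} {α : Fin n → ℝ} {Z : Matrix (Fin n) (Fin k) ℝ}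
    (h : InParameterSpace M₁ M₂ α Z) (i : Fin n) : |logitMatrix α Z i i| ≤ 2 * M₁ := by
  have h1 := abs_le.1 (h.alpha_le i)
  have h2 := h.latent_le i
  have h3 : 0 ≤ ∑ l, Z i l ^ 2 := Finset.sum_nonneg fun _ _ => sq_nonneg _
  have h4 : logitMatrix α Z i i = α i + α i + ∑ l, Z i l ^ 2 := by
    simp [logitMatrix, additivePart, rowConst, Matrix.mul_apply, sq]
  rw [h4, abs_le]
  constructor <;> linarith

/-- The error of the estimated logits in terms of that of the estimated probabilities. -/
lemma sqNorm_symLogit_sub_le {n k : ℕ} {M₁ M₂ : ℝ} {α : Fin n → ℝ} {Z : Matrix (Fin n) (Fin k) ℝ}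
    (h : InParameterSpace M₁ M₂ α Z) (hM : 0 ≤ M₁) (B : Matrix (Fin n) (Fin n) ℝ) :
    sqNorm (symLogit (clip M₁ B) - logitMatrix α Z) ≤
      (2 * Real.exp M₁ + 2) ^ 2 * sqNorm (B - meanMatrix (logitMatrix α Z)) +
        (2 * Real.exp M₁ + 2 + 2 * M₁) ^ 2 * n := by
  set a := Real.exp (-M₁) / 2 with ha
  set C := 2 * Real.exp M₁ + 2 with hC
  set D := B - meanMatrix (logitMatrix α Z) with hD
  have ha0 : 0 < a := by positivity
  have hCa : 1 / a + 2 = C := by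
    rw [ha, hC, Real.exp_neg]
    have := Real.exp_pos M₁
    field_simp
  have hC0 : 0 < C := by positivity
  have hmem : ∀ i j, (clip M₁ B i j + clip M₁ B j i) / 2 ∈ Set.Icc a (1 / 2) := by
    intro i j
    have h1 := clip_mem hM B i j
    have h2 := clip_mem hM B j i
    exact ⟨by linarith [h1.1, h2.1], by linarith [h1.2, h2.2]⟩
  have hentry : ∀ i j, (symLogit (clip M₁ B) - logitMatrix α Z) i j ^ 2 ≤
      C ^ 2 / 2 * (D i j ^ 2 + D j i ^ 2) + if i = j then (C + 2 * M₁) ^ 2 else 0 := by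
    intro i j
    rw [Matrix.sub_apply, symLogit, Matrix.of_apply]
    split_ifs with hij
    · subst hij
      -- On the diagonal the logit is not estimated. Comparison with `logit (1 / 2) = 0` bounds the
      -- entry, and there are only `n` of them.
      have h1 := abs_logit_sub_logit_le ha0 (hmem i i)
        (y := 1 / 2) ⟨by linarith [(hmem i i).1, (hmem i i).2], le_refl _⟩
      have h2 : logit (1 / 2) = 0 := by norm_num [logit]
      have h3 : |(clip M₁ B i i + clip M₁ B i i) / 2 - 1 / 2| ≤ 1 := by
        have := hmem i i
        rw [abs_le]; constructor <;> linarith [this.1, this.2]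
      rw [h2, sub_zero, hCa] at h1
      have h4 := h1.trans (mul_le_of_le_one_right hC0.le h3)
      have h5 := abs_logitMatrix_diag_le h i
      have h6 : 0 ≤ C ^ 2 / 2 * (D i i ^ 2 + D i i ^ 2) := by positivity
      have h7 := (abs_sub (logit ((clip M₁ B i i + clip M₁ B i i) / 2))
        (logitMatrix α Z i i)).trans (add_le_add h4 h5)
      rw [← sq_abs]
      have := pow_le_pow_left₀ (abs_nonneg _) h7 2
      linarith
    · have hp := sigmoid_mem_clip_range hM (h.lower i j hij)
        ((h.upper i j hij).trans (by linarith [h.M₂_nonneg]))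
      set p := Real.sigmoid (logitMatrix α Z i j) with hpdef
      have hDij : D i j = B i j - p := by
        simp [hD, meanMatrix, hij, hpdef]
      have hDji : D j i = B j i - p := by
        simp [hD, meanMatrix, Ne.symm hij, hpdef, logitMatrix_symm α Z j i]
      have h1 := abs_logit_sub_logit_le ha0 (hmem i j) hp
      rw [hpdef, logit_sigmoid, ← hpdef, hCa] at h1
      have h2 := abs_clip_sub_le B i j hp
      have h3 := abs_clip_sub_le B j i hp
      rw [← hDij] at h2
      rw [← hDji] at h3
      have h4 : |(clip M₁ B i j + clip M₁ B j i) / 2 - p| ≤ (|D i j| + |D j i|) / 2 := by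
        have : (clip M₁ B i j + clip M₁ B j i) / 2 - p =
            (clip M₁ B i j - p) / 2 + (clip M₁ B j i - p) / 2 := by ring
        rw [this]
        refine (abs_add_le _ _).trans ?_
        rw [abs_div, abs_div, abs_two]
        linarith
      have h5 := h1.trans (mul_le_mul_of_nonneg_left h4 hC0.le)
      rw [← sq_abs, ← sq_abs (D i j), ← sq_abs (D j i), add_zero]
      refine (pow_le_pow_left₀ (abs_nonneg _) h5 2).trans ?_
      have h6 : C ^ 2 / 2 * (|D i j| ^ 2 + |D j i| ^ 2) - (C * ((|D i j| + |D j i|) / 2)) ^ 2 =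
        (C / 2 * (|D i j| - |D j i|)) ^ 2 := by ring
      have := sq_nonneg (C / 2 * (|D i j| - |D j i|))
      linarith
  calc sqNorm (symLogit (clip M₁ B) - logitMatrix α Z)
      ≤ ∑ i : Fin n, ∑ j : Fin n, (C ^ 2 / 2 * (D i j ^ 2 + D j i ^ 2) +
        if i = j then (C + 2 * M₁) ^ 2 else 0) :=
        Finset.sum_le_sum fun i _ => Finset.sum_le_sum fun j _ => hentry i j
    _ = C ^ 2 / 2 * (sqNorm D + sqNorm D.transpose) + (C + 2 * M₁) ^ 2 * n := by
        simp only [sqNorm, Finset.sum_add_distrib, Finset.mul_sum, mul_add, Matrix.transpose_apply]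
        simp
        ring
    _ = _ := by rw [sqNorm_transpose]; ring

lemma M₁_nonneg {n k : ℕ} {M₁ M₂ : ℝ} {α : Fin n → ℝ} {Z : Matrix (Fin n) (Fin k) ℝ}
    (h : InParameterSpace M₁ M₂ α Z) (hn : 0 < n) : 0 ≤ M₁ := by
  have := (abs_nonneg _).trans (h.alpha_le ⟨0, hn⟩)
  linarith

end Logit

/-! ### Consistency of the estimated logits. -/

section LogitEstimate

lemma eventually_le_mul_sq (C : ℝ) {ε : ℝ} (hε : 0 < ε) :
    ∃ N : ℕ, ∀ n : ℕ, N ≤ n → C * (n : ℝ) ≤ ε * (n : ℝ) ^ 2 := by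
  obtain ⟨N, hN⟩ := exists_nat_ge (C / ε)
  refine ⟨N, fun n hn => ?_⟩
  have h1 : C / ε ≤ n := hN.trans (by exact_mod_cast hn)
  rw [div_le_iff₀ hε] at h1
  have h2 : (0 : ℝ) ≤ n := Nat.cast_nonneg n
  nlinarith

/-- If a trace moment of the noise is under control then the singular value threshold gives a
consistent estimate of the matrix of logits. -/
theorem exists_logit_estimate (k : ℕ) (M₁ : ℝ) {ε : ℝ} (hε : 0 < ε) :
    ∃ δ : ℝ, 0 < δ ∧ ∃ m N : ℕ, ∀ n : ℕ, N ≤ n →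
      ∀ (M₂ : ℝ) (α : Fin n → ℝ) (Z : Matrix (Fin n) (Fin k) ℝ), InParameterSpace M₁ M₂ α Z →
      ∀ τ : ℝ, 1.1 * Real.sqrt n ≤ τ → τ ≤ δ * n →
      ∀ A B : Matrix (Fin n) (Fin n) ℝ,
        (A - meanMatrix (logitMatrix α Z)).transpose = A - meanMatrix (logitMatrix α Z) →
        ((A - meanMatrix (logitMatrix α Z)) ^ (2 * (m + 1))).trace ≤ 2 * (n : ℝ) ^ (m + 1 + 1) →
        IsSingularValueThreshold A τ B →
        sqNorm (symLogit (clip M₁ B) - logitMatrix α Z) ≤ ε * (n : ℝ) ^ 2 := by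
  set C := (2 * Real.exp M₁ + 2) ^ 2 with hC
  set C' := (2 * Real.exp M₁ + 2 + 2 * M₁) ^ 2 with hC'
  have hC0 : 0 < C := by positivity
  -- Of the fifths of `ε`, three pay, after multiplication by `C`, for the noise remainder `33 * K`,
  -- the approximation error with factor `400`, and the threshold term with factor `12`. One more
  -- pays for all terms linear in `n`. This fixes `m` (with `66 = 33 * 2`), `r`, `δ` and `N`.
  set η := ε / (5 * C) with hη
  have hη0 : 0 < η := by positivity
  obtain ⟨m, hm⟩ := exists_pow_lt_of_lt_one (show 0 < η / 66 by positivity)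
    (show (1.04 : ℝ)⁻¹ < 1 by norm_num)
  obtain ⟨r, hr⟩ := exists_lowRank_approx k M₁ (show 0 < η / 400 by positivity)
  set δ := min 1 (η / (12 * (r + 1))) with hδ
  have hδ0 : 0 < δ := by positivity
  have hδr : 12 * (δ ^ 2 * r) ≤ η := by
    have h1 : δ ^ 2 ≤ η / (12 * (r + 1)) := by
      calc δ ^ 2 = δ * δ := sq δ
        _ ≤ 1 * (η / (12 * (r + 1))) :=
          mul_le_mul (min_le_left _ _) (min_le_right _ _) hδ0.le zero_le_one
        _ = _ := one_mul _
    rw [le_div_iff₀ (by positivity)] at h1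
    nlinarith [sq_nonneg δ]
  obtain ⟨N, hN⟩ := eventually_le_mul_sq (C * (36 * r + 400) + C') (show 0 < ε / 5 by positivity)
  refine ⟨δ, hδ0, m, N + 1, fun n hn M₂ α Z hpar τ hτ1 hτ2 A B hsymm htr hB => ?_⟩
  have hn0 : 0 < n := by omega
  have hnR : (0 : ℝ) < n := by exact_mod_cast hn0
  have hM := M₁_nonneg hpar hn0
  obtain ⟨L, Q, hQ, hQr, hLQ, hE⟩ := hr n α Z hpar.alpha_le hpar.latent_le
  set P := meanMatrix (logitMatrix α Z) with hP
  set K := 2 * (n : ℝ) ^ 2 * (1.04 : ℝ)⁻¹ ^ m with hK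
  have hτ0 : 0 ≤ τ := le_trans (by positivity) hτ1
  have hτn : 1.21 * (n : ℝ) ≤ τ ^ 2 := by
    calc 1.21 * (n : ℝ) = (1.1 * Real.sqrt n) ^ 2 := by
          rw [mul_pow, Real.sq_sqrt hnR.le]; norm_num
      _ ≤ τ ^ 2 := pow_le_pow_left₀ (by positivity) hτ1 2
  have hτδ : τ ^ 2 ≤ δ ^ 2 * (n : ℝ) ^ 2 := by
    rw [← mul_pow]; exact pow_le_pow_left₀ hτ0 hτ2 2
  have hmain := sqNorm_threshold_sub_le (A := A) (B := B) (L := L) (E := P - L) (W := A - P)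
    (Q := Q) (τ := τ) (K := K) (by abel) hsymm hQ hLQ hB hτ0 hτn
    (fun Q' hQ' => by
      -- With cutoff `1.04 * n` the moment bound leaves `2 n ^ 2 / 1.04 ^ m`, a small multiple of `n
      -- ^ 2` for large fixed `m`.
      refine (hQ'.sqNorm_mul_symm_le hsymm (a := 1.04 * n) (by positivity) m).trans ?_
      have h1 : ((A - P) ^ (2 * (m + 1))).trace / (1.04 * (n : ℝ)) ^ m ≤ K := by
        rw [div_le_iff₀ (by positivity), hK]
        refine htr.trans (le_of_eq ?_)
        rw [mul_pow, inv_pow]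
        have : (1.04 : ℝ) ^ m ≠ 0 := by positivity
        field_simp
        ring
      linarith) (by positivity)
  rw [show L + (P - L) = P by abel] at hmain
  have hKη : 33 * K ≤ η * (n : ℝ) ^ 2 := by
    rw [hK]
    have := mul_le_mul_of_nonneg_right hm.le (sq_nonneg (n : ℝ))
    nlinarith
  have hQ0 := hQ.trace_nonneg
  have hτQ : 12 * (τ ^ 2 * Q.trace) ≤ η * (n : ℝ) ^ 2 := by
    have h1 : τ ^ 2 * Q.trace ≤ (δ ^ 2 * (n : ℝ) ^ 2) * r :=
      mul_le_mul hτδ hQr hQ0 (by positivity)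
    have h2 := mul_le_mul_of_nonneg_right hδr (sq_nonneg (n : ℝ))
    nlinarith
  have hnQ : 36 * ((n : ℝ) * Q.trace) ≤ 36 * r * n := by
    have := mul_le_mul_of_nonneg_left hQr hnR.le
    linarith
  have hB2 : sqNorm (B - P) ≤ 3 * η * (n : ℝ) ^ 2 + (36 * r + 400) * n := by
    linarith
  refine (sqNorm_symLogit_sub_le hpar hM B).trans ?_
  rw [← hC, ← hC', ← hP]
  have h1 := mul_le_mul_of_nonneg_left hB2 hC0.le
  have h2 := hN n (by omega)
  have h3 : C * (3 * η * (n : ℝ) ^ 2) = 3 * ε / 5 * (n : ℝ) ^ 2 := by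
    rw [hη]; field_simp
  nlinarith [sq_nonneg (n : ℝ)]

end LogitEstimate

/-! ### The least squares step and the projection to the semidefinite cone. -/

section LeastSquares

variable {n : ℕ}

/-- The Frobenius inner product. -/
def frobInner (M N : Matrix (Fin n) (Fin n) ℝ) : ℝ := ∑ i, ∑ j, M i j * N i j

lemma sqNorm_sub_smul (M N : Matrix (Fin n) (Fin n) ℝ) (t : ℝ) :
    sqNorm (M - t • N) = sqNorm M - 2 * t * frobInner M N + t ^ 2 * sqNorm N := by
  simp only [sqNorm, frobInner, Finset.mul_sum, ← Finset.sum_sub_distrib, ← Finset.sum_add_distrib]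
  refine Finset.sum_congr rfl fun i _ => Finset.sum_congr rfl fun j _ => ?_
  simp only [Matrix.sub_apply, Matrix.smul_apply, smul_eq_mul]
  ring

lemma frobInner_add_left (M M' N : Matrix (Fin n) (Fin n) ℝ) :
    frobInner (M + M') N = frobInner M N + frobInner M' N := by
  simp only [frobInner, Matrix.add_apply, add_mul, Finset.sum_add_distrib]

lemma frobInner_sub_left (M M' N : Matrix (Fin n) (Fin n) ℝ) :
    frobInner (M - M') N = frobInner M N - frobInner M' N := by
  simp only [frobInner, Matrix.sub_apply, sub_mul, Finset.sum_sub_distrib]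

lemma frobInner_self (M : Matrix (Fin n) (Fin n) ℝ) : frobInner M M = sqNorm M := by
  simp only [frobInner, sqNorm, sq]

lemma additivePart_apply (β : Fin n → ℝ) (i j : Fin n) : additivePart β i j = β i + β j := by
  simp [additivePart, rowConst]

lemma additivePart_add_smul (α β : Fin n → ℝ) (t : ℝ) :
    additivePart (α + t • β) = additivePart α + t • additivePart β := by
  ext i j
  simp only [additivePart_apply, Matrix.add_apply, Matrix.smul_apply, Pi.add_apply, Pi.smul_apply,
    smul_eq_mul]
  ring

lemma additivePart_sub (α β : Fin n → ℝ) :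
    additivePart (α - β) = additivePart α - additivePart β := by
  ext i j
  simp only [additivePart_apply, Matrix.sub_apply, Pi.sub_apply]
  ring

lemma frobInner_additivePart (X : Matrix (Fin n) (Fin n) ℝ) (β : Fin n → ℝ) :
    frobInner X (additivePart β) = ∑ i, β i * (∑ j, X i j + ∑ j, X j i) := by
  simp only [frobInner, additivePart_apply, mul_add, Finset.sum_add_distrib, Finset.mul_sum]
  congr 1
  · exact Finset.sum_congr rfl fun i _ => Finset.sum_congr rfl fun j _ => mul_comm _ _
  · rw [Finset.sum_comm]
    exact Finset.sum_congr rfl fun i _ => Finset.sum_congr rfl fun j _ => mul_comm _ _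

lemma sqNorm_rowConst (β : Fin n → ℝ) : sqNorm (rowConst β) = n * ∑ i, β i ^ 2 := by
  simp [sqNorm, rowConst, Finset.mul_sum]

/-- The right side expands to `2 n ∑ β i ^ 2 + 2 (∑ β i) ^ 2`, and the last square is dropped. -/
lemma two_mul_sqNorm_rowConst_le (β : Fin n → ℝ) :
    2 * sqNorm (rowConst β) ≤ sqNorm (additivePart β) := by
  have h : sqNorm (additivePart β) = 2 * (n * ∑ i, β i ^ 2) + 2 * (∑ i, β i) ^ 2 := by
    have h1 : (∑ i, β i) ^ 2 = ∑ i, ∑ j, β i * β j := by rw [sq, Finset.sum_mul_sum]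
    have h2 : (n : ℝ) * ∑ i, β i ^ 2 = ∑ i : Fin n, ∑ _j : Fin n, β i ^ 2 := by
      simp [Finset.mul_sum]
    have h3 : (n : ℝ) * ∑ i, β i ^ 2 = ∑ _i : Fin n, ∑ j : Fin n, β j ^ 2 := by
      simp
    rw [two_mul ((n : ℝ) * ∑ i, β i ^ 2)]
    nth_rewrite 1 [h2]
    rw [h3, h1, Finset.mul_sum, sqNorm, ← Finset.sum_add_distrib, ← Finset.sum_add_distrib]
    refine Finset.sum_congr rfl fun i _ => ?_
    rw [Finset.mul_sum, ← Finset.sum_add_distrib, ← Finset.sum_add_distrib]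
    refine Finset.sum_congr rfl fun j _ => ?_
    rw [additivePart_apply]
    ring
  rw [h, sqNorm_rowConst]
  nlinarith [sq_nonneg (∑ i, β i)]

lemma IsLeastSquares.frobInner_eq_zero {T : Matrix (Fin n) (Fin n) ℝ} {α : Fin n → ℝ}
    (h : IsLeastSquares T α) (β : Fin n → ℝ) :
    frobInner (T - additivePart α) (additivePart β) = 0 := by
  set X := T - additivePart α with hX
  set N := additivePart β with hN
  set I := frobInner X N with hI
  have hS := sqNorm_nonneg N
  have h1 : ∀ t : ℝ, 0 ≤ - 2 * t * I + t ^ 2 * sqNorm N := by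
    intro t
    have h2 := h (α + t • β)
    rw [frobNorm_sq, frobNorm_sq, additivePart_add_smul, ← sub_sub, sqNorm_sub_smul, ← hX, ← hN,
      ← hI] at h2
    linarith
  -- Nearly the optimal step along `β`; the `+ 1` avoids a division by zero.
  have h2 := h1 (I / (sqNorm N + 1))
  have h3 : -2 * (I / (sqNorm N + 1)) * I + (I / (sqNorm N + 1)) ^ 2 * sqNorm N =
      - (I ^ 2 * ((sqNorm N + 2) / (sqNorm N + 1) ^ 2)) := by
    field_simp
    ring
  rw [h3] at h2
  have h4 : 0 < (sqNorm N + 2) / (sqNorm N + 1) ^ 2 := by positivity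
  have h5 : I ^ 2 ≤ 0 := by
    by_contra hc
    have := mul_pos (not_le.1 hc) h4
    linarith
  exact pow_eq_zero_iff (two_ne_zero) |>.1 (le_antisymm h5 (sq_nonneg _))

lemma isLeastSquares_of_frobInner_eq_zero {T : Matrix (Fin n) (Fin n) ℝ} {α : Fin n → ℝ}
    (h : ∀ β, frobInner (T - additivePart α) (additivePart β) = 0) : IsLeastSquares T α := by
  intro α'
  have h1 : T - additivePart α' = T - additivePart α - (1 : ℝ) • additivePart (α' - α) := by
    rw [additivePart_sub, one_smul]; abel
  rw [frobNorm_sq, frobNorm_sq, h1, sqNorm_sub_smul, h]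
  have := sqNorm_nonneg (additivePart (α' - α))
  linarith

lemma exists_isLeastSquares (T : Matrix (Fin n) (Fin n) ℝ) : ∃ α, IsLeastSquares T α := by
  rcases Nat.eq_zero_or_pos n with rfl | hn
  · exact ⟨0, fun α' => by rw [Subsingleton.elim α' 0]⟩
  have hn' : (n : ℝ) ≠ 0 := by exact_mod_cast hn.ne'
  set ρ : Fin n → ℝ := fun i => ∑ j, T i j + ∑ j, T j i with hρ
  set S := ∑ i, ρ i with hS
  -- The normal equations are `2 (n α i + ∑ α) = ρ i`; summing over `i` gives `∑ α = S / (4 n)`, and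
  -- then each `α i`.
  refine ⟨fun i => ρ i / (2 * n) - S / (4 * n ^ 2), isLeastSquares_of_frobInner_eq_zero fun β => ?_⟩
  rw [frobInner_additivePart]
  refine Finset.sum_eq_zero fun i _ => ?_
  have hsum : ∑ i, (ρ i / (2 * n) - S / (4 * n ^ 2)) = S / (4 * n) := by
    rw [Finset.sum_sub_distrib, ← Finset.sum_div, ← hS]
    simp
    field_simp
    ring
  simp only [Matrix.sub_apply, additivePart_apply, Finset.sum_sub_distrib, Finset.sum_add_distrib]
  rw [mul_eq_zero]
  right
  have h1 : ∑ j, T i j + ∑ j, T j i = ρ i := rfl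
  rw [Finset.sum_sub_distrib] at hsum
  simp only [Finset.sum_const, Finset.card_univ, Fintype.card_fin, nsmul_eq_mul] at hsum ⊢
  have h2 : (n : ℝ) * (ρ i / (2 * n)) = ρ i / 2 := by field_simp
  have h3 : (n : ℝ) * (S / (4 * n ^ 2)) = S / (4 * n) := by field_simp
  linear_combination h1 - 2 * hsum - 2 * h2 + 2 * h3

variable {k : ℕ}

lemma sum_col_eq_zero (hn : 0 < n) {Z : Matrix (Fin n) (Fin k) ℝ} (hZ : centering n * Z = Z)
    (l : Fin k) : ∑ i, Z i l = 0 := by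
  have h := congrFun (congrFun hZ ⟨0, hn⟩) l
  rw [centering, Matrix.sub_mul, Matrix.one_mul, Matrix.sub_apply, Matrix.smul_mul,
    Matrix.smul_apply, Matrix.mul_apply] at h
  simp only [Matrix.of_apply, one_mul, smul_eq_mul] at h
  have hn' : (n : ℝ) ≠ 0 := by exact_mod_cast hn.ne'
  have h2 : 1 / (n : ℝ) * ∑ i, Z i l = 0 := by linarith
  exact (mul_eq_zero.1 h2).resolve_left (one_div_ne_zero hn')

lemma frobInner_gram_additivePart (hn : 0 < n) {Z : Matrix (Fin n) (Fin k) ℝ}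
    (hZ : centering n * Z = Z) (β : Fin n → ℝ) :
    frobInner (Z * Z.transpose) (additivePart β) = 0 := by
  rw [frobInner_additivePart]
  refine Finset.sum_eq_zero fun i _ => ?_
  have h1 : ∑ j, (Z * Z.transpose) i j = 0 := by
    simp only [Matrix.mul_apply, Matrix.transpose_apply]
    rw [Finset.sum_comm]
    simp only [← Finset.mul_sum, sum_col_eq_zero hn hZ, mul_zero, Finset.sum_const_zero]
  have h2 : ∑ j, (Z * Z.transpose) j i = 0 := by
    simp only [Matrix.mul_apply, Matrix.transpose_apply]
    rw [Finset.sum_comm]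
    simp only [← Finset.sum_mul, sum_col_eq_zero hn hZ, zero_mul, Finset.sum_const_zero]
  rw [h1, h2]; ring

/-- The least squares step does not increase the error. -/
lemma IsLeastSquares.two_mul_sqNorm_rowConst_sub_le (hn : 0 < n) {T : Matrix (Fin n) (Fin n) ℝ}
    {α₀ α : Fin n → ℝ} {Z : Matrix (Fin n) (Fin k) ℝ} (hZ : centering n * Z = Z)
    (h : IsLeastSquares T α₀) :
    2 * sqNorm (rowConst (α₀ - α)) ≤ sqNorm (T - logitMatrix α Z) := by
  refine (two_mul_sqNorm_rowConst_le _).trans ?_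
  set N := additivePart (α₀ - α) with hN
  have h1 := h.frobInner_eq_zero (α₀ - α)
  have h2 := frobInner_gram_additivePart hn hZ (α₀ - α)
  -- The residual is orthogonal to `N`, and so is the Gram matrix because `Z` is centered. Hence `N`
  -- is the projection of `T - Θ` to the line it spans.
  have h3 : T - additivePart α₀ = (T - logitMatrix α Z) + Z * Z.transpose - N := by
    rw [hN, additivePart_sub, logitMatrix]; abel
  rw [h3, ← hN, frobInner_sub_left, frobInner_add_left, frobInner_self] at h1
  rw [← hN] at h2
  have h4 := sqNorm_nonneg (T - logitMatrix α Z - (1 : ℝ) • N)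
  rw [sqNorm_sub_smul] at h4
  linarith

lemma isProj_centering (hn : 0 < n) : IsProj (centering n) := by
  have hn' : (n : ℝ) ≠ 0 := by exact_mod_cast hn.ne'
  have h : IsProj ((1 / (n : ℝ)) • Matrix.of fun _ _ : Fin n => (1 : ℝ)) := by
    refine ⟨?_, ?_⟩
    · ext i j
      simp [Matrix.mul_apply]
      field_simp
    · ext i j
      simp
  exact h.one_sub

lemma additivePart_mul_centering (hn : 0 < n) (β : Fin n → ℝ) :
    centering n * additivePart β * centering n = 0 := by
  have hn' : (n : ℝ) ≠ 0 := by exact_mod_cast hn.ne'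
  have h1 : rowConst β * centering n = 0 := by
    ext i j
    simp [rowConst, centering, Matrix.mul_apply, Matrix.sub_apply, Matrix.one_apply, mul_sub,
      Finset.sum_sub_distrib]
    field_simp
    simp
  have h2 : centering n * (rowConst β).transpose = 0 := by
    rw [← (isProj_centering hn).symm, ← Matrix.transpose_mul, h1, Matrix.transpose_zero]
  rw [additivePart, Matrix.mul_add, Matrix.add_mul, h2, Matrix.zero_mul, add_zero,
    Matrix.mul_assoc, h1, Matrix.mul_zero]

/-- The projection to the cone of positive semidefinite matrices increases the error at most by
the factor `4`. -/
lemma sqNorm_psdProjection_sub_le (hn : 0 < n) {T G : Matrix (Fin n) (Fin n) ℝ}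
    {α₀ : Fin n → ℝ} (α : Fin n → ℝ) {Z : Matrix (Fin n) (Fin k) ℝ} (hZ : centering n * Z = Z)
    (hG : IsPSDProjection (centering n * (T - additivePart α₀) * centering n) G) :
    sqNorm (G - Z * Z.transpose) ≤ 4 * sqNorm (T - logitMatrix α Z) := by
  have hJ := isProj_centering hn
  set R := centering n * (T - additivePart α₀) * centering n with hR
  have hRG : R - Z * Z.transpose = centering n * (T - logitMatrix α Z) * centering n := by
    have h1 : T - additivePart α₀ =
        (T - logitMatrix α Z) + additivePart (α - α₀) + Z * Z.transpose := by
      rw [additivePart_sub, logitMatrix]; abel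
    have h2 : centering n * (Z * Z.transpose) * centering n = Z * Z.transpose := by
      rw [← Matrix.mul_assoc, hZ, Matrix.mul_assoc]
      conv_lhs => rw [← hJ.symm, ← Matrix.transpose_mul, hZ]
    rw [hR, h1, Matrix.mul_add, Matrix.add_mul, h2, Matrix.mul_add, Matrix.add_mul,
      additivePart_mul_centering hn]
    abel
  have h1 : sqNorm (R - Z * Z.transpose) ≤ sqNorm (T - logitMatrix α Z) := by
    rw [hRG]
    exact (hJ.sqNorm_mul_le _).trans (hJ.sqNorm_proj_mul_le _)
  have hpsd : (Z * Z.transpose).PosSemidef := by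
    have := Matrix.posSemidef_self_mul_conjTranspose Z
    rwa [Matrix.conjTranspose_eq_transpose_of_trivial] at this
  -- The true Gram matrix is itself a competitor in the cone, so `G` is no farther from `R` than it
  -- is.
  have h2 := (frobNorm_le_iff _ _).1 (hG.2 _ hpsd)
  rw [sqNorm_sub_comm (Z * Z.transpose)] at h2
  have h3 := sqNorm_add_le_two (G - R) (R - Z * Z.transpose)
  rw [sub_add_sub_cancel] at h3
  linarith

end LeastSquares

/-! ### Truncation to the leading components. -/

section TopFactor

variable {n k : ℕ}

lemma sum_castLE (hkn : k ≤ n) (f : Fin n → ℝ) :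
    ∑ l : Fin k, f (Fin.castLE hkn l) = ∑ i : Fin n, if (i : ℕ) < k then f i else 0 := by
  rw [← Finset.sum_filter]
  refine Finset.sum_bij (fun l _ => Fin.castLE hkn l) ?_ ?_ ?_ ?_
  · intro l _; simp
  · intro a _ b _ h; exact Fin.castLE_injective hkn h
  · intro i hi
    exact ⟨⟨i, (Finset.mem_filter.1 hi).2⟩, Finset.mem_univ _, rfl⟩
  · intro l _; rfl

/-- The truncation to the leading `k` components is at least as close as any matrix whose rows
lie in a space of dimension `k`. -/
lemma IsTopFactor.sqNorm_gram_sub_le {G G' Q : Matrix (Fin n) (Fin n) ℝ}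
    {Z₀ : Matrix (Fin n) (Fin k) ℝ} (h : IsTopFactor G Z₀) (hk : 1 ≤ k) (hkn : k ≤ n)
    (hQ : IsProj Q) (hQk : Q.trace = k) (hGQ : G' * Q = G') :
    sqNorm (Z₀ * Z₀.transpose - G) ≤ sqNorm (G - G') := by
  obtain ⟨U, hU, d, hd, hanti, hG, hZ₀⟩ := h
  have hU' := transpose_mem_orthogonalGroup hU
  have hgram : Z₀ * Z₀.transpose =
      U * Matrix.diagonal (fun i : Fin n => if (i : ℕ) < k then d i else 0) * U.transpose := by
    ext i j
    rw [Matrix.mul_apply, Matrix.mul_apply]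
    simp only [Matrix.mul_diagonal, Matrix.transpose_apply]
    rw [Finset.sum_congr rfl (g := fun x : Fin n =>
      if (x : ℕ) < k then U i x * d x * U j x else 0) (fun x _ => by split_ifs <;> simp),
      ← sum_castLE hkn (fun x => U i x * d x * U j x)]
    refine Finset.sum_congr rfl fun l _ => ?_
    have hl : (l : ℕ) < n := l.2.trans_le hkn
    rw [hZ₀, hZ₀, dif_pos hl, dif_pos hl]
    have : Fin.castLE hkn l = ⟨l, hl⟩ := rfl
    rw [this]
    have := Real.mul_self_sqrt (hd ⟨l, hl⟩)
    linear_combination (U i ⟨l, hl⟩ * U j ⟨l, hl⟩) * this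
  have hleft : sqNorm (Z₀ * Z₀.transpose - G) =
      ∑ i : Fin n, if (i : ℕ) < k then 0 else d i ^ 2 := by
    rw [hgram, hG, ← Matrix.sub_mul, ← Matrix.mul_sub, Matrix.diagonal_sub,
      sqNorm_mul_orthogonal hU', sqNorm_orthogonal_mul hU,
      ← Matrix.mul_one (Matrix.diagonal _), sqNorm_diagonal_mul]
    refine Finset.sum_congr rfl fun i _ => ?_
    have h1 : ∑ j, (1 : Matrix (Fin n) (Fin n) ℝ) i j ^ 2 = 1 :=
      orthogonal_row (one_mem _) i
    rw [h1]
    split_ifs <;> simp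
  -- The `k`-th squared eigenvalue serves as pivot. The weights `c` lie in `[0, 1]` and sum to `k`,
  -- so adding `D` times (indicator of `i < k` minus `c i`) changes no sum and makes the comparison
  -- termwise.
  set D := d ⟨k - 1, by omega⟩ ^ 2 with hD
  set c : Fin n → ℝ := fun i => ∑ j, (U.transpose * Q) i j ^ 2 with hc
  have hc0 : ∀ i, 0 ≤ c i := fun i => Finset.sum_nonneg fun _ _ => sq_nonneg _
  have hcsum : ∑ i, c i = k := (hQ.sum_row_orthogonal hU').trans hQk
  have hcomp : ∀ i, ∑ j, (U.transpose * (1 - Q) : Matrix (Fin n) (Fin n) ℝ) i j ^ 2 = 1 - c i := by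
    intro i
    have := (hQ.row_add U.transpose i).trans (orthogonal_row hU' i)
    simp only [hc]
    linarith
  have hc1 : ∀ i, c i ≤ 1 := fun i => (hQ.row_le _ i).trans_eq (orthogonal_row hU' i)
  have hright : ∑ i, d i ^ 2 * (1 - c i) ≤ sqNorm (G - G') := by
    refine le_trans (le_of_eq ?_) (hQ.one_sub.sqNorm_mul_le (G - G'))
    have h1 : (G - G') * (1 - Q) = G * (1 - Q) := by
      rw [Matrix.sub_mul, Matrix.mul_sub G', hGQ, Matrix.mul_one, sub_self, sub_zero]
    rw [h1, hG, Matrix.mul_assoc, Matrix.mul_assoc, sqNorm_orthogonal_mul hU, sqNorm_diagonal_mul]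
    simp only [hcomp]
  refine le_trans ?_ hright
  have hcount : ∑ i : Fin n, (if (i : ℕ) < k then (1 : ℝ) else 0) = k := by
    rw [← sum_castLE hkn (fun _ => (1 : ℝ))]; simp
  calc sqNorm (Z₀ * Z₀.transpose - G)
      = ∑ i : Fin n, ((if (i : ℕ) < k then 0 else d i ^ 2) +
          D * ((if (i : ℕ) < k then 1 else 0) - c i)) := by
        rw [hleft, Finset.sum_add_distrib, ← Finset.mul_sum, Finset.sum_sub_distrib, hcount, hcsum]
        ring
    _ ≤ _ := by
        refine Finset.sum_le_sum fun i _ => ?_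
        split_ifs with hi
        · have h1 : D ≤ d i ^ 2 := pow_le_pow_left₀ (hd _)
            (hanti (show i ≤ ⟨k - 1, by omega⟩ from Fin.mk_le_mk.2 (by omega))) 2
          have := mul_le_mul_of_nonneg_right h1 (sub_nonneg.2 (hc1 i))
          linarith
        · have h1 : d i ^ 2 ≤ D := pow_le_pow_left₀ (hd _)
            (hanti (show ⟨k - 1, by omega⟩ ≤ i from Fin.mk_le_mk.2 (by omega))) 2
          have := mul_le_mul_of_nonneg_right h1 (hc0 i)
          linarith

end TopFactor

/-! ### From Gram matrices to factors. -/

section Procrustes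

variable {n k : ℕ}

lemma sqNorm_mul_le_mul {m p : ℕ} (M : Matrix (Fin m) (Fin n) ℝ) (N : Matrix (Fin n) (Fin p) ℝ) :
    sqNorm (M * N) ≤ sqNorm M * sqNorm N := by
  have h : sqNorm M * sqNorm N = ∑ i, ∑ j, (∑ l, M i l ^ 2) * ∑ l, N l j ^ 2 := by
    rw [← sqNorm_transpose N, sqNorm, sqNorm, Finset.sum_mul_sum]
    rfl
  rw [h]
  refine Finset.sum_le_sum fun i _ => Finset.sum_le_sum fun j _ => ?_
  rw [Matrix.mul_apply]
  exact Finset.sum_mul_sq_le_sq_mul_sq _ _ _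

lemma sqNorm_transpose_mul_self (Y : Matrix (Fin n) (Fin k) ℝ) :
    sqNorm (Y.transpose * Y) = sqNorm (Y * Y.transpose) := by
  rw [sqNorm_eq_trace, sqNorm_eq_trace, Matrix.transpose_mul, Matrix.transpose_mul,
    Matrix.transpose_transpose, Matrix.mul_assoc, Matrix.trace_mul_comm]
  simp only [Matrix.mul_assoc]

/-- A square matrix close to being orthogonal is close to an orthogonal matrix. -/
lemma exists_orthogonal_near {M : Matrix (Fin k) (Fin k) ℝ}
    (hM : sqNorm (M * M.transpose - 1) < 1) :
    ∃ R ∈ Matrix.orthogonalGroup (Fin k) ℝ, sqNorm (M - R) ≤ sqNorm (M * M.transpose - 1) := by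
  obtain ⟨V, hV, d, hVd⟩ := exists_diagonalization (W := M * M.transpose)
    (by rw [Matrix.transpose_mul, Matrix.transpose_transpose])
  have hVV : V.transpose * V = 1 := (Matrix.mem_orthogonalGroup_iff' _ ℝ).1 hV
  have hVV' : V * V.transpose = 1 := (Matrix.mem_orthogonalGroup_iff _ ℝ).1 hV
  have hmul : ∀ a b : Fin k → ℝ, (V * Matrix.diagonal a * V.transpose) *
      (V * Matrix.diagonal b * V.transpose) =
      V * Matrix.diagonal (fun i => a i * b i) * V.transpose := by
    intro a b
    calc _ = V * Matrix.diagonal a * (V.transpose * V) * Matrix.diagonal b * V.transpose := by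
          simp only [Matrix.mul_assoc]
      _ = _ := by rw [hVV, Matrix.mul_one, Matrix.mul_assoc V, Matrix.diagonal_mul_diagonal]
  have hone : (1 : Matrix (Fin k) (Fin k) ℝ) =
      V * Matrix.diagonal (fun _ => (1 : ℝ)) * V.transpose := by
    rw [Matrix.diagonal_one, Matrix.mul_one, hVV']
  have htr : ∀ a : Fin k → ℝ, (V * Matrix.diagonal a * V.transpose).transpose =
      V * Matrix.diagonal a * V.transpose := by
    intro a
    simp [Matrix.transpose_mul, Matrix.mul_assoc]
  have hsub : ∀ a b : Fin k → ℝ, V * Matrix.diagonal a * V.transpose -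
      V * Matrix.diagonal b * V.transpose =
      V * Matrix.diagonal (fun i => a i - b i) * V.transpose := by
    intro a b
    rw [← Matrix.sub_mul, ← Matrix.mul_sub, Matrix.diagonal_sub]
  have hν : sqNorm (M * M.transpose - 1) = ∑ i, (d i - 1) ^ 2 := by
    rw [hVd, hone, hsub, sqNorm_eq_trace, htr, hmul, trace_diagonalization hV]
    simp only [sq]
  have hd : ∀ i, 0 < d i := by
    intro i
    have h1 : (d i - 1) ^ 2 < 1 := lt_of_le_of_lt
      (Finset.single_le_sum (f := fun i => (d i - 1) ^ 2) (fun _ _ => sq_nonneg _)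
        (Finset.mem_univ i)) (hν ▸ hM)
    nlinarith
  -- `S * M` is the orthogonal polar factor of `M`. The claim becomes `(√d - 1) ^ 2 ≤ (d - 1) ^ 2`
  -- for each eigenvalue `d > 0` of `M * Mᵀ`.
  set S := V * Matrix.diagonal (fun i => (Real.sqrt (d i))⁻¹) * V.transpose with hS
  refine ⟨S * M, ?_, ?_⟩
  · rw [Matrix.mem_orthogonalGroup_iff]
    change S * M * (S * M).transpose = 1
    rw [Matrix.transpose_mul, hS, htr, ← Matrix.mul_assoc, Matrix.mul_assoc _ M, hVd, hmul, hmul,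
      hone]
    congr 3
    funext i
    have h1 := Real.mul_self_sqrt (hd i).le
    have h2 := Real.sqrt_pos.2 (hd i)
    field_simp
    rw [sq, h1]
  · have h1 : M - S * M = (1 - S) * M := by rw [Matrix.sub_mul, Matrix.one_mul]
    rw [h1, sqNorm_eq_trace, Matrix.transpose_mul, ← Matrix.mul_assoc, Matrix.mul_assoc _ M, hVd,
      hS, hone, hsub, htr, hmul, hmul, trace_diagonalization hV, hsub, sqNorm_eq_trace, htr, hmul,
      trace_diagonalization hV]
    refine Finset.sum_le_sum fun i _ => ?_
    have h1 := Real.sq_sqrt (hd i).le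
    have h2 := Real.sqrt_pos.2 (hd i)
    set y := Real.sqrt (d i) with hy
    rw [← h1]
    have h3 : (1 - y⁻¹) * y ^ 2 * (1 - y⁻¹) = (y - 1) ^ 2 := by field_simp
    rw [h3]
    have h4 : (y ^ 2 - 1) * (y ^ 2 - 1) = (y - 1) ^ 2 * (y + 1) ^ 2 := by ring
    rw [h4]
    refine le_mul_of_one_le_right (sq_nonneg _) ?_
    nlinarith

/-- Properties of the left inverse of a matrix of full column rank. -/
lemma exists_leftInverse {Z : Matrix (Fin n) (Fin k) ℝ} {s : ℝ} (hs : 0 < s)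
    (hZ : ∀ (m : ℕ) (X : Matrix (Fin k) (Fin m) ℝ), s * sqNorm X ≤ sqNorm (Z * X)) :
    ∃ B : Matrix (Fin n) (Fin k) ℝ, B.transpose * Z = 1 ∧ IsProj (Z * B.transpose) ∧
      (Z * B.transpose).trace = k ∧
      ∀ (m : ℕ) (Y : Matrix (Fin n) (Fin m) ℝ), s * sqNorm (B.transpose * Y) ≤ sqNorm Y := by
  -- The left inverse is the transpose of `Z * H⁻¹`; then `Z * Bᵀ` is the orthogonal projection to
  -- the column space of `Z`.
  set H := Z.transpose * Z with hH
  have hHsymm : H.transpose = H := by rw [hH, Matrix.transpose_mul, Matrix.transpose_transpose]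
  have hunit : IsUnit H.det := by
    rw [← Matrix.isUnit_iff_isUnit_det, ← Matrix.mulVec_injective_iff_isUnit,
      ← Matrix.coe_mulVecLin, ← LinearMap.ker_eq_bot, LinearMap.ker_eq_bot']
    intro x hx
    rw [Matrix.mulVecLin_apply] at hx
    set X : Matrix (Fin k) (Fin 1) ℝ := Matrix.of fun i _ => x i with hX
    have hHX : H * X = 0 := by
      ext i j
      have := congrFun hx i
      simpa [Matrix.mul_apply, Matrix.mulVec, dotProduct, hX] using this
    have h1 := hZ 1 X
    have h2 : sqNorm (Z * X) = 0 := by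
      rw [sqNorm_eq_trace', Matrix.transpose_mul, Matrix.mul_assoc, ← Matrix.mul_assoc Z.transpose,
        ← hH, hHX, Matrix.mul_zero, Matrix.trace_zero]
    have h3 : sqNorm X ≤ 0 := by
      rw [h2] at h1
      by_contra hc
      have := mul_pos hs (not_le.1 hc)
      linarith
    funext i
    have h4 : X i 0 ^ 2 ≤ sqNorm X := by
      simp only [sqNorm, Finset.univ_unique, Finset.sum_singleton]
      exact Finset.single_le_sum (f := fun i => X i default ^ 2) (fun _ _ => sq_nonneg _)
        (Finset.mem_univ i)
    have h5 : X i 0 ^ 2 = 0 := le_antisymm (h4.trans h3) (sq_nonneg _)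
    simpa [hX] using h5
  have hinv : H⁻¹ * H = 1 := Matrix.nonsing_inv_mul H hunit
  have hBt : (Z * H⁻¹).transpose = H⁻¹ * Z.transpose := by
    rw [Matrix.transpose_mul, Matrix.transpose_nonsing_inv, hHsymm]
  have hBZ : (Z * H⁻¹).transpose * Z = 1 := by
    rw [hBt, Matrix.mul_assoc, ← hH, hinv]
  have hproj : IsProj (Z * (Z * H⁻¹).transpose) := by
    refine ⟨?_, ?_⟩
    · rw [Matrix.mul_assoc, ← Matrix.mul_assoc _ Z, hBZ, Matrix.one_mul]
    · rw [Matrix.transpose_mul, Matrix.transpose_transpose, hBt, Matrix.mul_assoc]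
  refine ⟨Z * H⁻¹, hBZ, hproj, ?_, ?_⟩
  · rw [Matrix.trace_mul_comm, hBZ, Matrix.trace_one, Fintype.card_fin]
  · intro m Y
    refine (hZ m _).trans ?_
    rw [← Matrix.mul_assoc]
    exact hproj.sqNorm_proj_mul_le Y

lemma procrustesDist_sq_le {Z₀ Z : Matrix (Fin n) (Fin k) ℝ} {R : Matrix (Fin k) (Fin k) ℝ}
    (hR : R ∈ Matrix.orthogonalGroup (Fin k) ℝ) :
    procrustesDist Z₀ Z ^ 2 ≤ sqNorm (Z₀ - Z * R) := by
  rw [← frobNorm_sq]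
  have h0 : 0 ≤ procrustesDist Z₀ Z := Real.iInf_nonneg fun _ => frobNorm_nonneg _
  refine pow_le_pow_left₀ h0 ?_ 2
  exact ciInf_le (f := fun R : Matrix.orthogonalGroup (Fin k) ℝ =>
    frobNorm (Z₀ - Z * (R : Matrix (Fin k) (Fin k) ℝ)))
    ⟨0, by rintro _ ⟨R, rfl⟩; exact frobNorm_nonneg _⟩ ⟨R, hR⟩

/-- The Procrustes distance of two factors in terms of the distance of their Gram matrices. -/
theorem procrustesDist_sq_le_of_gram {Z₀ Z B : Matrix (Fin n) (Fin k) ℝ} {s γ : ℝ} (hs : 0 < s)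
    (hBZ : B.transpose * Z = 1) (hQ : IsProj (Z * B.transpose))
    (hB : ∀ (m : ℕ) (Y : Matrix (Fin n) (Fin m) ℝ), s * sqNorm (B.transpose * Y) ≤ sqNorm Y)
    (hγ : sqNorm (Z₀ * Z₀.transpose - Z * Z.transpose) ≤ γ) (hγs : γ < s ^ 2) :
    procrustesDist Z₀ Z ^ 2 ≤ 2 * Real.sqrt (k * γ) + 2 * (sqNorm Z * (γ / s ^ 2)) := by
  set X := Z₀ * Z₀.transpose - Z * Z.transpose with hX
  set Q := Z * B.transpose with hQdef
  have hXsymm : X.transpose = X := by simp [hX, Matrix.transpose_mul]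
  have hZB : Z.transpose * B = 1 := by
    have := congrArg Matrix.transpose hBZ
    rwa [Matrix.transpose_mul, Matrix.transpose_transpose, Matrix.transpose_one] at this
  set M := B.transpose * Z₀ with hM
  have hMM : M * M.transpose - 1 = B.transpose * (X * B) := by
    have h1 : B.transpose * (Z * Z.transpose) * B = 1 := by
      rw [← Matrix.mul_assoc, hBZ, Matrix.one_mul, hZB]
    rw [hM, Matrix.transpose_mul, Matrix.transpose_transpose, hX, Matrix.sub_mul, Matrix.mul_sub,
      ← Matrix.mul_assoc B.transpose (Z * Z.transpose), h1]
    simp only [Matrix.mul_assoc]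
  have hν : sqNorm (M * M.transpose - 1) ≤ γ / s ^ 2 := by
    rw [le_div_iff₀ (by positivity), hMM]
    have h1 := hB k (X * B)
    have h2 := hB n X.transpose
    rw [hXsymm, ← sqNorm_transpose, Matrix.transpose_mul, Matrix.transpose_transpose, hXsymm] at h2
    nlinarith
  obtain ⟨R, hR, hMR⟩ := exists_orthogonal_near
    (hν.trans_lt ((div_lt_one (by positivity)).2 hγs))
  refine (procrustesDist_sq_le hR).trans ?_
  -- `M` holds the coordinates of the projection of `Z₀` to the column space of `Z`. It is nearly
  -- orthogonal because `M * Mᵀ - 1` is a compression of the Gram difference `X`, and `R` is its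
  -- polar factor.
  have hsplit : Z₀ - Z * R = (1 - Q) * Z₀ + Z * (M - R) := by
    rw [Matrix.sub_mul, Matrix.one_mul, Matrix.mul_sub, hM, hQdef, Matrix.mul_assoc]
    abel
  have h1 : sqNorm ((1 - Q) * Z₀) ≤ Real.sqrt (k * γ) := by
    set Y := (1 - Q) * Z₀ with hY
    apply Real.le_sqrt_of_sq_le
    have hYY : Y * Y.transpose = (1 - Q) * X * (1 - Q) := by
      have hQZ : (1 - Q) * (Z * Z.transpose) = 0 := by
        rw [Matrix.sub_mul, Matrix.one_mul, hQdef, Matrix.mul_assoc, ← Matrix.mul_assoc _ Z, hBZ,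
          Matrix.one_mul, sub_self]
      rw [hX, Matrix.mul_sub (1 - Q) (Z₀ * Z₀.transpose), hQZ, sub_zero, hY, Matrix.transpose_mul, hQ.one_sub.symm]
      simp only [Matrix.mul_assoc]
    have h2 : sqNorm (Y * Y.transpose) ≤ γ := by
      rw [hYY]
      exact ((hQ.one_sub.sqNorm_mul_le _).trans (hQ.one_sub.sqNorm_proj_mul_le _)).trans hγ
    -- Cauchy–Schwarz for the trace of a `k × k` matrix. It yields only a square root of `γ`, which
    -- suffices since `γ / n ^ 2` can be made arbitrarily small.
    have h4 : sqNorm Y ^ 2 ≤ k * sqNorm (Y.transpose * Y) := by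
      rw [sqNorm_eq_trace', Matrix.trace]
      refine sq_sum_le_card_mul_sum_sq.trans ?_
      rw [Finset.card_univ, Fintype.card_fin]
      refine mul_le_mul_of_nonneg_left (Finset.sum_le_sum fun i _ => ?_) (Nat.cast_nonneg k)
      exact Finset.single_le_sum (f := fun j => (Y.transpose * Y) i j ^ 2)
        (fun _ _ => sq_nonneg _) (Finset.mem_univ i)
    rw [sqNorm_transpose_mul_self] at h4
    exact h4.trans (mul_le_mul_of_nonneg_left h2 (Nat.cast_nonneg k))
  have h2 : sqNorm (Z * (M - R)) ≤ sqNorm Z * (γ / s ^ 2) :=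
    (sqNorm_mul_le_mul _ _).trans (mul_le_mul_of_nonneg_left (hMR.trans hν) (sqNorm_nonneg _))
  rw [hsplit]
  have := sqNorm_add_le_two ((1 - Q) * Z₀) (Z * (M - R))
  linarith

end Procrustes

/-! ### Singular values, operator norm and condition number. -/

section SingularValues

variable {n k : ℕ}

/-- The basis diagonalizes the composition of the adjoint with the map. Both the bound by the
largest and the bound by the smallest singular value are read off from this sum. -/
lemma sq_norm_toEuclideanLin (Z : Matrix (Fin n) (Fin k) ℝ) (x : EuclideanSpace ℝ (Fin k)) :
    ∃ b : OrthonormalBasis (Fin k) ℝ (EuclideanSpace ℝ (Fin k)),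
      ‖Matrix.toEuclideanLin Z x‖ ^ 2 =
        ∑ i : Fin k, (Matrix.toEuclideanLin Z).singularValues i ^ 2 * b.repr x i ^ 2 := by
  set T := Matrix.toEuclideanLin Z with hT
  have hk : Module.finrank ℝ (EuclideanSpace ℝ (Fin k)) = k := finrank_euclideanSpace_fin
  set b := T.isSymmetric_adjoint_comp_self.eigenvectorBasis hk with hb
  refine ⟨b, ?_⟩
  have h1 : ‖T x‖ ^ 2 = inner ℝ ((LinearMap.adjoint T ∘ₗ T) x) x := by
    rw [LinearMap.comp_apply, LinearMap.adjoint_inner_left, real_inner_self_eq_norm_sq]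
  rw [h1, ← b.repr.inner_map_map, PiLp.inner_apply]
  refine Finset.sum_congr rfl fun i _ => ?_
  rw [hb, LinearMap.IsSymmetric.eigenvectorBasis_apply_self_apply,
    ← LinearMap.sq_singularValues_fin]
  simp only [RCLike.ofReal_real_eq_id, id_eq, RCLike.inner_apply, conj_trivial]
  ring

lemma sq_norm_eq_sum_repr (b : OrthonormalBasis (Fin k) ℝ (EuclideanSpace ℝ (Fin k)))
    (x : EuclideanSpace ℝ (Fin k)) : ‖x‖ ^ 2 = ∑ i, b.repr x i ^ 2 := by
  rw [← b.repr.norm_map, EuclideanSpace.norm_sq_eq]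
  simp only [Real.norm_eq_abs, sq_abs]

lemma opNorm_nonneg (Z : Matrix (Fin n) (Fin k) ℝ) : 0 ≤ opNorm Z := norm_nonneg _

lemma norm_toEuclideanLin_le (Z : Matrix (Fin n) (Fin k) ℝ) (x : EuclideanSpace ℝ (Fin k)) :
    ‖Matrix.toEuclideanLin Z x‖ ≤ opNorm Z * ‖x‖ :=
  (LinearMap.toContinuousLinearMap (Matrix.toEuclideanLin Z)).le_opNorm x

lemma opNorm_le_singularValues_zero (Z : Matrix (Fin n) (Fin k) ℝ) :
    opNorm Z ≤ (Matrix.toEuclideanLin Z).singularValues 0 := by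
  have h0 := (Matrix.toEuclideanLin Z).singularValues_nonneg 0
  refine ContinuousLinearMap.opNorm_le_bound _ h0 fun x => ?_
  refine abs_le_of_sq_le_sq' ?_ (by positivity) |>.2
  obtain ⟨b, hb⟩ := sq_norm_toEuclideanLin Z x
  change ‖Matrix.toEuclideanLin Z x‖ ^ 2 ≤ _
  rw [hb, mul_pow, sq_norm_eq_sum_repr b, Finset.mul_sum]
  refine Finset.sum_le_sum fun i _ => mul_le_mul_of_nonneg_right ?_ (sq_nonneg _)
  exact pow_le_pow_left₀ ((Matrix.toEuclideanLin Z).singularValues_nonneg i)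
    ((Matrix.toEuclideanLin Z).singularValues_antitone (Nat.zero_le _)) 2

lemma singularValues_last_mul_le (Z : Matrix (Fin n) (Fin k) ℝ) (x : EuclideanSpace ℝ (Fin k)) :
    (Matrix.toEuclideanLin Z).singularValues (k - 1) ^ 2 * ‖x‖ ^ 2 ≤
      ‖Matrix.toEuclideanLin Z x‖ ^ 2 := by
  obtain ⟨b, hb⟩ := sq_norm_toEuclideanLin Z x
  rw [hb, sq_norm_eq_sum_repr b, Finset.mul_sum]
  refine Finset.sum_le_sum fun i _ => mul_le_mul_of_nonneg_right ?_ (sq_nonneg _)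
  exact pow_le_pow_left₀ ((Matrix.toEuclideanLin Z).singularValues_nonneg _)
    ((Matrix.toEuclideanLin Z).singularValues_antitone (by omega)) 2

lemma sqNorm_eq_sum_col {m p : ℕ} (M : Matrix (Fin m) (Fin p) ℝ) :
    sqNorm M = ∑ j, ‖WithLp.toLp 2 (M.col j)‖ ^ 2 := by
  rw [sqNorm, Finset.sum_comm]
  refine Finset.sum_congr rfl fun j _ => ?_
  rw [EuclideanSpace.norm_sq_eq]
  simp [Matrix.col]

lemma toEuclideanLin_col {m : ℕ} (Z : Matrix (Fin n) (Fin k) ℝ) (X : Matrix (Fin k) (Fin m) ℝ)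
    (j : Fin m) : WithLp.toLp 2 ((Z * X).col j) =
      Matrix.toEuclideanLin Z (WithLp.toLp 2 (X.col j)) := by
  rw [Matrix.toLpLin_apply]
  rfl

lemma sqNorm_mul_le_opNorm {m : ℕ} (Z : Matrix (Fin n) (Fin k) ℝ)
    (X : Matrix (Fin k) (Fin m) ℝ) : sqNorm (Z * X) ≤ opNorm Z ^ 2 * sqNorm X := by
  rw [sqNorm_eq_sum_col, sqNorm_eq_sum_col, Finset.mul_sum]
  refine Finset.sum_le_sum fun j _ => ?_
  rw [toEuclideanLin_col, ← mul_pow]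
  exact pow_le_pow_left₀ (norm_nonneg _) (norm_toEuclideanLin_le Z _) 2

lemma singularValues_last_mul_sqNorm_le {m : ℕ} (Z : Matrix (Fin n) (Fin k) ℝ)
    (X : Matrix (Fin k) (Fin m) ℝ) :
    (Matrix.toEuclideanLin Z).singularValues (k - 1) ^ 2 * sqNorm X ≤ sqNorm (Z * X) := by
  rw [sqNorm_eq_sum_col, sqNorm_eq_sum_col, Finset.mul_sum]
  refine Finset.sum_le_sum fun j _ => ?_
  rw [toEuclideanLin_col]
  exact singularValues_last_mul_le Z _

lemma opNorm_sq_le_sqNorm (Z : Matrix (Fin n) (Fin k) ℝ) : opNorm Z ^ 2 ≤ sqNorm Z := by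
  have h : opNorm Z ≤ Real.sqrt (sqNorm Z) := by
    refine ContinuousLinearMap.opNorm_le_bound _ (Real.sqrt_nonneg _) fun x => ?_
    refine abs_le_of_sq_le_sq' ?_ (by positivity) |>.2
    change ‖Matrix.toEuclideanLin Z x‖ ^ 2 ≤ _
    rw [mul_pow, Real.sq_sqrt (sqNorm_nonneg Z), EuclideanSpace.norm_sq_eq,
      EuclideanSpace.norm_sq_eq, sqNorm, Finset.sum_mul]
    refine Finset.sum_le_sum fun i _ => ?_
    simp only [Real.norm_eq_abs, sq_abs]
    rw [Matrix.toLpLin_apply]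
    exact Finset.sum_mul_sq_le_sq_mul_sq Finset.univ (fun j => Z i j) (fun j => x j)
  calc opNorm Z ^ 2 ≤ Real.sqrt (sqNorm Z) ^ 2 := pow_le_pow_left₀ (opNorm_nonneg Z) h 2
    _ = _ := Real.sq_sqrt (sqNorm_nonneg Z)

/-- Converts the assumption on the Frobenius norm of the Gram matrix into a lower bound of order `n`
for `opNorm Z ^ 2`. -/
lemma frobNorm_gram_le (hk : 1 ≤ k) (Z : Matrix (Fin n) (Fin k) ℝ) :
    frobNorm (Z * Z.transpose) ≤ k * opNorm Z ^ 2 := by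
  have h1 := sqNorm_mul_le_opNorm Z Z.transpose
  have h2 := sqNorm_mul_le_opNorm Z (1 : Matrix (Fin k) (Fin k) ℝ)
  have h3 : sqNorm (1 : Matrix (Fin k) (Fin k) ℝ) = k := by
    rw [sqNorm_eq_trace]; simp
  rw [Matrix.mul_one, h3] at h2
  rw [sqNorm_transpose] at h1
  rw [frobNorm_eq_sqrt_sqNorm]
  refine Real.sqrt_le_iff.2 ⟨by positivity, h1.trans ?_⟩
  have hk' : (1 : ℝ) ≤ k := by exact_mod_cast hk
  have h4 : 0 ≤ opNorm Z ^ 2 := sq_nonneg _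
  calc opNorm Z ^ 2 * sqNorm Z ≤ opNorm Z ^ 2 * (opNorm Z ^ 2 * k) :=
        mul_le_mul_of_nonneg_left h2 h4
    _ = (opNorm Z ^ 2) ^ 2 * k * 1 := by ring
    _ ≤ (opNorm Z ^ 2) ^ 2 * k * k := by gcongr
    _ = _ := by ring

lemma singularValues_last_pos (hk : 1 ≤ k) {Z : Matrix (Fin n) (Fin k) ℝ} (hZ : Z.rank = k) :
    0 < (Matrix.toEuclideanLin Z).singularValues (k - 1) := by
  rw [LinearMap.singularValues_pos_iff_lt_finrank_range]
  have h : Z.rank = Module.finrank ℝ (Matrix.toEuclideanLin Z).range := by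
    change _ = Module.finrank ℝ (Matrix.toLpLin 2 2 Z).range
    rw [Matrix.toLpLin_eq_toLin]
    exact Matrix.rank_eq_finrank_range_toLin _ _ _
  omega

lemma condNumber_pos (hk : 1 ≤ k) {Z : Matrix (Fin n) (Fin k) ℝ} (hZ : Z.rank = k) :
    0 < condNumber Z := by
  have h := singularValues_last_pos hk hZ
  exact div_pos (h.trans_le ((Matrix.toEuclideanLin Z).singularValues_antitone (Nat.zero_le _))) h

lemma opNorm_sq_div_mul_le (hk : 1 ≤ k) {Z : Matrix (Fin n) (Fin k) ℝ} (hZ : Z.rank = k)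
    {κ : ℝ} (hκ : condNumber Z ≤ κ) (m : ℕ) (X : Matrix (Fin k) (Fin m) ℝ) :
    opNorm Z ^ 2 / κ ^ 2 * sqNorm X ≤ sqNorm (Z * X) := by
  have hpos := singularValues_last_pos hk hZ
  have hκ0 := (condNumber_pos hk hZ).trans_le hκ
  refine le_trans (mul_le_mul_of_nonneg_right ?_ (sqNorm_nonneg X))
    (singularValues_last_mul_sqNorm_le Z X)
  rw [← div_pow]
  refine pow_le_pow_left₀ (div_nonneg (opNorm_nonneg Z) hκ0.le) ?_ 2
  rw [div_le_iff₀ hκ0]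
  rw [condNumber, div_le_iff₀ hpos, mul_comm] at hκ
  exact (opNorm_le_singularValues_zero Z).trans hκ

end SingularValues

/-! ### Deterministic propagation of the logit error. -/

section Initialization

lemma exists_small (a b t s : ℝ) (ht : 0 < t) (hs : 0 < s) :
    ∃ ε : ℝ, 0 < ε ∧ 16 * ε < s ∧ a * Real.sqrt (b * ε) + a * b * ε + ε ≤ t := by
  have hcont : Filter.Tendsto (fun ε : ℝ => a * Real.sqrt (b * ε) + a * b * ε + ε)
      (nhdsWithin 0 (Set.Ioi 0)) (nhds 0) := by
    have : Continuous fun ε : ℝ => a * Real.sqrt (b * ε) + a * b * ε + ε := by fun_prop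
    have h := (this.tendsto 0).mono_left (nhdsWithin_le_nhds (s := Set.Ioi 0))
    simpa using h
  have hcont' : Filter.Tendsto (fun ε : ℝ => 16 * ε) (nhdsWithin 0 (Set.Ioi 0)) (nhds 0) := by
    have : Continuous fun ε : ℝ => 16 * ε := by fun_prop
    have h := (this.tendsto 0).mono_left (nhdsWithin_le_nhds (s := Set.Ioi 0))
    simpa using h
  have hev := ((hcont.eventually (gt_mem_nhds ht)).and
    (hcont'.eventually (gt_mem_nhds hs))).and self_mem_nhdsWithin
  obtain ⟨ε, ⟨h1, h2⟩, h3⟩ := hev.exists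
  exact ⟨ε, h3, h2, h1.le⟩

/-- The initialization condition holds if the logits are estimated well enough. -/
theorem exists_initCondition {c₀ c : ℝ} (hc₀ : 0 < c₀) (hc : 0 < c) {k : ℕ} (hk : 1 ≤ k)
    (M₁ : ℝ) {κ : ℝ} (hκ0 : 0 < κ) :
    ∃ ε : ℝ, 0 < ε ∧ ∀ n : ℕ, 0 < n → ∀ (M₂ : ℝ) (α : Fin n → ℝ) (Z : Matrix (Fin n) (Fin k) ℝ),
      InParameterSpace M₁ M₂ α Z → Z.rank = k → condNumber Z ≤ κ →
      c₀ * (n : ℝ) ≤ frobNorm (Z * Z.transpose) →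
      ∀ (T G : Matrix (Fin n) (Fin n) ℝ) (α₀ : Fin n → ℝ) (Z₀ : Matrix (Fin n) (Fin k) ℝ),
        sqNorm (T - logitMatrix α Z) ≤ ε * (n : ℝ) ^ 2 → IsLeastSquares T α₀ →
        IsPSDProjection (centering n * (T - additivePart α₀) * centering n) G →
        IsTopFactor G Z₀ → InitCondition c M₁ α₀ α Z₀ Z := by
  have hkR : (1 : ℝ) ≤ k := by exact_mod_cast hk
  -- `s * n` bounds the squared smallest singular value from below, and `t * n ^ 2` below bounds the
  -- right side of the condition from below.
  set s := c₀ / (k * κ ^ 2) with hs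
  have hs0 : 0 < s := by positivity
  set t := c * Real.exp (-2 * M₁) * (c₀ / k) ^ 2 / κ ^ 4 with ht
  have ht0 : 0 < t := by positivity
  set b := 16 * (k : ℝ) + 16 * |M₁| / s ^ 2 with hb
  obtain ⟨ε, hε0, hεs, hεt⟩ := exists_small |M₁| b t (s ^ 2) ht0 (by positivity)
  refine ⟨ε, hε0, fun n hn M₂ α Z hpar hrank hκ hG₀ T G α₀ Z₀ hT hLS hPSD hTop => ?_⟩
  have hnR : (0 : ℝ) < n := by exact_mod_cast hn
  have hM := M₁_nonneg hpar hn
  rw [abs_of_nonneg hM] at hεt hb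
  have hkn : k ≤ n := by
    have := Matrix.rank_le_card_height Z
    rw [hrank, Fintype.card_fin] at this
    exact this
  set ρ := opNorm Z ^ 2 with hρ
  have hρn : c₀ / k * n ≤ ρ := by
    have := hG₀.trans (frobNorm_gram_le hk Z)
    rw [div_mul_eq_mul_div, div_le_iff₀ (by positivity)]
    linarith
  have hρ0 : 0 < ρ := lt_of_lt_of_le (by positivity) hρn
  have hZM : sqNorm Z ≤ n * (M₁ / 2) := by
    calc sqNorm Z ≤ ∑ _i : Fin n, M₁ / 2 := Finset.sum_le_sum fun i _ => hpar.latent_le i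
      _ = _ := by simp
  have hρM : ρ ≤ n * (M₁ / 2) := (opNorm_sq_le_sqNorm Z).trans hZM
  have hsn : ∀ (m : ℕ) (X : Matrix (Fin k) (Fin m) ℝ), s * n * sqNorm X ≤ sqNorm (Z * X) := by
    intro m X
    refine le_trans (mul_le_mul_of_nonneg_right ?_ (sqNorm_nonneg X))
      (opNorm_sq_div_mul_le hk hrank hκ m X)
    rw [le_div_iff₀ (by positivity)]
    refine le_trans (le_of_eq ?_) hρn
    rw [hs]
    field_simp
  obtain ⟨B, hBZ, hQ, hQk, hB⟩ := exists_leftInverse (s := s * n) (by positivity) hsn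
  have hGQ : Z * Z.transpose * (Z * B.transpose) = Z * Z.transpose := by
    have h1 : Z.transpose * (Z * B.transpose) = Z.transpose := by
      rw [← hQ.symm, ← Matrix.transpose_mul, Matrix.mul_assoc, hBZ, Matrix.mul_one]
    rw [Matrix.mul_assoc, h1]
  have h1 := sqNorm_psdProjection_sub_le hn α hpar.centered hPSD
  have h2 := hTop.sqNorm_gram_sub_le hk hkn hQ hQk hGQ
  -- The cone projection costs a factor `4`; truncation adds an error no larger than that of `G`,
  -- and the triangle inequality for squares gives another `4`.
  have hγ : sqNorm (Z₀ * Z₀.transpose - Z * Z.transpose) ≤ 16 * ε * (n : ℝ) ^ 2 := by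
    have h3 := sqNorm_add_le_two (Z₀ * Z₀.transpose - G) (G - Z * Z.transpose)
    rw [sub_add_sub_cancel] at h3
    linarith
  have hdist := procrustesDist_sq_le_of_gram (by positivity) hBZ hQ hB hγ (by
    rw [mul_pow]; gcongr)
  have hα := (hLS.two_mul_sqNorm_rowConst_sub_le (α := α) hn hpar.centered).trans hT
  have hdist' : procrustesDist Z₀ Z ^ 2 ≤ n * (2 * Real.sqrt (b * ε) + 2 * b * ε) := by
    refine hdist.trans ?_
    have h3 : Real.sqrt (k * (16 * ε * (n : ℝ) ^ 2)) ≤ n * Real.sqrt (b * ε) := by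
      refine Real.sqrt_le_iff.2 ⟨by positivity, ?_⟩
      rw [mul_pow, Real.sq_sqrt (by positivity), hb]
      have : 0 ≤ 16 * M₁ / s ^ 2 * ε * (n : ℝ) ^ 2 := by positivity
      nlinarith
    have h4 : sqNorm Z * (16 * ε * (n : ℝ) ^ 2 / (s * n) ^ 2) ≤ n * (b * ε) := by
      have h5 : 16 * ε * (n : ℝ) ^ 2 / (s * n) ^ 2 = 16 * ε / s ^ 2 := by
        field_simp
      rw [h5]
      calc _ ≤ n * (M₁ / 2) * (16 * ε / s ^ 2) :=
            mul_le_mul_of_nonneg_right hZM (by positivity)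
        _ = n * ((8 * M₁ / s ^ 2) * ε) := by ring
        _ ≤ n * (b * ε) := by
          gcongr
          rw [hb]
          have h6 : 0 ≤ 8 * M₁ / s ^ 2 := by positivity
          have h7 : 16 * M₁ / s ^ 2 = 2 * (8 * M₁ / s ^ 2) := by ring
          rw [h7]
          linarith
    linarith
  rw [InitCondition, initError, frobNorm_sq, ← hρ]
  have hb0 : 0 ≤ b := by positivity
  have hleft : ρ * procrustesDist Z₀ Z ^ 2 + 2 * sqNorm (rowConst (α₀ - α)) ≤
      t * (n : ℝ) ^ 2 := by
    have h3 : ρ * procrustesDist Z₀ Z ^ 2 ≤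
        n * (M₁ / 2) * (n * (2 * Real.sqrt (b * ε) + 2 * b * ε)) :=
      mul_le_mul hρM hdist' (sq_nonneg _) (by positivity)
    have h4 := mul_le_mul_of_nonneg_right hεt (sq_nonneg (n : ℝ))
    linarith
  refine hleft.trans ?_
  have hcond := condNumber_pos hk hrank
  have h3 : opNorm Z ^ 4 = ρ ^ 2 := by rw [hρ]; ring
  rw [h3, ht, div_mul_eq_mul_div, mul_assoc, ← mul_pow]
  gcongr

end Initialization

/-! ### Existence of an output. -/

section Existence

variable {n k : ℕ}

lemma exists_isSingularValueThreshold {A : Matrix (Fin n) (Fin n) ℝ} (hA : A.transpose = A)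
    (τ : ℝ) : ∃ B, IsSingularValueThreshold A τ B := by
  obtain ⟨O, hO, d, hd⟩ := exists_diagonalization hA
  have hOO : O.transpose * O = 1 := (Matrix.mem_orthogonalGroup_iff' _ ℝ).1 hO
  have hOO' : O * O.transpose = 1 := (Matrix.mem_orthogonalGroup_iff _ ℝ).1 hO
  -- An eigendecomposition becomes a singular value decomposition once the signs of the eigenvalues
  -- are moved into the right factor.
  set σ : Fin n → ℝ := fun i => if 0 ≤ d i then 1 else -1 with hσ
  refine ⟨_, O, hO, O * Matrix.diagonal σ, ?_, fun i => |d i|, fun i => abs_nonneg _, ?_, rfl⟩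
  · rw [Matrix.mem_orthogonalGroup_iff]
    change O * Matrix.diagonal σ * (O * Matrix.diagonal σ).transpose = 1
    rw [Matrix.transpose_mul, Matrix.diagonal_transpose, Matrix.mul_assoc,
      ← Matrix.mul_assoc (Matrix.diagonal σ), Matrix.diagonal_mul_diagonal]
    have : (fun i => σ i * σ i) = fun _ => (1 : ℝ) := by
      funext i; simp only [hσ]; split_ifs <;> norm_num
    rw [this, Matrix.diagonal_one, Matrix.one_mul, hOO']
  · rw [Matrix.transpose_mul, Matrix.diagonal_transpose, Matrix.mul_assoc,
      ← Matrix.mul_assoc (Matrix.diagonal _) (Matrix.diagonal σ), Matrix.diagonal_mul_diagonal,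
      ← Matrix.mul_assoc, hd]
    congr 3
    funext i
    simp only [hσ]
    split_ifs with h
    · rw [abs_of_nonneg h, mul_one]
    · rw [abs_of_neg (not_le.1 h)]; ring

lemma posSemidef_diagonalization {O : Matrix (Fin n) (Fin n) ℝ} {d : Fin n → ℝ}
    (hd : ∀ i, 0 ≤ d i) : (O * Matrix.diagonal d * O.transpose).PosSemidef := by
  have h := (Matrix.PosSemidef.diagonal (d := d) (fun i => hd i)).mul_mul_conjTranspose_same O
  rwa [Matrix.conjTranspose_eq_transpose_of_trivial] at h

lemma diag_conj_nonneg {H : Matrix (Fin n) (Fin n) ℝ} (hH : H.PosSemidef)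
    (O : Matrix (Fin n) (Fin n) ℝ) (i : Fin n) : 0 ≤ (O.transpose * H * O) i i := by
  have h := hH.conjTranspose_mul_mul_same O
  rw [Matrix.conjTranspose_eq_transpose_of_trivial] at h
  exact h.diag_nonneg

/-- Take the positive part in an eigenbasis of `R`. A competitor has nonnegative diagonal entries in
that basis, so it does no better on the diagonal, and its off-diagonal entries only add to the
distance. -/
lemma exists_isPSDProjection {R : Matrix (Fin n) (Fin n) ℝ} (hR : R.transpose = R) :
    ∃ G, IsPSDProjection R G := by
  obtain ⟨O, hO, d, rfl⟩ := exists_diagonalization hR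
  have hO' := transpose_mem_orthogonalGroup hO
  have hOO : O.transpose * O = 1 := (Matrix.mem_orthogonalGroup_iff' _ ℝ).1 hO
  refine ⟨O * Matrix.diagonal (fun i => max (d i) 0) * O.transpose,
    posSemidef_diagonalization fun i => le_max_right _ _, fun H hH => ?_⟩
  rw [frobNorm_le_iff, ← Matrix.sub_mul, ← Matrix.mul_sub, Matrix.diagonal_sub,
    sqNorm_mul_orthogonal hO', sqNorm_orthogonal_mul hO]
  have h1 : sqNorm (H - O * Matrix.diagonal d * O.transpose) =
      sqNorm (O.transpose * H * O - Matrix.diagonal d) := by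
    rw [← sqNorm_mul_orthogonal hO, ← sqNorm_orthogonal_mul hO', Matrix.sub_mul, Matrix.mul_sub,
      Matrix.mul_assoc (O * Matrix.diagonal d), hOO, Matrix.mul_one, ← Matrix.mul_assoc O.transpose O,
      hOO, Matrix.one_mul, ← Matrix.mul_assoc]
  rw [h1]
  refine Finset.sum_le_sum fun i _ => ?_
  have h2 : ∑ j, Matrix.diagonal (fun i => max (d i) 0 - d i) i j ^ 2 = (max (d i) 0 - d i) ^ 2 := by
    rw [Finset.sum_eq_single i]
    · rw [Matrix.diagonal_apply_eq]
    · intro j _ hj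
      rw [Matrix.diagonal_apply_ne _ (Ne.symm hj)]; norm_num
    · simp
  rw [h2]
  refine le_trans ?_ (Finset.single_le_sum
    (f := fun j => (O.transpose * H * O - Matrix.diagonal d) i j ^ 2)
    (fun _ _ => sq_nonneg _) (Finset.mem_univ i))
  rw [Matrix.sub_apply, Matrix.diagonal_apply_eq]
  have h3 := diag_conj_nonneg hH O i
  rcases le_total (d i) 0 with h | h
  · rw [max_eq_right h]
    nlinarith
  · rw [max_eq_left h, sub_self, zero_pow two_ne_zero]
    exact sq_nonneg _

lemma exists_isTopFactor {G : Matrix (Fin n) (Fin n) ℝ} (hG : G.PosSemidef) :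
    ∃ Z₀ : Matrix (Fin n) (Fin k) ℝ, IsTopFactor G Z₀ := by
  have hGs : G.transpose = G := by
    have := hG.isHermitian
    rwa [Matrix.IsHermitian, Matrix.conjTranspose_eq_transpose_of_trivial] at this
  obtain ⟨O, hO, d, rfl⟩ := exists_diagonalization hGs
  have hOO : O.transpose * O = 1 := (Matrix.mem_orthogonalGroup_iff' _ ℝ).1 hO
  have hOO' : O * O.transpose = 1 := (Matrix.mem_orthogonalGroup_iff _ ℝ).1 hO
  have hd : ∀ i, 0 ≤ d i := by
    intro i
    have h := diag_conj_nonneg hG O i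
    rwa [← Matrix.mul_assoc, ← Matrix.mul_assoc, hOO, Matrix.one_mul, Matrix.mul_assoc, hOO,
      Matrix.mul_one, Matrix.diagonal_apply_eq] at h
  set σ := Tuple.sort fun i => - d i with hσ
  have hmono := Tuple.monotone_sort fun i => - d i
  refine ⟨Matrix.of fun i l => if h : (l : ℕ) < n then
    O.submatrix id σ i ⟨l, h⟩ * Real.sqrt (d (σ ⟨l, h⟩)) else 0,
    O.submatrix id σ, ?_, d ∘ σ, fun i => hd _, ?_, ?_, fun i l => rfl⟩
  · rw [Matrix.mem_orthogonalGroup_iff]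
    change O.submatrix id σ * (O.submatrix id σ).transpose = 1
    rw [Matrix.transpose_submatrix, Matrix.submatrix_mul_equiv, hOO']
    rfl
  · intro i j hij
    have := hmono hij
    simp only [Function.comp_apply] at this ⊢
    linarith
  · rw [← Matrix.submatrix_diagonal_equiv, Matrix.transpose_submatrix, Matrix.submatrix_mul_equiv,
      Matrix.submatrix_mul_equiv]
    rfl

/-- The initialization algorithm has an output for every symmetric matrix. -/
theorem exists_isSVTInit {A : Matrix (Fin n) (Fin n) ℝ} (hA : A.transpose = A) (hn : 0 < n)
    (M₁ τ : ℝ) : ∃ (α₀ : Fin n → ℝ) (Z₀ : Matrix (Fin n) (Fin k) ℝ), IsSVTInit A M₁ τ α₀ Z₀ := by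
  obtain ⟨P, hP⟩ := exists_isSingularValueThreshold hA τ
  obtain ⟨α₀, hα₀⟩ := exists_isLeastSquares (symLogit (clip M₁ P))
  have hT : (symLogit (clip M₁ P) - additivePart α₀).transpose =
      symLogit (clip M₁ P) - additivePart α₀ := by
    ext i j
    simp only [Matrix.transpose_apply, Matrix.sub_apply, symLogit, Matrix.of_apply,
      additivePart_apply]
    rw [add_comm (clip M₁ P j i), add_comm (α₀ j)]
  have hJ := (isProj_centering hn).symm
  obtain ⟨G, hG⟩ := exists_isPSDProjection
    (R := centering n * (symLogit (clip M₁ P) - additivePart α₀) * centering n) (by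
      rw [Matrix.transpose_mul, Matrix.transpose_mul, hJ, hT, Matrix.mul_assoc])
  obtain ⟨Z₀, hZ₀⟩ := exists_isTopFactor (k := k) hG.1
  exact ⟨α₀, Z₀, P, G, hP, hα₀, hG, hZ₀⟩

end Existence

end LatentSpace

/-! ### Assembly of the probability bound. -/

theorem proposition4p1 :
    ∃ c₁ : ℝ, 0 < c₁ ∧
      ∀ c₀ c : ℝ, 0 < c₀ → 0 < c → ∀ k : ℕ, 1 ≤ k → ∀ M₁ κ : ℝ,
        ∃ δ : ℝ, 0 < δ ∧ ∃ N : ℕ, ∀ n : ℕ, N ≤ n →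
          ∀ (M₂ : ℝ) (α : Fin n → ℝ) (Z : Matrix (Fin n) (Fin k) ℝ),
            LatentSpace.InParameterSpace M₁ M₂ α Z →
            Z.rank = k →
            LatentSpace.condNumber Z ≤ κ →
            c₀ * (n : ℝ) ≤ LatentSpace.frobNorm (Z * Z.transpose) →
            ∀ τ : ℝ, 1.1 * Real.sqrt (n : ℝ) ≤ τ → τ ≤ δ * (n : ℝ) →
            ∀ {Ω : Type*} [MeasurableSpace Ω] (μ : MeasureTheory.Measure Ω)
              [MeasureTheory.IsProbabilityMeasure μ] (A : Ω → Matrix (Fin n) (Fin n) ℝ),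
              LatentSpace.IsBernoulliNetwork μ (LatentSpace.logitMatrix α Z) A →
              1 - (n : ℝ) ^ (-c₁) ≤
                μ.real {ω |
                  (∃ (α₀ : Fin n → ℝ) (Z₀ : Matrix (Fin n) (Fin k) ℝ),
                    LatentSpace.IsSVTInit (A ω) M₁ τ α₀ Z₀) ∧
                  ∀ (α₀ : Fin n → ℝ) (Z₀ : Matrix (Fin n) (Fin k) ℝ),
                    LatentSpace.IsSVTInit (A ω) M₁ τ α₀ Z₀ →
                    LatentSpace.InitCondition c M₁ α₀ α Z₀ Z} := by
  refine ⟨1 / 2, by norm_num, fun c₀ c hc₀ hc k hk M₁ κ => ?_⟩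
  -- For `κ ≤ 0` no admissible parameters exist, as the condition number is positive.
  rcases le_or_gt κ 0 with hκ | hκ
  · refine ⟨1, one_pos, 0, fun n _ M₂ α Z _ hrank hcond => ?_⟩
    exact absurd ((LatentSpace.condNumber_pos hk hrank).trans_le hcond) (not_lt.2 hκ)
  obtain ⟨ε, hε, hinit⟩ := LatentSpace.exists_initCondition hc₀ hc hk M₁ hκ
  obtain ⟨δ, hδ, m, N, hest⟩ := LatentSpace.exists_logit_estimate k M₁ hε
  set C := 8 * (2 * (m + 1) + 1) ^ (4 * (m + 1) + 2) with hC
  -- The second summand is what the moment bound requires; `C ^ 2 ≤ n` turns the failure probability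
  -- `C / n` into at most `n ^ (-1/2)`.
  refine ⟨δ, hδ, N + 2 * (m + 1) ^ (2 * (m + 1) + 1) + C ^ 2 + 1, ?_⟩
  intro n hn M₂ α Z hpar hrank hcond hG τ hτ1 hτ2 Ω _ μ _ A hA
  have hn0 : 0 < n := by omega
  have hnR : (0 : ℝ) < n := by exact_mod_cast hn0
  have : Nonempty (Fin n) := ⟨⟨0, hn0⟩⟩
  set Θ := LatentSpace.logitMatrix α Z with hΘ
  have hmat := LatentSpace.sym2Matrix_networkNoise hA (LatentSpace.logitMatrix_symm α Z)
  have hbad := (LatentSpace.isNoise_networkNoise hA).measure_trace_pow_gt_le (m + 1)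
    (by rw [Fintype.card_fin]; omega)
  simp only [hmat, Fintype.card_fin] at hbad
  set bad : Set Ω := {ω | 2 * (n : ℝ) ^ (m + 1 + 1) <
    ((A ω - LatentSpace.meanMatrix Θ) ^ (2 * (m + 1))).trace} with hbaddef
  set good : Set Ω := {ω |
    (∃ (α₀ : Fin n → ℝ) (Z₀ : Matrix (Fin n) (Fin k) ℝ),
      LatentSpace.IsSVTInit (A ω) M₁ τ α₀ Z₀) ∧
    ∀ (α₀ : Fin n → ℝ) (Z₀ : Matrix (Fin n) (Fin k) ℝ),
      LatentSpace.IsSVTInit (A ω) M₁ τ α₀ Z₀ →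
      LatentSpace.InitCondition c M₁ α₀ α Z₀ Z} with hgooddef
  -- Covering the space and using subadditivity avoids any question of measurability of the good
  -- event.
  have hcover : good ∪ bad = Set.univ := by
    refine Set.eq_univ_of_forall fun ω => or_iff_not_imp_right.2 fun hω => ?_
    have htr := hω
    rw [hbaddef, Set.mem_ofPred_eq, not_lt] at htr
    rw [hgooddef, Set.mem_ofPred_eq]
    have hAs : (A ω).transpose = A ω := by
      ext i j; exact hA.symm ω j i
    have hWs : (A ω - LatentSpace.meanMatrix Θ).transpose = A ω - LatentSpace.meanMatrix Θ := by
      rw [← hmat ω]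
      ext i j
      simp only [LatentSpace.sym2Matrix, Matrix.transpose_apply, Matrix.of_apply, Sym2.eq_swap]
    refine ⟨LatentSpace.exists_isSVTInit hAs hn0 M₁ τ, ?_⟩
    rintro α₀ Z₀ ⟨P, G, hP, hLS, hPSD, hTop⟩
    exact hinit n hn0 M₂ α Z hpar hrank hcond hG _ G α₀ Z₀
      (hest n (by omega) M₂ α Z hpar τ hτ1 hτ2 (A ω) P hWs htr hP) hLS hPSD hTop
  have hunion := measureReal_union_le (μ := μ) good bad
  rw [hcover, probReal_univ] at hunion
  have hsmall : (C : ℝ) / n ≤ (n : ℝ) ^ (-(1 / 2) : ℝ) := by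
    rw [Real.rpow_neg hnR.le, ← Real.sqrt_eq_rpow, div_le_iff₀ hnR]
    have h1 : (C : ℝ) ≤ Real.sqrt n := by
      apply Real.le_sqrt_of_sq_le
      have : C ^ 2 ≤ n := by omega
      exact_mod_cast this
    have h2 : (Real.sqrt n)⁻¹ * (n : ℝ) = Real.sqrt n := by
      have h3 := Real.sqrt_pos.2 hnR
      have h4 := Real.mul_self_sqrt hnR.le
      field_simp
      rw [sq, h4]
    rw [h2]
    exact h1
  have hC' : 8 * (2 * ((m + 1 : ℕ) : ℝ) + 1) ^ (4 * (m + 1) + 2) / (n : ℝ) = C / n := by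
    rw [hC]; push_cast; rfl
  rw [hC'] at hbad
  linarith
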